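/- Let $\mathbb K$ be an algebraically closed field of characteristic zero, $V$ a $\mathbb K$-vector space of countably infinite dimension with basis $E$, and $E=\bigcup_n E_n$ a filtration by finite subsets. Let $\mathbf G(E)$ be the group of automorphisms of $V$ fixing all but finitely many elements of $E$; it is an ind-group through $\mathbf G(E)=\bigcup_n GL(\langle E_n\rangle)$. Let $\mathbf H(E)$ be its subgroup of elements diagonal in $E$. A splitting Borel subgroup containing $\mathbf H(E)$ is a subgroup $\mathbf B\supset\mathbf H(E)$ which is maximal among the closed connected ind-subgroups all of whose algebraic subgroups are solvable. A generalized flag is a set $\mathcal F$ of subspaces of $V$, totally ordered by inclusion, such that every $F\in\mathcal F$ has an immediate predecessor or an immediate successor in $\mathcal F$ and every nonzero $v\in V$ lies in $F''\setminus F'$ for some pair $F'\subset F''$ of consecutive elements of $\mathcal F$. It is compatible with a basis $L$ if there is a map $\sigma$ from $L$ to the ordered set of pairs of consecutive elements with $F'=\langle e\in L:\sigma(e)<(F',F'')\rangle$ and $F''=\langle e\in L:\sigma(e)\le(F',F'')\rangle$ for all such pairs, and weakly compatible with $E$ if it is compatible with a basis containing all but finitely many elements of $E$. Generalized flags $\mathcal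 F,\mathcal G$ are $E$-commensurable if both are weakly compatible with $E$ and there are an isomorphism of ordered sets $\phi:\mathcal F\to\mathcal G$ and a finite-dimensional subspace $U\subset V$ with $\phi(F)+U=F+U$ and $\dim\phi(F)\cap U=\dim F\cap U$ for all $F\in\mathcal F$; such a $\phi$ is called a commensuration. Let $A$ be a totally ordered set. For a surjective map $\sigma:E\to A$ put $F'_{\sigma,\alpha}=\langle e\in E:\sigma(e)<\alpha\rangle$, $F''_{\sigma,\alpha}=\langle e\in E:\sigma(e)\le\alpha\rangle$ and $\mathcal F_\sigma=\{F'_{\sigma,\alpha},F''_{\sigma,\alpha}:\alpha\in A\}$. Fix a surjective $\sigma_0:E\to A$ and let $\mathcal F=\mathcal F_{\sigma_0}$, let $\mathbf P_{\mathcal F}\subset\mathbf G(E)$ be the stabilizer of $\mathcal F$, and let $\mathbf{Fl}(\mathcal F,E)$ be the set of generalized flags $E$-commensurable with $\mathcal F$, with its ind-variety structure as the direct limit of the flag varieties $\mathrm{Fl}(\mathcal F,E_n)$: the points of $\mathrm{Fl}(\mathcal F,E_n)$ are the families of subspaces $M'_\alpha\subset M''_\alpha$ ($\alpha\in A$) of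 $\langle E_n\rangle$ with $\dim M'_\alpha=\dim F'_{\sigma_0,\alpha}\cap\langle E_n\rangle$, $\dim M''_\alpha=\dim F''_{\sigma_0,\alpha}\cap\langle E_n\rangle$, and $M''_\alpha\subset M'_\beta$ for $\alpha<\beta$; such a family is identified with the generalized flag consisting of the spaces $M'_\alpha\oplus\langle e\in E\setminus E_n:\sigma_0(e)<\alpha\rangle$ and $M''_\alpha\oplus\langle e\in E\setminus E_n:\sigma_0(e)\le\alpha\rangle$. Let $\mathbf W(E)$ be the group of permutations of $E$ moving only finitely many elements, let $\mathbf W(E)\cdot\sigma_0=\{\sigma_0\circ w^{-1}:w\in\mathbf W(E)\}$, and let $\mathbf W_{\mathbf P}(E)=\{w\in\mathbf W(E):\sigma_0\circ w^{-1}=\sigma_0\}$. Let $\mathbf B$ be any splitting Borel subgroup of $\mathbf G(E)$ containing $\mathbf H(E)$. Then $\mathbf B$ is the stabilizer in $\mathbf G(E)$ of the generalized flag $\{F'_{0,e},F''_{0,e}:e\in E\}$, $F'_{0,e}=\langle e'\in E:e'\prec_{\mathbf B}e\rangle$, $F''_{0,e}=\langle e'\in E:e'\preceq_{\mathbf B}e\rangle$,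 for a unique total order $\preceq_{\mathbf B}$ on $E$. Let $n_{\mathrm{inv}}(\sigma)$ be the (possibly infinite) number of pairs $(e,e')$ with $e\prec_{\mathbf B}e'$ and $\sigma(e)>\sigma(e')$. Write $\sigma\le\tau$ if there is a chain $\sigma=\tau_0,\tau_1,\dots,\tau_k=\tau$ ($k\ge0$) where each $\tau_{i+1}$ is obtained from $\tau_i$ by exchanging its values at two elements $e\prec_{\mathbf B}e'$ of $E$ with $\tau_i(e)<\tau_i(e')$. For $\mathcal G\in\mathbf{Fl}(\mathcal F,E)$ and a commensuration $\phi:\mathcal F\to\mathcal G$ put $G''_\alpha=\phi(F''_{\sigma_0,\alpha})$ and $\sigma_{\mathcal G}(e)=\min\{\alpha\in A:G''_\alpha\cap F''_{0,e}\ne G''_\alpha\cap F'_{0,e}\}$. (a) The map $g\mapsto g\mathcal F$ induces an isomorphism of ind-varieties $\mathbf G(E)/\mathbf P_{\mathcal F}\cong\mathbf{Fl}(\mathcal F,E)$, the map $w\mapsto\sigma_0\circ w^{-1}$ induces a bijection $\mathbf W(E)/\mathbf W_{\mathbf P}(E)\cong\mathbf W(E)\cdot\sigma_0$, and $$\mathbf{Fl}(\mathcal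 F,E)=\bigsqcup_{\sigma\in\mathbf W(E)\cdot\sigma_0}\mathbf B\mathcal F_\sigma=\bigsqcup_{w\in\mathbf W(E)/\mathbf W_{\mathbf P}(E)}\mathbf B\mathcal F_{\sigma_0\circ w^{-1}}.$$ (b) For $\sigma\in\mathbf W(E)\cdot\sigma_0$, a generalized flag $\mathcal G\in\mathbf{Fl}(\mathcal F,E)$ belongs to $\mathbf B\mathcal F_\sigma$ if and only if $\sigma_{\mathcal G}=\sigma$. (c) For $\sigma\in\mathbf W(E)\cdot\sigma_0$, the orbit $\mathbf B\mathcal F_\sigma$ is a locally closed ind-subvariety of $\mathbf{Fl}(\mathcal F,E)$ isomorphic to the affine space $\mathbb A^{n_{\mathrm{inv}}(\sigma)}$, where $\mathbb A^\infty=\bigcup_n\mathbb A^n$ if $n_{\mathrm{inv}}(\sigma)$ is infinite. (d) For $\sigma,\tau\in\mathbf W(E)\cdot\sigma_0$, the inclusion $\mathbf B\mathcal F_\sigma\subset\overline{\mathbf B\mathcal F_\tau}$ holds if and only if $\sigma\le\tau$. -/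

import Mathlib

open Module Topology

namespace GenFlag

/-! ## Varieties and ind-varieties as spaces with functions -/

/-- A set `X` with a topology and, for `U ⊆ X`, a predicate singling out the `K`-valued functions
that are regular on `U` (only the values on `U` matter). Over an algebraically closed field the
classical varieties and their morphisms are described this way. -/
structure FunSpace (K : Type*) (X : Type*) where
  top : TopologicalSpace X
  IsReg : Set X → (X → K) → Prop

/-- A morphism: continuous, and pulling back regular functions to regular functions. -/
def FunSpace.IsMor {K X Y : Type*} (S : FunSpace K X) (T : FunSpace K Y) (f : X → Y) : Prop :=
  Continuous[S.top, T.top] f ∧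
    ∀ (U : Set Y) (h : Y → K), IsOpen[T.top] U → T.IsReg U h → S.IsReg (f ⁻¹' U) (h ∘ f)

/-- The structure induced along an injection `j`: subspace topology, and regular functions are
those that are locally restrictions of regular functions of the ambient space. -/
def FunSpace.induced {K X Y : Type*} (S : FunSpace K X) (j : Y → X) : FunSpace K Y where
  top := TopologicalSpace.induced j S.top
  IsReg U f := ∀ y ∈ U, ∃ (W : Set X) (h : X → K), IsOpen[S.top] W ∧ j y ∈ W ∧ S.IsReg W h ∧
    ∀ z ∈ U, j z ∈ W → f z = h (j z)

/-- The quotient structure along a map `π : X → Z`, on a set `Y` that is identified by the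
injection `j : Y → Z` with the image of `π`: a set is open iff its preimage in `X` is open, a
function is regular iff its pullback to `X` is regular. -/
def FunSpace.quot {K X Y Z : Type*} (S : FunSpace K X) (π : X → Z) (j : Y → Z) :
    FunSpace K Y where
  top := TopologicalSpace.induced j (TopologicalSpace.coinduced π S.top)
  IsReg U f := ∃ h : X → K, S.IsReg (π ⁻¹' (j '' U)) h ∧ ∀ x, ∀ y ∈ U, π x = j y → h x = f y

/-- The Zariski structure on a set `X` with coordinates `c : X → (s → K)`: the basic open sets are
the non-vanishing loci of polynomials in the coordinates, and regular functions are locally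
quotients of polynomials in the coordinates. -/
def zariski {K : Type*} [Field K] {X s : Type*} (c : X → s → K) : FunSpace K X where
  top := TopologicalSpace.generateFrom
    {U | ∃ p : MvPolynomial s K, U = {x | MvPolynomial.eval (c x) p ≠ 0}}
  IsReg U f := ∀ x ∈ U, ∃ p q : MvPolynomial s K, MvPolynomial.eval (c x) q ≠ 0 ∧
    ∀ y ∈ U, MvPolynomial.eval (c y) q ≠ 0 →
      f y = MvPolynomial.eval (c y) p / MvPolynomial.eval (c y) q

/-- An exhaustion of `X` by subsets, each one with a structure of a space with functions. -/
structure IndSpace (K : Type*) (X : Type*) where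
  piece : ℕ → Set X
  str : ∀ n, FunSpace K (piece n)

/-- The direct limit topology: a set is open iff its trace on every piece is open. -/
@[reducible]
def IndSpace.top {K X : Type*} (S : IndSpace K X) : TopologicalSpace X :=
  ⨆ n, TopologicalSpace.coinduced (Subtype.val : S.piece n → X) (S.str n).top

/-- A morphism of ind-varieties: every piece is mapped into some piece, by a morphism. -/
def IndSpace.IsMor {K X Y : Type*} (S : IndSpace K X) (T : IndSpace K Y) (f : X → Y) : Prop :=
  ∀ n, ∃ (m : ℕ) (h : Set.MapsTo f (S.piece n) (T.piece m)),
    (S.str n).IsMor (T.str m) (h.restrict f (S.piece n) (T.piece m))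

def IndSpace.IsIso {K X Y : Type*} (S : IndSpace K X) (T : IndSpace K Y) (f : X ≃ Y) : Prop :=
  S.IsMor T f ∧ T.IsMor S f.symm

/-- The structure induced on a subset `Z`, with pieces `Z ∩ Xₙ`. -/
def IndSpace.sub {K X : Type*} (S : IndSpace K X) (Z : Set X) : IndSpace K Z where
  piece n := {z | (z : X) ∈ S.piece n}
  str n := (S.str n).induced fun z => ⟨z.1.1, z.2⟩

/-- The points of the affine space `𝔸^N` for `N ≤ ∞`: finitely supported sequences that vanish
from the index `N` on. -/
def AffineSpc (K : Type*) [Field K] (N : ℕ∞) : Type _ :=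
  {x : ℕ →₀ K // ∀ i : ℕ, N ≤ (i : ℕ∞) → x i = 0}

/-- `𝔸^N`, exhausted by the subspaces `𝔸^(min n N)` of points with coordinates only in places
`< n`. For finite `N` the exhaustion is stationary. -/
def affineInd (K : Type*) [Field K] (N : ℕ∞) : IndSpace K (AffineSpc K N) where
  piece n := {x | ∀ i, n ≤ i → x.1 i = 0}
  str _ := zariski fun x (i : ℕ) => x.1.1 i

section

variable {K : Type*} [Field K] {V : Type*} [AddCommGroup V] [Module K V] {ι : Type*}

/-! ## The ind-group `GL(∞)` of a basis -/

/-- `G(E)`: the automorphisms of `V` that fix all but finitely many vectors of the basis. -/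
def GLInf (b : Basis ι K V) : Subgroup (V ≃ₗ[K] V) where
  carrier := {g | {i | g (b i) ≠ b i}.Finite}
  one_mem' := by simp
  mul_mem' := by
    intro g h hg hh
    refine (hg.union hh).subset fun i hi => ?_
    by_contra hc
    simp only [Set.mem_union, Set.mem_ofPred_eq, not_or, not_not] at hc
    exact hi (by rw [LinearEquiv.mul_apply, hc.2, hc.1])
  inv_mem' := by
    intro g hg
    refine Set.Finite.subset hg fun i hi hc => hi ?_
    conv_lhs => rw [← hc]
    exact g.symm_apply_apply (b i)

/-- `G(I) = GL(⟨I⟩)` for a finite set `I` of basis vectors, as a subset of `G(E)`. -/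
def glPiece (b : Basis ι K V) (I : Finset ι) : Set (GLInf b) :=
  {g | (∀ i ∉ I, g.1 (b i) = b i) ∧ ∀ i ∈ I, g.1 (b i) ∈ Submodule.span K (b '' (I : Set ι))}

/-- The ind-variety structure `G(E) = ⋃ G(Eₙ)`; the coordinates on `G(Eₙ)` are the matrix
entries. -/
noncomputable def glInd (b : Basis ι K V) (E : ℕ → Finset ι) : IndSpace K (GLInf b) where
  piece n := glPiece b (E n)
  str _ := zariski fun g (p : ι × ι) => b.repr (g.1.1 (b p.2)) p.1

/-- `g` is diagonal in the basis, i.e. `g` belongs to the splitting Cartan subgroup `H(E)`. -/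
def IsDiag (b : Basis ι K V) (g : GLInf b) : Prop := ∀ i, ∃ c : K, g.1 (b i) = c • b i

/-- Every algebraic subgroup of `B` (a closed subgroup contained in some `G(Eₙ)`) is solvable. -/
def IsLocallySolvable (b : Basis ι K V) (E : ℕ → Finset ι) (B : Subgroup (GLInf b)) : Prop :=
  ∀ Q : Subgroup (GLInf b), Q ≤ B → (∃ n, (Q : Set (GLInf b)) ⊆ glPiece b (E n)) →
    IsClosed[(glInd b E).top] (Q : Set (GLInf b)) → Group.IsSolvable Q

/-- A splitting Borel subgroup containing `H(E)`: maximal among the closed, connected, locally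
solvable ind-subgroups that contain `H(E)`. -/
def IsSplittingBorel (b : Basis ι K V) (E : ℕ → Finset ι) (B : Subgroup (GLInf b)) : Prop :=
  Maximal (fun Q : Subgroup (GLInf b) =>
    (∀ g, IsDiag b g → g ∈ Q) ∧
    IsClosed[(glInd b E).top] (Q : Set (GLInf b)) ∧
    @IsConnected _ (glInd b E).top (Q : Set (GLInf b)) ∧
    IsLocallySolvable b E Q) B

/-! ## Generalized flags -/

/-- `p = (F', F'')` is a pair of consecutive elements of `F`. The set of these pairs is ordered by
inclusion in both components, which is the order of `Submodule K V × Submodule K V`. -/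
def IsConsecutive (F : Set (Submodule K V)) (p : Submodule K V × Submodule K V) : Prop :=
  p.1 ∈ F ∧ p.2 ∈ F ∧ p.1 < p.2 ∧ ∀ W ∈ F, ¬ (p.1 < W ∧ W < p.2)

structure IsGeneralizedFlag (F : Set (Submodule K V)) : Prop where
  chain : IsChain (· ≤ ·) F
  consec : ∀ W ∈ F, ∃ p, IsConsecutive F p ∧ (p.1 = W ∨ p.2 = W)
  vector : ∀ v : V, v ≠ 0 → ∃ p, IsConsecutive F p ∧ v ∈ p.2 ∧ v ∉ p.1

/-- The generalized flag `F` is compatible with the basis `l`. -/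
def IsCompatible (l : Basis ι K V) (F : Set (Submodule K V)) : Prop :=
  IsGeneralizedFlag F ∧ ∃ s : ι → Submodule K V × Submodule K V,
    (∀ i, IsConsecutive F (s i)) ∧
    ∀ p, IsConsecutive F p →
      p.1 = Submodule.span K (l '' {i | s i < p}) ∧ p.2 = Submodule.span K (l '' {i | s i ≤ p})

/-- `F` is compatible with a basis that contains all but finitely many vectors of `b`. -/
def IsWeaklyCompatible (b : Basis ι K V) (F : Set (Submodule K V)) : Prop :=
  ∃ l : Basis ι K V, IsCompatible l F ∧ (Set.range b \ Set.range l).Finite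

/-- The isomorphism of ordered sets `φ : F → G` exhibits `F` and `G` as commensurable. -/
def IsCommensuration {F G : Set (Submodule K V)} (φ : F ≃o G) : Prop :=
  ∃ U : Submodule K V, FiniteDimensional K U ∧ ∀ W : F,
    (φ W : Submodule K V) ⊔ U = (W : Submodule K V) ⊔ U ∧
    finrank K ((φ W : Submodule K V) ⊓ U : Submodule K V) =
      finrank K ((W : Submodule K V) ⊓ U : Submodule K V)

/-- `Fl(F, E)`: the generalized flags that are `E`-commensurable with `F`. -/
def Fl (b : Basis ι K V) (F : Set (Submodule K V)) : Set (Set (Submodule K V)) :=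
  {G | IsWeaklyCompatible b F ∧ IsWeaklyCompatible b G ∧ ∃ φ : F ≃o G, IsCommensuration φ}

/-- The natural action of automorphisms on sets of subspaces. -/
def act (g : V ≃ₗ[K] V) (F : Set (Submodule K V)) : Set (Submodule K V) :=
  (fun W => W.map (g : V →ₗ[K] V)) '' F

theorem act_one (F : Set (Submodule K V)) : act (1 : V ≃ₗ[K] V) F = F := by
  have h : (fun W : Submodule K V => W.map ((1 : V ≃ₗ[K] V) : V →ₗ[K] V)) = id := by
    funext W
    exact Submodule.map_id W
  rw [act, h, Set.image_id]

theorem act_mul (g h : V ≃ₗ[K] V) (F : Set (Submodule K V)) :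
    act (g * h) F = act g (act h F) := by
  rw [act, act, act, Set.image_image]
  refine Set.image_congr fun W _ => ?_
  exact Submodule.map_comp (h : V →ₗ[K] V) (g : V →ₗ[K] V) W

/-- `P_F`: the subgroup of the elements of `G(E)` that preserve `F`. -/
def flagStabilizer (b : Basis ι K V) (F : Set (Submodule K V)) : Subgroup (GLInf b) where
  carrier := {g | act g.1 F = F}
  one_mem' := act_one F
  mul_mem' := by
    intro g h hg hh
    show act (g.1 * h.1) F = F
    rw [act_mul, show act h.1 F = F from hh, show act g.1 F = F from hg]
  inv_mem' := by
    intro g hg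
    show act (g.1⁻¹) F = F
    conv_lhs => rw [← show act g.1 F = F from hg]
    rw [← act_mul, inv_mul_cancel, act_one]

section Sigma

variable {A : Type*} [LinearOrder A]

/-- `F'_{σ,α} = ⟨e : σ(e) < α⟩`. -/
def lower (b : Basis ι K V) (σ : ι → A) (α : A) : Submodule K V :=
  Submodule.span K (b '' {i | σ i < α})

/-- `F''_{σ,α} = ⟨e : σ(e) ≤ α⟩`. -/
def upper (b : Basis ι K V) (σ : ι → A) (α : A) : Submodule K V :=
  Submodule.span K (b '' {i | σ i ≤ α})

/-- `F_σ = {F'_{σ,α}, F''_{σ,α} : α ∈ A}`. -/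
def flagOf (b : Basis ι K V) (σ : ι → A) : Set (Submodule K V) :=
  {W | ∃ α, W = lower b σ α ∨ W = upper b σ α}

theorem upper_mem (b : Basis ι K V) (σ : ι → A) (α : A) : upper b σ α ∈ flagOf b σ :=
  ⟨α, Or.inr rfl⟩

/-! ## The ind-variety structure on `Fl(F, E)` -/

/-- The image of `Fl(F, I)` in `Fl(F, E)`, for `F = F_{σ₀}` and a finite set `I` of basis vectors:
flags `{M'_α, M''_α}` of `⟨I⟩` with the same dimensions as the trace of `F` on `⟨I⟩`, completed by
the basis vectors outside `I`. -/
def flPiece (b : Basis ι K V) (σ₀ : ι → A) (I : Finset ι) : Set (Fl b (flagOf b σ₀)) :=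
  {G | ∃ M' M'' : A → Submodule K V,
    (∀ α, M' α ≤ M'' α ∧ M'' α ≤ Submodule.span K (b '' (I : Set ι)) ∧
      finrank K (M' α) = (I.filter fun i => σ₀ i < α).card ∧
      finrank K (M'' α) = (I.filter fun i => σ₀ i ≤ α).card) ∧
    (∀ α β, α < β → M'' α ≤ M' β) ∧
    G.1 = {W | ∃ α, W = M' α ⊔ Submodule.span K (b '' {i | i ∉ I ∧ σ₀ i < α}) ∨
      W = M'' α ⊔ Submodule.span K (b '' {i | i ∉ I ∧ σ₀ i ≤ α})}}

/-- `Fl(F, E)` as the direct limit of the flag varieties `Fl(F, Eₙ)`. Each `Fl(F, Eₙ)` carries the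
structure of a homogeneous space of `G(Eₙ)`: open sets and regular functions are tested on
`G(Eₙ)` along `g ↦ gF`. -/
noncomputable def flInd (b : Basis ι K V) (E : ℕ → Finset ι) (σ₀ : ι → A) :
    IndSpace K (Fl b (flagOf b σ₀)) where
  piece n := flPiece b σ₀ (E n)
  str n := ((glInd b E).str n).quot (fun g => act g.1.1 (flagOf b σ₀)) (fun x => x.1.1)

/-- The ind-variety `G(E)/P = ⋃ G(Eₙ)/(P ∩ G(Eₙ))`. -/
noncomputable def quotInd (b : Basis ι K V) (E : ℕ → Finset ι) (P : Subgroup (GLInf b)) :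
    IndSpace K (GLInf b ⧸ P) where
  piece n := (fun g : GLInf b => (g : GLInf b ⧸ P)) '' glPiece b (E n)
  str n := ((glInd b E).str n).quot (fun g => (g.1 : GLInf b ⧸ P)) (fun x => x.1)

/-! ## Combinatorics -/

/-- `W(E)`: the finitary permutations of the basis. -/
def WInf (ι : Type*) : Subgroup (Equiv.Perm ι) where
  carrier := {w | {i | w i ≠ i}.Finite}
  one_mem' := by simp
  mul_mem' := by
    intro g h hg hh
    refine (hg.union hh).subset fun i hi => ?_
    by_contra hc
    simp only [Set.mem_union, Set.mem_ofPred_eq, not_or, not_not] at hc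
    exact hi (by rw [Equiv.Perm.mul_apply, hc.2, hc.1])
  inv_mem' := by
    intro g hg
    refine Set.Finite.subset hg fun i hi hc => hi ?_
    conv_lhs => rw [← hc]
    exact g.symm_apply_apply i

/-- `w · σ = σ ∘ w⁻¹`. -/
def wact (w : WInf ι) (σ : ι → A) : ι → A := fun i => σ ((w.1)⁻¹ i)

/-- `W_P(E)`: the stabilizer of `σ₀` in `W(E)`. -/
def WPar (σ₀ : ι → A) : Subgroup (WInf ι) where
  carrier := {w | wact w σ₀ = σ₀}
  one_mem' := rfl
  mul_mem' := by
    intro g h hg hh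
    funext i
    have h1 := congrFun (show wact h σ₀ = σ₀ from hh) ((g.1)⁻¹ i)
    have h2 := congrFun (show wact g σ₀ = σ₀ from hg) i
    simp only [wact] at h1 h2 ⊢
    rw [← h2, ← h1]
    simp [mul_inv_rev]
  inv_mem' := by
    intro g hg
    funext i
    have h2 := congrFun (show wact g σ₀ = σ₀ from hg) (g.1 i)
    simp only [wact] at h2 ⊢
    simpa using h2.symm

/-- `W(E) · σ₀`. -/
def WOrbit (σ₀ : ι → A) : Set (ι → A) := Set.range fun w : WInf ι => wact w σ₀

/-- The orbit `B F_σ`. -/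
def cell (b : Basis ι K V) (B : Subgroup (GLInf b)) (σ : ι → A) : Set (Set (Submodule K V)) :=
  {G | ∃ g ∈ B, G = act g.1 (flagOf b σ)}

/-- The orbit `B F_σ` as a subset of `Fl(F_{σ₀}, E)`. -/
def cellIn (b : Basis ι K V) (σ₀ : ι → A) (B : Subgroup (GLInf b)) (σ : ι → A) :
    Set (Fl b (flagOf b σ₀)) :=
  {G | G.1 ∈ cell b B σ}

section Order

variable [LinearOrder ι]

/-- The inversion number. -/
noncomputable def nInv (σ : ι → A) : ℕ∞ :=
  Set.encard {p : ι × ι | p.1 < p.2 ∧ σ p.2 < σ p.1}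

/-- `τ = σ ∘ t_{e,e'}` for some `e < e'` with `σ(e) < σ(e')`. -/
def BruhatStep (σ τ : ι → A) : Prop :=
  ∃ e e' : ι, e < e' ∧ σ e < σ e' ∧ τ = σ ∘ Equiv.swap e e'

/-- The order `σ ≤ τ`: there is a chain of steps, possibly empty, from `σ` to `τ`. -/
def BruhatLE (σ τ : ι → A) : Prop := Relation.ReflTransGen BruhatStep σ τ

/-- The maximal generalized flag `F₀` given by the total order on the basis. -/
def maxFlag (b : Basis ι K V) : Set (Submodule K V) := flagOf b (id : ι → ι)

/-- `σ_G = σ`, where `G''_α = φ(F''_α)` for the identification `φ : F_{σ₀} → G` of generalized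
flags, and `σ_G(e) = min {α : G''_α ∩ F''_{0,e} ≠ G''_α ∩ F'_{0,e}}`. -/
def IsRelPosition (b : Basis ι K V) (σ₀ : ι → A) {G : Set (Submodule K V)}
    (φ : flagOf b σ₀ ≃o G) (σ : ι → A) : Prop :=
  ∀ e : ι, IsLeast {α : A |
    (φ ⟨upper b σ₀ α, upper_mem b σ₀ α⟩ : Submodule K V) ⊓ upper b (id : ι → ι) e ≠
    (φ ⟨upper b σ₀ α, upper_mem b σ₀ α⟩ : Submodule K V) ⊓ lower b (id : ι → ι) e} (σ e)

end Order

end Sigma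

end

end GenFlag

/-! Everything is tested on the finite pieces `G(I) = GL(⟨I⟩)`. An element of `G(I)` changes vectors
only by elements of `⟨I⟩` (`apply_sub_mem`), and finitely many data always lie in one piece. A
commensuration is unique, because comparable subspaces with equal sum and equal intersection
dimension against a finite-dimensional `U` coincide (`eq_of_le_of_sup_eq`, `commensuration_unique`).
Since `G(I)` is transitive on `Fl(F, I)` (`mem_flPiece_iff`) and each commensurable flag lies in
some piece (`exists_mem_flPiece`), both sides of the isomorphism in (a) are quotients of the same
matrix groups.

The order attached to `B` is read off matrix entries: put `i` below `j` if some element of `B` has a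
nonzero entry at `(i, j)`. The torus makes this relation transitive (`exists_ent_ne_zero_trans`). If
it failed to be antisymmetric, a connected solvable group of matrices of size at least two would
contain the diagonal torus and have no identically vanishing entry; a Lie–Kolchin type argument
excludes this (`subsingleton_of_isSolvable`). Any linear extension gives a triangular group
containing `B`. That group is itself closed, connected and locally solvable, so maximality makes it
equal to `B`; the transvections in it recover the order.

For the decomposition and (b), `σ(e)` is the first `α` for which the `α`-th space contains a vector
with leading index `e`. Choosing such vectors gives a triangular matrix carrying `F_σ` to the flag
(`exists_triangular_act_eq`). Triangular matrices preserve the reference flag, so the relative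
position is constant on a cell (`isRelPosition_of_triangular`) and distinct cells are disjoint.

For (d), the dimensions of the intersections with the reference flag are the prefix counts of `σ`,
and the Bruhat order is domination of prefix counts (`bruhatLE_of_prefixCount_le`,
`prefixCount_le_of_bruhatLE`). Lower semicontinuity of rank makes the union of the cells below `τ`
closed; conversely a one-parameter family of transvections degenerates the cell of `τ` to that of
`σ` for each Bruhat step (`mem_closed_of_step`).

For (c), every point of a cell is `uF_σ` for a unique unipotent `u` with off-diagonal entries only
at the inversions of `σ`. By Cramer's rule its entries are quotients of polynomials in any
representing matrix, invariant under change of representative (`exists_chart_factor`). So the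
coordinates and their inverse are morphisms. Local closedness holds because only finitely many cells
meet each piece. -/

namespace GenFlag

/-! ## Polynomial functions and the Zariski structure -/

section Zariski

variable {K : Type*} [Field K] {X Y s t : Type*}

/-- The algebra of functions that are polynomials in the coordinates `c`. -/
noncomputable def polyFun (c : X → s → K) : Subalgebra K (X → K) :=
  (MvPolynomial.aeval (R := K) (S₁ := X → K) fun j x => c x j).range

theorem aeval_pi_apply (c : X → s → K) (p : MvPolynomial s K) (x : X) :
    MvPolynomial.aeval (R := K) (S₁ := X → K) (fun j x => c x j) p x =
      MvPolynomial.eval (c x) p := by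
  have : (Pi.evalAlgHom K (fun _ : X => K) x).comp
      (MvPolynomial.aeval (R := K) (S₁ := X → K) fun j x => c x j) =
      MvPolynomial.aeval (c x) := by
    ext j; simp
  have h := congrArg (fun f => f p) this
  simpa [MvPolynomial.aeval_eq_eval] using h

theorem mem_polyFun_iff {c : X → s → K} {f : X → K} :
    f ∈ polyFun c ↔ ∃ p : MvPolynomial s K, ∀ x, f x = MvPolynomial.eval (c x) p := by
  constructor
  · rintro ⟨p, rfl⟩
    exact ⟨p, fun x => aeval_pi_apply c p x⟩
  · rintro ⟨p, hp⟩
    exact ⟨p, funext fun x => (aeval_pi_apply c p x).trans (hp x).symm⟩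

theorem eval_mem_polyFun (c : X → s → K) (p : MvPolynomial s K) :
    (fun x => MvPolynomial.eval (c x) p) ∈ polyFun c :=
  mem_polyFun_iff.2 ⟨p, fun _ => rfl⟩

theorem coord_mem_polyFun (c : X → s → K) (j : s) : (fun x => c x j) ∈ polyFun c :=
  mem_polyFun_iff.2 ⟨MvPolynomial.X j, fun x => by simp⟩

theorem const_mem_polyFun (c : X → s → K) (a : K) : (fun _ => a) ∈ polyFun c :=
  mem_polyFun_iff.2 ⟨MvPolynomial.C a, fun x => by simp⟩

theorem add_mem_polyFun {c : X → s → K} {f g : X → K} (hf : f ∈ polyFun c) (hg : g ∈ polyFun c) :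
    (fun x => f x + g x) ∈ polyFun c := add_mem hf hg

theorem sub_mem_polyFun {c : X → s → K} {f g : X → K} (hf : f ∈ polyFun c) (hg : g ∈ polyFun c) :
    (fun x => f x - g x) ∈ polyFun c := sub_mem hf hg

theorem mul_mem_polyFun {c : X → s → K} {f g : X → K} (hf : f ∈ polyFun c) (hg : g ∈ polyFun c) :
    (fun x => f x * g x) ∈ polyFun c := mul_mem hf hg

theorem sum_mem_polyFun {c : X → s → K} {κ : Type*} (S : Finset κ) {f : κ → X → K}
    (hf : ∀ k ∈ S, f k ∈ polyFun c) : (fun x => ∑ k ∈ S, f k x) ∈ polyFun c := by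
  have : (fun x => ∑ k ∈ S, f k x) = ∑ k ∈ S, f k := by ext x; simp
  rw [this]
  exact sum_mem hf

theorem prod_mem_polyFun {c : X → s → K} {κ : Type*} (S : Finset κ) {f : κ → X → K}
    (hf : ∀ k ∈ S, f k ∈ polyFun c) : (fun x => ∏ k ∈ S, f k x) ∈ polyFun c := by
  have : (fun x => ∏ k ∈ S, f k x) = ∏ k ∈ S, f k := by ext x; simp
  rw [this]
  exact prod_mem hf

theorem matrix_mul_mem_polyFun {c : X → s → K} {m n o : Type*} [Fintype n]
    {M : X → Matrix m n K} {N : X → Matrix n o K} (hM : ∀ i j, (fun x => M x i j) ∈ polyFun c)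
    (hN : ∀ i j, (fun x => N x i j) ∈ polyFun c) (i : m) (j : o) :
    (fun x => (M x * N x) i j) ∈ polyFun c := by
  simp only [Matrix.mul_apply]
  exact sum_mem_polyFun _ fun k _ => mul_mem_polyFun (hM i k) (hN k j)

theorem det_mem_polyFun {c : X → s → K} {m : Type*} [Fintype m] [DecidableEq m]
    {M : X → Matrix m m K} (hM : ∀ i j, (fun x => M x i j) ∈ polyFun c) :
    (fun x => (M x).det) ∈ polyFun c := by
  simp only [Matrix.det_apply']
  exact sum_mem_polyFun _ fun τ _ => mul_mem_polyFun (const_mem_polyFun c _)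
    (prod_mem_polyFun _ fun i _ => hM _ _)

theorem adjugate_mem_polyFun {c : X → s → K} {m : Type*} [Fintype m] [DecidableEq m]
    {M : X → Matrix m m K} (hM : ∀ i j, (fun x => M x i j) ∈ polyFun c) (i j : m) :
    (fun x => (M x).adjugate i j) ∈ polyFun c := by
  simp only [Matrix.adjugate_apply]
  refine det_mem_polyFun fun k l => ?_
  by_cases h : k = j
  · subst h
    simp only [Matrix.updateRow_self]
    exact const_mem_polyFun c _
  · simp only [Matrix.updateRow_ne h]
    exact hM k l

theorem comp_mem_polyFun {c : X → s → K} {d : Y → t → K} {f : X → Y}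
    (hf : ∀ j, (fun x => d (f x) j) ∈ polyFun c) {h : Y → K} (hh : h ∈ polyFun d) :
    h ∘ f ∈ polyFun c := by
  obtain ⟨p, hp⟩ := mem_polyFun_iff.1 hh
  choose q hq using fun j => mem_polyFun_iff.1 (hf j)
  refine mem_polyFun_iff.2 ⟨MvPolynomial.bind₁ q p, fun x => ?_⟩
  have : d (f x) = fun j => MvPolynomial.eval (c x) (q j) := funext fun j => hq j x
  simp only [Function.comp, hp, this]
  rw [← MvPolynomial.aeval_eq_eval, ← MvPolynomial.aeval_eq_eval, MvPolynomial.aeval_bind₁]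

theorem isOpen_ne_zariski {c : X → s → K} {f : X → K} (hf : f ∈ polyFun c) :
    IsOpen[(zariski c).top] {x | f x ≠ 0} := by
  obtain ⟨p, hp⟩ := mem_polyFun_iff.1 hf
  exact TopologicalSpace.GenerateOpen.basic _ ⟨p, by simp [hp]⟩

theorem isClosed_eq_zariski {c : X → s → K} {f : X → K} (hf : f ∈ polyFun c) :
    IsClosed[(zariski c).top] {x | f x = 0} := by
  let _ := (zariski c).top
  exact ⟨isOpen_ne_zariski hf⟩

/-- Multiplying polynomials intersects their non-vanishing loci, so the generating sets already form
a base of the topology. -/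
theorem exists_polyFun_of_isOpen {c : X → s → K} {O : Set X} (hO : IsOpen[(zariski c).top] O)
    {x : X} (hx : x ∈ O) : ∃ f ∈ polyFun c, f x ≠ 0 ∧ ∀ y, f y ≠ 0 → y ∈ O := by
  induction hO with
  | basic U hU =>
    obtain ⟨p, rfl⟩ := hU
    exact ⟨_, eval_mem_polyFun c p, hx, fun y hy => hy⟩
  | univ => exact ⟨fun _ => 1, const_mem_polyFun c 1, one_ne_zero, fun y _ => trivial⟩
  | inter U V _ _ hU hV =>
    obtain ⟨f, hf, hfx, hfU⟩ := hU hx.1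
    obtain ⟨g, hg, hgx, hgV⟩ := hV hx.2
    exact ⟨_, mul_mem_polyFun hf hg, mul_ne_zero hfx hgx, fun y hy =>
      ⟨hfU y (left_ne_zero_of_mul hy), hgV y (right_ne_zero_of_mul hy)⟩⟩
  | sUnion S _ hS =>
    obtain ⟨U, hU, hxU⟩ := hx
    obtain ⟨f, hf, hfx, hfU⟩ := hS U hU hxU
    exact ⟨f, hf, hfx, fun y hy => ⟨U, hU, hfU y hy⟩⟩

theorem zariski_isReg_iff {c : X → s → K} {U : Set X} {f : X → K} :
    (zariski c).IsReg U f ↔ ∀ x ∈ U, ∃ p ∈ polyFun c, ∃ q ∈ polyFun c, q x ≠ 0 ∧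
      ∀ y ∈ U, q y ≠ 0 → f y = p y / q y := by
  constructor
  · intro h x hx
    obtain ⟨p, q, hq, hy⟩ := h x hx
    exact ⟨_, eval_mem_polyFun c p, _, eval_mem_polyFun c q, hq, hy⟩
  · intro h x hx
    obtain ⟨p, hp, q, hq, hqx, hy⟩ := h x hx
    obtain ⟨P, hP⟩ := mem_polyFun_iff.1 hp
    obtain ⟨Q, hQ⟩ := mem_polyFun_iff.1 hq
    refine ⟨P, Q, by rwa [← hQ], fun y hyU hyQ => ?_⟩
    rw [← hP, ← hQ]
    exact hy y hyU (by rwa [hQ])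

theorem zariski_isReg_of_polyFun {c : X → s → K} {U : Set X} {f : X → K} (hf : f ∈ polyFun c) :
    (zariski c).IsReg U f :=
  zariski_isReg_iff.2 fun x _ => ⟨f, hf, fun _ => 1, const_mem_polyFun c 1, one_ne_zero,
    fun y _ _ => by simp⟩

theorem zariski_isReg_add {c : X → s → K} {U : Set X} {f g : X → K} (hf : (zariski c).IsReg U f)
    (hg : (zariski c).IsReg U g) : (zariski c).IsReg U fun x => f x + g x := by
  rw [zariski_isReg_iff] at *
  intro x hx
  obtain ⟨p, hp, q, hq, hqx, h⟩ := hf x hx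
  obtain ⟨p', hp', q', hq', hqx', h'⟩ := hg x hx
  refine ⟨_, add_mem_polyFun (mul_mem_polyFun hp hq')
    (mul_mem_polyFun hq hp'), _, mul_mem_polyFun hq hq', mul_ne_zero hqx hqx', fun y hy hne => ?_⟩
  have h1 := left_ne_zero_of_mul hne
  have h2 := right_ne_zero_of_mul hne
  rw [h y hy h1, h' y hy h2, div_add_div _ _ h1 h2]

theorem zariski_isReg_mul {c : X → s → K} {U : Set X} {f g : X → K} (hf : (zariski c).IsReg U f)
    (hg : (zariski c).IsReg U g) : (zariski c).IsReg U fun x => f x * g x := by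
  rw [zariski_isReg_iff] at *
  intro x hx
  obtain ⟨p, hp, q, hq, hqx, h⟩ := hf x hx
  obtain ⟨p', hp', q', hq', hqx', h'⟩ := hg x hx
  refine ⟨_, mul_mem_polyFun hp hp', _, mul_mem_polyFun hq hq', mul_ne_zero hqx hqx',
    fun y hy hne => ?_⟩
  rw [h y hy (left_ne_zero_of_mul hne), h' y hy (right_ne_zero_of_mul hne), div_mul_div_comm]

theorem zariski_isReg_inv {c : X → s → K} {U : Set X} {f : X → K} (hf : (zariski c).IsReg U f)
    (h0 : ∀ x ∈ U, f x ≠ 0) : (zariski c).IsReg U fun x => (f x)⁻¹ := by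
  rw [zariski_isReg_iff] at *
  intro x hx
  obtain ⟨p, hp, q, hq, hqx, h⟩ := hf x hx
  have hpx : p x ≠ 0 := fun h' => h0 x hx (by rw [h x hx hqx, h', zero_div])
  refine ⟨_, mul_mem_polyFun hq hq, _, mul_mem_polyFun hp hq, mul_ne_zero hpx hqx,
    fun y hy hne => ?_⟩
  have h2 := right_ne_zero_of_mul hne
  rw [h y hy h2, inv_div, mul_div_mul_right _ _ h2]

theorem zariski_isReg_eval {c : X → s → K} {U : Set X} {h : t → X → K}
    (hh : ∀ j, (zariski c).IsReg U (h j)) (P : MvPolynomial t K) :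
    (zariski c).IsReg U fun x => MvPolynomial.eval (fun j => h j x) P := by
  induction P using MvPolynomial.induction_on with
  | C a => simpa using zariski_isReg_of_polyFun (const_mem_polyFun c a)
  | add p q hp hq => simpa using zariski_isReg_add hp hq
  | mul_X p j hp => simpa using zariski_isReg_mul hp (hh j)

theorem zariski_isReg_mono {c : X → s → K} {U W : Set X} (hUW : W ⊆ U) {f : X → K}
    (hf : (zariski c).IsReg U f) : (zariski c).IsReg W f := by
  intro x hx
  obtain ⟨p, q, hq, h⟩ := hf x (hUW hx)
  exact ⟨p, q, hq, fun y hy => h y (hUW hy)⟩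

theorem zariski_isReg_congr {c : X → s → K} {U : Set X} {f g : X → K}
    (hf : (zariski c).IsReg U f) (h : ∀ x ∈ U, g x = f x) : (zariski c).IsReg U g := by
  intro x hx
  obtain ⟨p, q, hq, h'⟩ := hf x hx
  exact ⟨p, q, hq, fun y hy hne => (h y hy).trans (h' y hy hne)⟩

/-- Regularity is a local condition: multiplying numerator and denominator by a polynomial `r` that
vanishes off `O` leaves the quotient unchanged and confines the condition on the denominator to
points of `O`. -/
theorem zariski_isReg_local {c : X → s → K} {U : Set X} {f : X → K}
    (h : ∀ x ∈ U, ∃ O, IsOpen[(zariski c).top] O ∧ x ∈ O ∧ (zariski c).IsReg (U ∩ O) f) :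
    (zariski c).IsReg U f := by
  rw [zariski_isReg_iff]
  intro x hx
  obtain ⟨O, hO, hxO, hreg⟩ := h x hx
  obtain ⟨r, hr, hrx, hrO⟩ := exists_polyFun_of_isOpen hO hxO
  obtain ⟨p, hp, q, hq, hqx, hy⟩ := zariski_isReg_iff.1 hreg x ⟨hx, hxO⟩
  refine ⟨_, mul_mem_polyFun hp hr, _, mul_mem_polyFun hq hr, mul_ne_zero hqx hrx,
    fun y hyU hne => ?_⟩
  have h2 := right_ne_zero_of_mul hne
  rw [hy y ⟨hyU, hrO y h2⟩ (left_ne_zero_of_mul hne), mul_div_mul_right _ _ h2]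

theorem isOpen_ne_of_zariski_isReg {c : X → s → K} {U : Set X} (hU : IsOpen[(zariski c).top] U)
    {f : X → K} (hf : (zariski c).IsReg U f) :
    IsOpen[(zariski c).top] {x | x ∈ U ∧ f x ≠ 0} := by
  let _ := (zariski c).top
  rw [isOpen_iff_forall_mem_open]
  rintro x ⟨hx, hfx⟩
  obtain ⟨p, hp, q, hq, hqx, h⟩ := zariski_isReg_iff.1 hf x hx
  refine ⟨U ∩ ({y | p y ≠ 0} ∩ {y | q y ≠ 0}), ?_,
    hU.inter ((isOpen_ne_zariski hp).inter (isOpen_ne_zariski hq)), hx, ?_, hqx⟩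
  · rintro y ⟨hy, hpy, hqy⟩
    exact ⟨hy, by rw [h y hy hqy]; exact div_ne_zero hpy hqy⟩
  · intro h0
    exact hfx (by rw [h x hx hqx, h0, zero_div])

theorem continuous_zariski {c : X → s → K} {d : Y → t → K} {f : X → Y}
    (hf : ∀ j, (fun x => d (f x) j) ∈ polyFun c) :
    Continuous[(zariski c).top, (zariski d).top] f := by
  refine continuous_generateFrom_iff.2 ?_
  rintro _ ⟨p, rfl⟩
  exact isOpen_ne_zariski (comp_mem_polyFun hf (eval_mem_polyFun d p))

theorem zariski_isMor {c : X → s → K} {d : Y → t → K} {f : X → Y}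
    (hf : ∀ j, (fun x => d (f x) j) ∈ polyFun c) : (zariski c).IsMor (zariski d) f := by
  refine ⟨continuous_zariski hf, fun U h _ hh => ?_⟩
  rw [zariski_isReg_iff] at *
  intro x hx
  obtain ⟨p, hp, q, hq, hqx, hy⟩ := hh (f x) hx
  exact ⟨_, comp_mem_polyFun hf hp, _, comp_mem_polyFun hf hq, hqx, fun y hyU hne =>
    hy (f y) hyU hne⟩

/-- The standard coordinate on a subset of the line. -/
def lineCoord (D : Set K) : D → Unit → K := fun x _ => x.1

theorem exists_polynomial_of_mem_polyFun {D : Set K} {f : D → K} (hf : f ∈ polyFun (lineCoord D)) :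
    ∃ P : Polynomial K, ∀ x : D, f x = P.eval x.1 := by
  obtain ⟨p, hp⟩ := mem_polyFun_iff.1 hf
  refine ⟨MvPolynomial.aeval (fun _ => Polynomial.X) p, fun x => ?_⟩
  have : ((Polynomial.aeval x.1).comp (MvPolynomial.aeval (R := K)
      (fun _ : Unit => (Polynomial.X : Polynomial K)))) = MvPolynomial.aeval (lineCoord D x) := by
    ext j; simp [lineCoord]
  have h := congrArg (fun f => f p) this
  simp only [AlgHom.comp_apply] at h
  rw [Polynomial.coe_aeval_eq_eval] at h
  rw [hp, h]
  rfl

theorem finite_zeros_of_mem_polyFun {D : Set K} {f : D → K} (hf : f ∈ polyFun (lineCoord D))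
    {x : D} (hx : f x ≠ 0) : {y : D | f y = 0}.Finite := by
  obtain ⟨P, hP⟩ := exists_polynomial_of_mem_polyFun hf
  have hP0 : P ≠ 0 := by rintro rfl; simp [hP] at hx
  refine Set.Finite.of_finite_image ((P.rootSet_finite K).subset ?_) Subtype.val_injective.injOn
  rintro _ ⟨y, hy, rfl⟩
  rw [Polynomial.mem_rootSet]
  exact ⟨hP0, by rw [Polynomial.coe_aeval_eq_eval, ← hP]; exact hy⟩

/-- Each nonempty open set omits only finitely many points, the roots of a nonzero polynomial, so an
infinite subset of the line is irreducible. -/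
theorem nonempty_inter_of_isOpen_line {D : Set K} (hD : D.Infinite) {U W : Set D}
    (hU : IsOpen[(zariski (lineCoord D)).top] U) (hW : IsOpen[(zariski (lineCoord D)).top] W)
    (hUn : U.Nonempty) (hWn : W.Nonempty) : (U ∩ W).Nonempty := by
  obtain ⟨x, hx⟩ := hUn
  obtain ⟨y, hy⟩ := hWn
  obtain ⟨f, hf, hfx, hfU⟩ := exists_polyFun_of_isOpen hU hx
  obtain ⟨g, hg, hgy, hgW⟩ := exists_polyFun_of_isOpen hW hy
  have := hD.to_subtype
  obtain ⟨z, hz⟩ := ((finite_zeros_of_mem_polyFun hf hfx).union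
    (finite_zeros_of_mem_polyFun hg hgy)).exists_notMem
  simp only [Set.mem_union, Set.mem_ofPred_eq, not_or] at hz
  exact ⟨z, hfU z hz.1, hgW z hz.2⟩

theorem preconnectedSpace_line {D : Set K} (hD : D.Infinite) :
    @PreconnectedSpace D (zariski (lineCoord D)).top := by
  let _ := (zariski (lineCoord D)).top
  refine ⟨fun U W hU hW _ hUn hWn => ?_⟩
  simp only [Set.univ_inter] at *
  exact nonempty_inter_of_isOpen_line hD hU hW hUn hWn

/-- The Zariski topology of finitely many coordinates is noetherian. -/
theorem noetherianSpace_zariski [Finite s] (c : X → s → K) :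
    @TopologicalSpace.NoetherianSpace X (zariski c).top := by
  let _ := (zariski c).top
  -- A point goes to the kernel of evaluation there. Basic open sets of the spectrum pull back to
  -- the generating sets, and the spectrum of a polynomial ring in finitely many variables is
  -- noetherian.
  let f : X → PrimeSpectrum (MvPolynomial s K) := fun x =>
    ⟨RingHom.ker (MvPolynomial.eval (c x)), RingHom.ker_isPrime _⟩
  have hf : IsInducing f := by
    refine ⟨?_⟩
    rw [PrimeSpectrum.isTopologicalBasis_basic_opens.eq_generateFrom, induced_generateFrom_eq]
    show TopologicalSpace.generateFrom _ = _
    congr 1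
    ext U
    constructor
    · rintro ⟨p, rfl⟩
      refine ⟨_, ⟨p, rfl⟩, ?_⟩
      ext x
      simp [f, RingHom.mem_ker]
    · rintro ⟨_, ⟨p, rfl⟩, rfl⟩
      refine ⟨p, ?_⟩
      ext x
      simp [f, RingHom.mem_ker]
  exact hf.noetherianSpace

end Zariski

/-! ## Coordinate subspaces -/

section Coord

variable {K : Type*} [Field K] {V : Type*} [AddCommGroup V] [Module K V] {ι : Type*}

/-- The span of the basis vectors indexed by `S`. -/
abbrev coordSpan (b : Basis ι K V) (S : Set ι) : Submodule K V := Submodule.span K (b '' S)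

theorem mem_coordSpan {b : Basis ι K V} {S : Set ι} {v : V} :
    v ∈ coordSpan b S ↔ ∀ i, b.repr v i ≠ 0 → i ∈ S := by
  rw [Basis.mem_span_image]
  exact ⟨fun h i hi => h (by simpa using hi), fun h i hi => h i (by simpa using hi)⟩

theorem basis_mem_coordSpan {b : Basis ι K V} {S : Set ι} {i : ι} :
    b i ∈ coordSpan b S ↔ i ∈ S := by
  classical
  rw [mem_coordSpan]
  simp [Finsupp.single_apply]

theorem coordSpan_le_iff {b : Basis ι K V} {S T : Set ι} :
    coordSpan b S ≤ coordSpan b T ↔ S ⊆ T :=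
  ⟨fun h _ hi => basis_mem_coordSpan.1 (h (basis_mem_coordSpan.2 hi)),
    fun h => Submodule.span_mono (Set.image_mono h)⟩

theorem coordSpan_injective (b : Basis ι K V) : Function.Injective (coordSpan b) := fun _ _ h =>
  Set.Subset.antisymm (coordSpan_le_iff.1 h.le) (coordSpan_le_iff.1 h.ge)

theorem coordSpan_lt_iff {b : Basis ι K V} {S T : Set ι} :
    coordSpan b S < coordSpan b T ↔ S ⊂ T := by
  rw [lt_iff_le_not_ge, coordSpan_le_iff, coordSpan_le_iff]
  rfl

theorem coordSpan_inf (b : Basis ι K V) (S T : Set ι) :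
    coordSpan b S ⊓ coordSpan b T = coordSpan b (S ∩ T) := by
  ext v
  simp only [Submodule.mem_inf, mem_coordSpan]
  exact ⟨fun h i hi => ⟨h.1 i hi, h.2 i hi⟩, fun h => ⟨fun i hi => (h i hi).1,
    fun i hi => (h i hi).2⟩⟩

theorem coordSpan_sup (b : Basis ι K V) (S T : Set ι) :
    coordSpan b S ⊔ coordSpan b T = coordSpan b (S ∪ T) := by
  rw [coordSpan, coordSpan, coordSpan, Set.image_union, Submodule.span_union]

instance finiteDimensional_coordSpan (b : Basis ι K V) (I : Finset ι) :
    FiniteDimensional K (coordSpan b (I : Set ι)) :=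
  FiniteDimensional.span_of_finite K (I.finite_toSet.image b)

theorem finrank_coordSpan (b : Basis ι K V) (I : Finset ι) :
    finrank K (coordSpan b (I : Set ι)) = I.card := by
  classical
  have h : (b '' (I : Set ι)) = Set.range fun i : I => b i := by
    ext v; simp
  have hli : LinearIndependent K fun i : I => b i :=
    b.linearIndependent.comp _ Subtype.val_injective
  rw [coordSpan, h, finrank_span_eq_card hli]
  simp

/-- Finite dimension of `U` turns equal dimensions into equal intersections; modularity of the
lattice of subspaces then forces equality. Uniqueness of commensurations and most equalities of
images below rest on this. -/
theorem eq_of_le_of_sup_eq {X Y U : Submodule K V} [FiniteDimensional K U] (h : X ≤ Y)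
    (hs : X ⊔ U = Y ⊔ U)
    (hf : finrank K (X ⊓ U : Submodule K V) = finrank K (Y ⊓ U : Submodule K V)) : X = Y := by
  have : FiniteDimensional K (Y ⊓ U : Submodule K V) :=
    Submodule.finiteDimensional_of_le inf_le_right
  have h1 : X ⊓ U = Y ⊓ U := Submodule.eq_of_le_of_finrank_eq (inf_le_inf_right U h) hf
  exact eq_of_le_of_inf_le_of_sup_le h h1.ge hs.ge

/-- By the modular law `(Z + U) ∩ U' = (Z ∩ U') + U`, so `dim (Z ∩ U')` and `dim (Z ∩ U)` differ by
a number that depends only on `Z + U`. Thus the space witnessing a commensuration may be enlarged.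
-/
theorem finrank_inf_eq_of_le {X Y U U' : Submodule K V} [FiniteDimensional K U'] (hU : U ≤ U')
    (hs : X ⊔ U = Y ⊔ U)
    (hf : finrank K (X ⊓ U : Submodule K V) = finrank K (Y ⊓ U : Submodule K V)) :
    finrank K (X ⊓ U' : Submodule K V) = finrank K (Y ⊓ U' : Submodule K V) := by
  have key : ∀ Z : Submodule K V, finrank K ((Z ⊔ U) ⊓ U' : Submodule K V) +
      finrank K (Z ⊓ U : Submodule K V) =
      finrank K (Z ⊓ U' : Submodule K V) + finrank K U := by
    intro Z
    have : FiniteDimensional K (Z ⊓ U' : Submodule K V) :=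
      Submodule.finiteDimensional_of_le inf_le_right
    have : FiniteDimensional K U := Submodule.finiteDimensional_of_le hU
    have h1 := Submodule.finrank_sup_add_finrank_inf_eq (Z ⊓ U') U
    rw [inf_assoc, inf_eq_right.2 hU] at h1
    rw [← h1, sup_comm Z U, sup_inf_assoc_of_le Z hU, sup_comm U]
  have hX := key X
  have hY := key Y
  rw [hs, hf] at hX
  omega

theorem sup_eq_of_le {X Y U U' : Submodule K V} (hU : U ≤ U') (hs : X ⊔ U = Y ⊔ U) :
    X ⊔ U' = Y ⊔ U' := by
  rw [← sup_eq_right.2 hU, ← sup_assoc, ← sup_assoc, hs]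

/-- A family that is triangular with respect to the basis is linearly independent. -/
theorem linearIndependent_of_triangular [LinearOrder ι] (b : Basis ι K V) {I : Finset ι}
    {u : ι → V} (h1 : ∀ i ∈ I, b.repr (u i) i ≠ 0)
    (h2 : ∀ i ∈ I, ∀ k, b.repr (u i) k ≠ 0 → k ≤ i) :
    LinearIndependent K fun i : I => u i := by
  classical
  rw [Fintype.linearIndependent_iff]
  intro c hc
  by_contra! hne
  obtain ⟨i₀, hi₀⟩ := hne
  have hS : (Finset.univ.filter fun i : I => c i ≠ 0).Nonempty := ⟨i₀, by simpa using hi₀⟩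
  -- In coordinate `m`, the largest index with a nonzero coefficient, only the diagonal term of the
  -- relation survives.
  obtain ⟨m, hm, hmax⟩ := Finset.exists_max_image _ (fun i : I => (i : ι)) hS
  simp only [Finset.mem_filter, Finset.mem_univ, true_and] at hm hmax
  have h := congrArg (fun v => b.repr v m) hc
  simp only [map_sum, map_smul, Finsupp.coe_finsetSum, Finset.sum_apply, Finsupp.coe_smul,
    Pi.smul_apply, smul_eq_mul, map_zero, Finsupp.coe_zero, Pi.zero_apply] at h
  rw [Finset.sum_eq_single m] at h
  · exact mul_ne_zero hm (h1 m m.2) h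
  · intro j _ hj
    by_contra hne
    have h3 := h2 j j.2 m (right_ne_zero_of_mul hne)
    exact hj (Subtype.ext (le_antisymm (hmax j (left_ne_zero_of_mul hne)) h3))
  · simp

end Coord

/-! ## The group `G(E)` in coordinates -/

section Group

variable {K : Type*} [Field K] {V : Type*} [AddCommGroup V] [Module K V] {ι : Type*}
  {b : Basis ι K V}

/-- The matrix entries of an element of `G(E)`. -/
noncomputable def ent (g : GLInf b) (i j : ι) : K := b.repr (g.1 (b j)) i

theorem GLInf_ext {g h : GLInf b} (H : ∀ i, g.1 (b i) = h.1 (b i)) : g = h := by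
  apply Subtype.ext
  apply LinearEquiv.toLinearMap_injective
  exact b.ext H

theorem ext_ent {g h : GLInf b} (H : ∀ i j, ent g i j = ent h i j) : g = h :=
  GLInf_ext fun j => b.repr.injective (Finsupp.ext fun i => H i j)

theorem repr_apply_eq_sum (g : GLInf b) {I : Finset ι} {v : V} (hv : v ∈ coordSpan b (I : Set ι))
    (i : ι) : b.repr (g.1 v) i = ∑ k ∈ I, ent g i k * b.repr v k := by
  have h : v = ∑ k ∈ I, b.repr v k • b k := by
    conv_lhs => rw [← b.linearCombination_repr v, Finsupp.linearCombination_apply]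
    refine Finsupp.sum_of_support_subset _ (fun k hk => ?_) _ (by simp)
    exact mem_coordSpan.1 hv k (by simpa using hk)
  conv_lhs => rw [h]
  simp [ent, mul_comm]

theorem ent_one [DecidableEq ι] (i j : ι) : ent (1 : GLInf b) i j = if i = j then 1 else 0 := by
  simp [ent, Finsupp.single_apply, eq_comm]

/-- Enough to check on basis vectors. This makes `⟨I⟩` a witness of commensurability between a flag
and its translate by `g`. -/
theorem apply_sub_mem {I : Finset ι} {g : GLInf b} (hg : g ∈ glPiece b I) (v : V) :
    g.1 v - v ∈ coordSpan b (I : Set ι) := by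
  have hv : v ∈ Submodule.span K (Set.range b) := by rw [b.span_eq]; trivial
  induction hv using Submodule.span_induction with
  | zero => simp
  | mem _ h =>
    obtain ⟨i, rfl⟩ := h
    by_cases hi : i ∈ I
    · exact sub_mem (hg.2 i hi) (basis_mem_coordSpan.2 hi)
    · simp [hg.1 i hi]
  | add v w _ _ hv hw =>
    rw [map_add, add_sub_add_comm]
    exact add_mem hv hw
  | smul c v _ hv =>
    rw [map_smul, ← smul_sub]
    exact Submodule.smul_mem _ _ hv

theorem map_coordSpan_self {I : Finset ι} {g : GLInf b} (hg : g ∈ glPiece b I) :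
    (coordSpan b (I : Set ι)).map (g.1 : V →ₗ[K] V) = coordSpan b (I : Set ι) := by
  refine Submodule.eq_of_le_of_finrank_eq ?_ (LinearEquiv.finrank_map_eq g.1 _)
  rintro _ ⟨v, hv, rfl⟩
  have := add_mem (apply_sub_mem hg v) hv
  rwa [sub_add_cancel] at this

/-- `G(I)` as a subgroup. -/
def glSub (b : Basis ι K V) (I : Finset ι) : Subgroup (GLInf b) where
  carrier := glPiece b I
  one_mem' := ⟨fun _ _ => rfl, fun _ hi => basis_mem_coordSpan.2 hi⟩
  mul_mem' := by
    intro g h hg hh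
    refine ⟨fun i hi => ?_, fun i hi => ?_⟩
    · show g.1 (h.1 (b i)) = b i
      rw [hh.1 i hi, hg.1 i hi]
    · have : (g * h).1 (b i) ∈ (coordSpan b (I : Set ι)).map (g.1 : V →ₗ[K] V) :=
        ⟨h.1 (b i), hh.2 i hi, rfl⟩
      rwa [map_coordSpan_self hg] at this
  inv_mem' := by
    intro g hg
    have hinv : ∀ v, (g⁻¹).1 (g.1 v) = v := fun v => g.1.symm_apply_apply v
    refine ⟨fun i hi => ?_, fun i hi => ?_⟩
    · conv_lhs => rw [← hg.1 i hi]
      exact hinv _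
    · have : b i ∈ (coordSpan b (I : Set ι)).map (g.1 : V →ₗ[K] V) := by
        rw [map_coordSpan_self hg]; exact basis_mem_coordSpan.2 hi
      obtain ⟨v, hv, hvi⟩ := this
      rw [← hvi]
      erw [hinv v]
      exact hv

theorem glPiece_mono {I J : Finset ι} (h : I ⊆ J) : glPiece b I ⊆ glPiece b J := by
  intro g hg
  refine ⟨fun i hi => hg.1 i fun hi' => hi (h hi'), fun i hi => ?_⟩
  have h1 := coordSpan_le_iff (b := b).2 (Finset.coe_subset.2 h) (apply_sub_mem hg (b i))
  have h2 := add_mem h1 (basis_mem_coordSpan.2 hi : b i ∈ coordSpan b (J : Set ι))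
  rwa [sub_add_cancel] at h2

theorem ent_of_notMem_right [DecidableEq ι] {I : Finset ι} {g : GLInf b} (hg : g ∈ glPiece b I)
    {j : ι} (hj : j ∉ I) (i : ι) : ent g i j = if i = j then 1 else 0 := by
  rw [← ent_one (b := b) i j, ent, hg.1 j hj]
  rfl

theorem ent_of_notMem_left [DecidableEq ι] {I : Finset ι} {g : GLInf b} (hg : g ∈ glPiece b I)
    {i : ι} (hi : i ∉ I) (j : ι) : ent g i j = if i = j then 1 else 0 := by
  by_cases hj : j ∈ I
  · rw [if_neg fun h : i = j => hi (h ▸ hj)]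
    by_contra hne
    exact hi (mem_coordSpan.1 (hg.2 j hj) i hne)
  · exact ent_of_notMem_right hg hj i

theorem ent_mul {I : Finset ι} (g : GLInf b) {h : GLInf b} (hh : h ∈ glPiece b I) (i : ι) {j : ι}
    (hj : j ∈ I) : ent (g * h) i j = ∑ k ∈ I, ent g i k * ent h k j :=
  repr_apply_eq_sum g (hh.2 j hj) i

theorem exists_subset_of_exhaustion {E : ℕ → Finset ι} (hE : Monotone E) (hEι : ∀ i, ∃ n, i ∈ E n)
    {S : Set ι} (hS : S.Finite) : ∃ n, S ⊆ E n := by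
  induction S, hS using Set.Finite.induction_on with
  | empty => exact ⟨0, by simp⟩
  | @insert a s _ _ ih =>
    obtain ⟨n, hn⟩ := ih
    obtain ⟨m, hm⟩ := hEι a
    refine ⟨max n m, Set.insert_subset ?_ ?_⟩
    · exact hE (le_max_right n m) hm
    · exact hn.trans (Finset.coe_subset.2 (hE (le_max_left n m)))

theorem exists_mem_coordSpan {E : ℕ → Finset ι} (hE : Monotone E) (hEι : ∀ i, ∃ n, i ∈ E n)
    (b : Basis ι K V) {S : Set V} (hS : S.Finite) : ∃ n, S ⊆ coordSpan b (E n : Set ι) := by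
  have hfin : (⋃ v ∈ S, ((b.repr v).support : Set ι)).Finite :=
    hS.biUnion fun v _ => (b.repr v).support.finite_toSet
  obtain ⟨n, hn⟩ := exists_subset_of_exhaustion hE hEι hfin
  refine ⟨n, fun v hv => mem_coordSpan.2 fun i hi => hn ?_⟩
  simp only [Set.mem_iUnion]
  exact ⟨v, hv, by simpa using hi⟩

theorem exists_mem_glPiece {E : ℕ → Finset ι} (hE : Monotone E) (hEι : ∀ i, ∃ n, i ∈ E n)
    (g : GLInf b) : ∃ n, g ∈ glPiece b (E n) := by
  obtain ⟨n, hn⟩ := exists_subset_of_exhaustion hE hEι g.2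
  obtain ⟨m, hm⟩ := exists_mem_coordSpan hE hEι b ((E n).finite_toSet.image fun i => g.1 (b i))
  have h1 : ∀ i ∉ E n, g.1 (b i) = b i := fun i hi => by
    by_contra h
    exact hi (hn h)
  refine ⟨max n m, fun i hi => h1 i fun h => hi (hE (le_max_left n m) h), fun i hi => ?_⟩
  by_cases hin : i ∈ E n
  · exact coordSpan_le_iff.2 (Finset.coe_subset.2 (hE (le_max_right n m)))
      (hm ⟨i, hin, rfl⟩)
  · rw [h1 i hin]
    exact basis_mem_coordSpan.2 hi

/-- Linearly independent vectors of `⟨I⟩` indexed by `I` are the columns of an element of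
`G(I)`. -/
theorem exists_glPiece_of_linearIndependent (b : Basis ι K V) (I : Finset ι) {u : ι → V}
    (hu : ∀ i ∈ I, u i ∈ coordSpan b (I : Set ι)) (hli : LinearIndependent K fun i : I => u i) :
    ∃ g ∈ glPiece b I, ∀ i ∈ I, g.1 (b i) = u i := by
  classical
  let f : V →ₗ[K] V := b.constr K fun i => if i ∈ I then u i else b i
  have hf1 : ∀ i ∈ I, f (b i) = u i := fun i hi => by simp [f, b.constr_basis, hi]
  have hf2 : ∀ i ∉ I, f (b i) = b i := fun i hi => by simp [f, b.constr_basis, hi]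
  -- Coordinates outside `I` are untouched, so the kernel lies in `⟨I⟩`, where linear independence
  -- of the columns applies.
  have hcoord : ∀ i ∉ I, ∀ v, b.repr (f v) i = b.repr v i := by
    intro i hi v
    have : (b.coord i).comp f = b.coord i := by
      refine b.ext fun j => ?_
      by_cases hj : j ∈ I
      · have h0 : b.repr (u j) i = 0 := by
          by_contra h; exact hi (mem_coordSpan.1 (hu j hj) i h)
        have hij : j ≠ i := fun h => hi (h ▸ hj)
        simp [hf1 j hj, h0, hij]
      · simp [hf2 j hj]
    exact congrArg (fun φ => φ v) this
  have hinj : Function.Injective f := by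
    rw [← LinearMap.ker_eq_bot, LinearMap.ker_eq_bot']
    intro v hv
    have hvI : v ∈ coordSpan b (I : Set ι) := mem_coordSpan.2 fun i hi => by
      by_contra h
      exact hi (by rw [← hcoord i h v, hv]; simp)
    have hsum : v = ∑ i : I, b.repr v i • b i := by
      conv_lhs => rw [← b.linearCombination_repr v, Finsupp.linearCombination_apply]
      rw [Finset.sum_coe_sort I fun i => b.repr v i • b i]
      refine Finsupp.sum_of_support_subset _ (fun k hk => ?_) _ (by simp)
      exact mem_coordSpan.1 hvI k (by simpa using hk)
    rw [hsum] at hv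
    simp only [map_sum, map_smul] at hv
    have hv' : ∑ i : I, b.repr v i • u i = 0 := by
      rw [← hv]
      exact Finset.sum_congr rfl fun i _ => by rw [hf1 i i.2]
    have h0 := Fintype.linearIndependent_iff.1 hli (fun i => b.repr v i) hv'
    rw [hsum]
    exact Finset.sum_eq_zero fun i _ => by rw [h0 i, zero_smul]
  have hspan : Submodule.span K (Set.range fun i : I => u i) = coordSpan b (I : Set ι) := by
    refine Submodule.eq_of_le_of_finrank_eq (Submodule.span_le.2 ?_) ?_
    · rintro _ ⟨i, rfl⟩
      exact hu i i.2
    · rw [finrank_span_eq_card hli, finrank_coordSpan]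
      simp
  have hsurj : Function.Surjective f := by
    rw [← LinearMap.range_eq_top, eq_top_iff, ← b.span_eq, Submodule.span_le]
    rintro _ ⟨i, rfl⟩
    by_cases hi : i ∈ I
    · have h1 : b i ∈ Submodule.span K (Set.range fun i : I => u i) := by
        rw [hspan]; exact basis_mem_coordSpan.2 hi
      refine Submodule.span_le.2 ?_ h1
      rintro _ ⟨j, rfl⟩
      exact ⟨b j, hf1 j j.2⟩
    · exact ⟨b i, hf2 i hi⟩
  have hmem : LinearEquiv.ofBijective f ⟨hinj, hsurj⟩ ∈ GLInf b := by
    refine I.finite_toSet.subset fun i hi => ?_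
    by_contra h
    exact hi (hf2 i h)
  refine ⟨⟨_, hmem⟩, ⟨fun i hi => hf2 i hi, fun i hi => ?_⟩, hf1⟩
  show f (b i) ∈ _
  rw [hf1 i hi]
  exact hu i hi

theorem map_sup_coordSpan {I : Finset ι} {g : GLInf b} (hg : g ∈ glPiece b I)
    (W : Submodule K V) :
    W.map (g.1 : V →ₗ[K] V) ⊔ coordSpan b (I : Set ι) = W ⊔ coordSpan b (I : Set ι) := by
  refine le_antisymm (sup_le ?_ le_sup_right) (sup_le ?_ le_sup_right)
  · rintro _ ⟨v, hv, rfl⟩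
    exact Submodule.mem_sup.2 ⟨v, hv, _, apply_sub_mem hg v, add_sub_cancel _ _⟩
  · intro v hv
    exact Submodule.mem_sup.2 ⟨g.1 v, ⟨v, hv, rfl⟩, _, neg_mem (apply_sub_mem hg v), by abel⟩

theorem map_inf_coordSpan {I : Finset ι} {g : GLInf b} (hg : g ∈ glPiece b I)
    (W : Submodule K V) : W.map (g.1 : V →ₗ[K] V) ⊓ coordSpan b (I : Set ι) =
      (W ⊓ coordSpan b (I : Set ι)).map (g.1 : V →ₗ[K] V) := by
  conv_lhs => rw [← map_coordSpan_self hg]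
  exact (Submodule.map_inf _ g.1.injective).symm

theorem finrank_map_inf_coordSpan {I : Finset ι} {g : GLInf b} (hg : g ∈ glPiece b I)
    (W : Submodule K V) :
    finrank K (W.map (g.1 : V →ₗ[K] V) ⊓ coordSpan b (I : Set ι) : Submodule K V) =
      finrank K (W ⊓ coordSpan b (I : Set ι) : Submodule K V) := by
  rw [map_inf_coordSpan hg]
  exact LinearEquiv.finrank_map_eq g.1 _

theorem map_eq_of_le {I : Finset ι} {g : GLInf b} (hg : g ∈ glPiece b I) {W : Submodule K V}
    (h : W.map (g.1 : V →ₗ[K] V) ≤ W) : W.map (g.1 : V →ₗ[K] V) = W :=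
  eq_of_le_of_sup_eq h (map_sup_coordSpan hg W) (finrank_map_inf_coordSpan hg W)

end Group

/-! ## The generalized flags `F_σ` and their translates -/

section Flags

variable {K : Type*} [Field K] {V : Type*} [AddCommGroup V] [Module K V] {ι : Type*}
  {A : Type*} [LinearOrder A]

theorem lower_mem (b : Basis ι K V) (σ : ι → A) (α : A) : lower b σ α ∈ flagOf b σ :=
  ⟨α, Or.inl rfl⟩

theorem exists_flag_set {b : Basis ι K V} {σ : ι → A} {W : Submodule K V} (hW : W ∈ flagOf b σ) :
    ∃ T : Set A, IsLowerSet T ∧ W = coordSpan b (σ ⁻¹' T) := by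
  obtain ⟨α, rfl | rfl⟩ := hW
  · exact ⟨Set.Iio α, isLowerSet_Iio α, rfl⟩
  · exact ⟨Set.Iic α, isLowerSet_Iic α, rfl⟩

theorem isChain_flagOf (b : Basis ι K V) (σ : ι → A) : IsChain (· ≤ ·) (flagOf b σ) := by
  intro W hW W' hW' _
  obtain ⟨T, hT, rfl⟩ := exists_flag_set hW
  obtain ⟨T', hT', rfl⟩ := exists_flag_set hW'
  exact (hT.total hT').imp (fun h => coordSpan_le_iff.2 (Set.preimage_mono h))
    (fun h => coordSpan_le_iff.2 (Set.preimage_mono h))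

theorem lower_le_upper (b : Basis ι K V) (σ : ι → A) (α : A) : lower b σ α ≤ upper b σ α :=
  coordSpan_le_iff.2 fun _ h => le_of_lt h

theorem upper_le_lower (b : Basis ι K V) (σ : ι → A) {α β : A} (h : α < β) :
    upper b σ α ≤ lower b σ β :=
  coordSpan_le_iff.2 fun i (hi : σ i ≤ α) => lt_of_le_of_lt hi h

theorem isConsecutive_flagOf (b : Basis ι K V) {σ : ι → A} (i : ι) :
    IsConsecutive (flagOf b σ) (lower b σ (σ i), upper b σ (σ i)) := by
  refine ⟨lower_mem b σ _, upper_mem b σ _, coordSpan_lt_iff.2 ⟨fun _ h => le_of_lt h, fun h =>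
    lt_irrefl _ (h (le_refl (σ i)) : σ i < σ i)⟩, ?_⟩
  rintro W hW ⟨h1, h2⟩
  obtain ⟨T, hT, rfl⟩ := exists_flag_set hW
  by_cases hi : σ i ∈ T
  · exact h2.not_ge (coordSpan_le_iff.2 fun j (hj : σ j ≤ σ i) => hT hj hi)
  · refine h1.not_ge (coordSpan_le_iff.2 fun j (hj : σ j ∈ T) => ?_)
    by_contra h
    exact hi (hT (not_lt.1 h) hj)

/-- An index `i` in the gap between the two lower sets squeezes the pair at `σ i` between the given
two spaces; as nothing lies strictly between these, the pairs agree. -/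
theorem eq_of_isConsecutive_flagOf {b : Basis ι K V} {σ : ι → A}
    {p : Submodule K V × Submodule K V} (hp : IsConsecutive (flagOf b σ) p) :
    ∃ i, p = (lower b σ (σ i), upper b σ (σ i)) := by
  obtain ⟨h1, h2, hlt, hno⟩ := hp
  obtain ⟨T, hT, hpT⟩ := exists_flag_set h1
  obtain ⟨T', hT', hpT'⟩ := exists_flag_set h2
  rw [hpT, hpT', coordSpan_lt_iff] at hlt
  obtain ⟨i, hi', hi⟩ := Set.exists_of_ssubset hlt
  have hle1 : p.1 ≤ lower b σ (σ i) := by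
    rw [hpT]
    refine coordSpan_le_iff.2 fun j (hj : σ j ∈ T) => ?_
    by_contra h
    exact hi (hT (not_lt.1 h) hj)
  have hle2 : upper b σ (σ i) ≤ p.2 := by
    rw [hpT']
    exact coordSpan_le_iff.2 fun j (hj : σ j ≤ σ i) => hT' hj hi'
  have hc := (isConsecutive_flagOf b (σ := σ) i).2.2.1
  refine ⟨i, Prod.ext ?_ ?_⟩
  · refine eq_of_le_of_not_lt hle1 fun h => hno _ (lower_mem b σ _) ⟨h, hc.trans_le hle2⟩
  · refine (eq_of_le_of_not_lt hle2 fun h => hno _ (upper_mem b σ _) ⟨?_, h⟩).symm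
    exact hle1.trans_lt hc

theorem isGeneralizedFlag_flagOf (b : Basis ι K V) {σ : ι → A} (hσ : Function.Surjective σ) :
    IsGeneralizedFlag (flagOf b σ) where
  chain := isChain_flagOf b σ
  consec := by
    rintro W ⟨α, hW⟩
    obtain ⟨i, rfl⟩ := hσ α
    exact ⟨_, isConsecutive_flagOf b i, hW.imp Eq.symm Eq.symm⟩
  vector := by
    intro v hv
    have hne : (b.repr v).support.Nonempty := by
      rw [Finsupp.support_nonempty_iff]
      simpa using hv
    -- The largest value of `σ` on the support of `v` determines the pair of consecutive spaces that
    -- separates `v`.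
    obtain ⟨i, hi, hmax⟩ := Finset.exists_max_image _ σ hne
    refine ⟨_, isConsecutive_flagOf b i, mem_coordSpan.2 fun j hj => hmax j (by simpa using hj),
      fun h => ?_⟩
    exact lt_irrefl (σ i) (mem_coordSpan.1 h i (by simpa using hi))

theorem isCompatible_flagOf (b : Basis ι K V) {σ : ι → A} (hσ : Function.Surjective σ) :
    IsCompatible b (flagOf b σ) := by
  refine ⟨isGeneralizedFlag_flagOf b hσ, fun i => (lower b σ (σ i), upper b σ (σ i)),
    fun i => isConsecutive_flagOf b i, fun p hp => ?_⟩
  obtain ⟨i, rfl⟩ := eq_of_isConsecutive_flagOf hp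
  have hle : ∀ j k : ι, (lower b σ (σ j), upper b σ (σ j)) ≤ (lower b σ (σ k), upper b σ (σ k)) ↔
      σ j ≤ σ k := by
    intro j k
    constructor
    · intro h
      exact coordSpan_le_iff.1 h.2 (le_refl (σ j))
    · intro h
      exact ⟨coordSpan_le_iff.2 fun l (hl : σ l < σ j) => hl.trans_le h,
        coordSpan_le_iff.2 fun l (hl : σ l ≤ σ j) => hl.trans h⟩
  constructor
  · simp only [lt_iff_le_not_ge, hle]
    simp only [← lt_iff_le_not_ge]
    rfl
  · simp only [hle]
    rfl

theorem act_flagOf (b : Basis ι K V) (σ : ι → A) (g : V ≃ₗ[K] V) :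
    act g (flagOf b σ) = flagOf (b.map g) σ := by
  have h : ∀ S : Set ι, (coordSpan b S).map (g : V →ₗ[K] V) = coordSpan (b.map g) S := by
    intro S
    rw [coordSpan, Submodule.map_span, ← Set.image_comp]
    congr 1
  ext W
  constructor
  · rintro ⟨_, ⟨α, rfl | rfl⟩, rfl⟩
    · exact ⟨α, Or.inl (h _)⟩
    · exact ⟨α, Or.inr (h _)⟩
  · rintro ⟨α, rfl | rfl⟩
    · exact ⟨_, lower_mem b σ α, h _⟩
    · exact ⟨_, upper_mem b σ α, h _⟩

theorem isWeaklyCompatible_act (b : Basis ι K V) {σ : ι → A} (hσ : Function.Surjective σ)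
    (g : GLInf b) : IsWeaklyCompatible b (act g.1 (flagOf b σ)) := by
  refine ⟨b.map g.1, ?_, (Set.Finite.image b g.2).subset ?_⟩
  · rw [act_flagOf]
    exact isCompatible_flagOf _ hσ
  · rintro _ ⟨⟨i, rfl⟩, hi⟩
    exact ⟨i, fun h => hi ⟨i, by simpa using h⟩, rfl⟩

/-- The isomorphism of ordered sets `F → gF`. -/
noncomputable def actIso (g : V ≃ₗ[K] V) (F : Set (Submodule K V)) : F ≃o act g F where
  toFun W := ⟨W.1.map (g : V →ₗ[K] V), W.1, W.2, rfl⟩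
  invFun W := ⟨W.1.map (g.symm : V →ₗ[K] V), by
    obtain ⟨W, W', hW', rfl⟩ := W
    have : (W'.map (g : V →ₗ[K] V)).map (g.symm : V →ₗ[K] V) = W' := by
      rw [← Submodule.map_comp]
      simp
    simpa only [this] using hW'⟩
  left_inv W := by
    apply Subtype.ext
    show (W.1.map (g : V →ₗ[K] V)).map (g.symm : V →ₗ[K] V) = W
    rw [← Submodule.map_comp]
    simp
  right_inv W := by
    apply Subtype.ext
    show (W.1.map (g.symm : V →ₗ[K] V)).map (g : V →ₗ[K] V) = W
    rw [← Submodule.map_comp]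
    simp
  map_rel_iff' := by
    intro W W'
    show W.1.map (g : V →ₗ[K] V) ≤ W'.1.map (g : V →ₗ[K] V) ↔ W.1 ≤ W'.1
    exact Submodule.map_le_map_iff_of_injective g.injective _ _

theorem coe_actIso (g : V ≃ₗ[K] V) {F : Set (Submodule K V)} (W : F) :
    (actIso g F W : Submodule K V) = W.1.map (g : V →ₗ[K] V) := rfl

theorem exists_finset_mem_glPiece {b : Basis ι K V} (g : GLInf b) : ∃ I, g ∈ glPiece b I := by
  classical
  let S := Set.Finite.toFinset (s := {i | g.1 (b i) ≠ b i}) g.2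
  refine ⟨S ∪ S.biUnion fun i => (b.repr (g.1 (b i))).support, fun i hi => ?_, fun i hi => ?_⟩
  · by_contra h
    exact hi (Finset.mem_union_left _ ((Set.Finite.mem_toFinset _).2 h))
  · by_cases h : g.1 (b i) = b i
    · rw [h]
      exact basis_mem_coordSpan.2 hi
    · refine mem_coordSpan.2 fun k hk => Finset.mem_coe.2 (Finset.mem_union_right _ ?_)
      exact Finset.mem_biUnion.2 ⟨i, (Set.Finite.mem_toFinset _).2 h, by simpa using hk⟩

theorem isCommensuration_actIso {b : Basis ι K V} (g : GLInf b) (F : Set (Submodule K V)) :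
    IsCommensuration (actIso g.1 F) := by
  obtain ⟨I, hI⟩ := exists_finset_mem_glPiece g
  exact ⟨coordSpan b (I : Set ι), inferInstance, fun W =>
    ⟨map_sup_coordSpan hI _, finrank_map_inf_coordSpan hI _⟩⟩

theorem act_mem_Fl (b : Basis ι K V) {σ : ι → A} (hσ : Function.Surjective σ) (g : GLInf b) :
    act g.1 (flagOf b σ) ∈ Fl b (flagOf b σ) := by
  refine ⟨?_, isWeaklyCompatible_act b hσ g, _, isCommensuration_actIso g _⟩
  have := isWeaklyCompatible_act b hσ (1 : GLInf b)
  rwa [show act ((1 : GLInf b)).1 (flagOf b σ) = flagOf b σ from act_one _] at this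

/-- A commensuration is unique. -/
theorem commensuration_unique {F G : Set (Submodule K V)} (hG : IsChain (· ≤ ·) G) {φ ψ : F ≃o G}
    (hφ : IsCommensuration φ) (hψ : IsCommensuration ψ) (W : F) :
    (φ W : Submodule K V) = ψ W := by
  obtain ⟨U, hU, h⟩ := hφ
  obtain ⟨U', hU', h'⟩ := hψ
  -- Both witnesses are enlarged to `U + U'`. The two images of `W` are comparable in the chain `G`
  -- and have the same sum and intersection dimension with that space.
  have h1 := sup_eq_of_le (le_sup_left : U ≤ U ⊔ U') (h W).1
  have h2 := finrank_inf_eq_of_le (le_sup_left : U ≤ U ⊔ U') (h W).1 (h W).2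
  have h1' := sup_eq_of_le (le_sup_right : U' ≤ U ⊔ U') (h' W).1
  have h2' := finrank_inf_eq_of_le (le_sup_right : U' ≤ U ⊔ U') (h' W).1 (h' W).2
  rcases hG.total (φ W).2 (ψ W).2 with hle | hle
  · exact eq_of_le_of_sup_eq hle (h1.trans h1'.symm) (h2.trans h2'.symm)
  · exact (eq_of_le_of_sup_eq hle (h1'.trans h1.symm) (h2'.trans h2.symm)).symm

/-- If `gF_σ = hF_σ`, then `g` and `h` agree on each member of the flag. -/
theorem map_eq_of_act_eq {b : Basis ι K V} {σ : ι → A} {g h : GLInf b}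
    (H : act g.1 (flagOf b σ) = act h.1 (flagOf b σ)) {W : Submodule K V} (hW : W ∈ flagOf b σ) :
    W.map (g.1 : V →ₗ[K] V) = W.map (h.1 : V →ₗ[K] V) := by
  have hchain : IsChain (· ≤ ·) (act h.1 (flagOf b σ)) := by
    rw [act_flagOf]; exact isChain_flagOf _ _
  -- The target of `actIso` is literally `act g.1 _`; generalizing over the target lets the equality
  -- `H` be substituted.
  have hcomm : ∀ {G : Set (Submodule K V)} (e : act g.1 (flagOf b σ) = G),
      ∃ φ : flagOf b σ ≃o G, IsCommensuration φ ∧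
        ∀ W, (φ W : Submodule K V) = W.1.map (g.1 : V →ₗ[K] V) := by
    rintro _ rfl
    exact ⟨actIso g.1 _, isCommensuration_actIso g _, fun W => rfl⟩
  obtain ⟨φ, hφ, hφW⟩ := hcomm H
  have := commensuration_unique hchain hφ (isCommensuration_actIso h (flagOf b σ)) ⟨W, hW⟩
  rwa [hφW, coe_actIso] at this

/-! ### The pieces of `Fl(F, E)` are homogeneous spaces -/

theorem map_coordSpan_eq_sup {b : Basis ι K V} {I : Finset ι} {g : GLInf b}
    (hg : g ∈ glPiece b I) (S : Set ι) : (coordSpan b S).map (g.1 : V →ₗ[K] V) =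
      (coordSpan b (S ∩ I)).map (g.1 : V →ₗ[K] V) ⊔ coordSpan b (S \ I) := by
  have h : (coordSpan b (S \ I)).map (g.1 : V →ₗ[K] V) = coordSpan b (S \ I) := by
    rw [coordSpan, Submodule.map_span, ← Set.image_comp]
    congr 1
    exact Set.image_congr fun i hi => hg.1 i hi.2
  rw [← h, ← Submodule.map_sup, coordSpan_sup, Set.inter_union_sdiff]

/-- Greedy choice in increasing order of `σ`: the indices treated before `a` all have value at most
`σ a`, so they number fewer than `dim M (σ a)` and their vectors cannot span `M (σ a)`. -/
theorem exists_linearIndepOn_mem (σ : ι → A) (I : Finset ι) {M : A → Submodule K V}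
    (hM : ∀ α, (I.filter fun i => σ i ≤ α).card ≤ finrank K (M α)) (s : Finset ι) (hs : s ⊆ I) :
    ∃ u : ι → V, (∀ i ∈ s, u i ∈ M (σ i)) ∧ LinearIndepOn K u (s : Set ι) := by
  classical
  induction s using Finset.induction_on_max_value σ with
  | empty => exact ⟨0, by simp, by simp⟩
  | insert a s ha hmax ih =>
    obtain ⟨u, hu, hli⟩ := ih ((Finset.subset_insert a s).trans hs)
    have hcard : s.card < finrank K (M (σ a)) := by
      refine lt_of_lt_of_le ?_ (hM (σ a))
      rw [← Nat.succ_le_iff, Nat.succ_eq_add_one, ← Finset.card_insert_of_notMem ha]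
      refine Finset.card_le_card fun i hi => Finset.mem_filter.2 ⟨hs hi, ?_⟩
      rcases Finset.mem_insert.1 hi with rfl | hi
      · exact le_rfl
      · exact hmax i hi
    have hex : ∃ v ∈ M (σ a), v ∉ Submodule.span K (u '' (s : Set ι)) := by
      by_contra! h
      have hle : M (σ a) ≤ Submodule.span K ((s.image u : Finset V) : Set V) := by
        rw [Finset.coe_image]; exact h
      have h1 := (Submodule.finrank_mono hle).trans (finrank_span_finset_le_card (s.image u))
      exact absurd (h1.trans Finset.card_image_le) (not_le.2 hcard)
    obtain ⟨v, hv, hvs⟩ := hex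
    have hne : ∀ i ∈ s, Function.update u a v i = u i := fun i hi =>
      Function.update_of_ne (fun h : i = a => ha (h ▸ hi)) _ _
    refine ⟨Function.update u a v, fun i hi => ?_, ?_⟩
    · rcases Finset.mem_insert.1 hi with rfl | hi
      · rwa [Function.update_self]
      · rw [hne i hi]
        exact hu i hi
    · rw [Finset.coe_insert]
      have himg : Function.update u a v '' (s : Set ι) = u '' (s : Set ι) :=
        Set.image_congr fun i hi => hne i hi
      refine LinearIndepOn.insert ?_ ?_
      · exact hli.congr fun i hi => (hne i hi).symm
      · rwa [himg, Function.update_self]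

theorem inter_coe_eq_filter (I : Finset ι) (p : ι → Prop) [DecidablePred p] :
    {i | p i} ∩ (I : Set ι) = (I.filter p : Finset ι) := by
  ext i
  simp [and_comm]

theorem diff_coe_eq (I : Finset ι) (p : ι → Prop) :
    {i | p i} \ (I : Set ι) = {i | i ∉ I ∧ p i} := by
  ext i
  simp [and_comm]

/-- Transitivity of `G(I)` on flags of prescribed dimensions. A basis adapted to the spaces `M''`
gives the columns of `g`; it is adapted to the `M'` as well, since `M''` at a smaller value lies in
`M'`. The inclusions become equalities by counting dimensions. -/
theorem mem_flPiece_iff {b : Basis ι K V} {σ₀ : ι → A} {I : Finset ι}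
    {G : Fl b (flagOf b σ₀)} :
    G ∈ flPiece b σ₀ I ↔ ∃ g ∈ glPiece b I, G.1 = act g.1 (flagOf b σ₀) := by
  classical
  have hact : ∀ g ∈ glPiece b I, ∀ M' M'' : A → Submodule K V,
      (∀ α, M' α = (coordSpan b (I.filter fun i => σ₀ i < α : Finset ι)).map (g.1 : V →ₗ[K] V)) →
      (∀ α, M'' α = (coordSpan b (I.filter fun i => σ₀ i ≤ α : Finset ι)).map (g.1 : V →ₗ[K] V)) →
      act g.1 (flagOf b σ₀) =
        {W | ∃ α, W = M' α ⊔ Submodule.span K (b '' {i | i ∉ I ∧ σ₀ i < α}) ∨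
          W = M'' α ⊔ Submodule.span K (b '' {i | i ∉ I ∧ σ₀ i ≤ α})} := by
    intro g hg M' M'' hM' hM''
    have hl : ∀ α, (lower b σ₀ α).map (g.1 : V →ₗ[K] V) =
        M' α ⊔ Submodule.span K (b '' {i | i ∉ I ∧ σ₀ i < α}) := fun α => by
      rw [hM', ← inter_coe_eq_filter, ← diff_coe_eq]
      exact map_coordSpan_eq_sup hg _
    have hu : ∀ α, (upper b σ₀ α).map (g.1 : V →ₗ[K] V) =
        M'' α ⊔ Submodule.span K (b '' {i | i ∉ I ∧ σ₀ i ≤ α}) := fun α => by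
      rw [hM'', ← inter_coe_eq_filter, ← diff_coe_eq]
      exact map_coordSpan_eq_sup hg _
    ext W
    constructor
    · rintro ⟨_, ⟨α, rfl | rfl⟩, rfl⟩
      · exact ⟨α, Or.inl (hl α)⟩
      · exact ⟨α, Or.inr (hu α)⟩
    · rintro ⟨α, rfl | rfl⟩
      · exact ⟨_, lower_mem b σ₀ α, hl α⟩
      · exact ⟨_, upper_mem b σ₀ α, hu α⟩
  constructor
  · rintro ⟨M', M'', hM, hlt, hG⟩
    have hmono : ∀ {α β}, α ≤ β → M'' α ≤ M'' β := by
      intro α β h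
      rcases h.eq_or_lt with rfl | h
      · exact le_rfl
      · exact (hlt α β h).trans (hM β).1
    obtain ⟨u, hu, hli⟩ := exists_linearIndepOn_mem σ₀ I (M := M'')
      (fun α => (hM α).2.2.2.ge) I subset_rfl
    obtain ⟨g, hg, hgu⟩ := exists_glPiece_of_linearIndependent b I (u := u)
      (fun i hi => (hM _).2.1 (hu i hi)) hli
    refine ⟨g, hg, hG.trans (hact g hg M' M'' (fun α => ?_) fun α => ?_).symm⟩
    all_goals
      symm
      have hfd : FiniteDimensional K (M'' α) := Submodule.finiteDimensional_of_le (hM α).2.1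
      have hfd' : FiniteDimensional K (M' α) := Submodule.finiteDimensional_of_le (hM α).1
      refine Submodule.eq_of_le_of_finrank_eq ?_ ?_
    · rw [Submodule.map_span_le]
      rintro _ ⟨i, hi, rfl⟩
      obtain ⟨hiI, hiα⟩ := Finset.mem_filter.1 (Finset.mem_coe.1 hi)
      have h1 := hlt _ _ hiα (hu i hiI)
      rwa [← hgu i hiI] at h1
    · exact (LinearEquiv.finrank_map_eq g.1 _).trans
        ((finrank_coordSpan b _).trans (hM α).2.2.1.symm)
    · rw [Submodule.map_span_le]
      rintro _ ⟨i, hi, rfl⟩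
      obtain ⟨hiI, hiα⟩ := Finset.mem_filter.1 (Finset.mem_coe.1 hi)
      have h1 := hmono hiα (hu i hiI)
      rwa [← hgu i hiI] at h1
    · exact (LinearEquiv.finrank_map_eq g.1 _).trans
        ((finrank_coordSpan b _).trans (hM α).2.2.2.symm)
  · rintro ⟨g, hg, hG⟩
    refine ⟨fun α => (coordSpan b (I.filter fun i => σ₀ i < α : Finset ι)).map (g.1 : V →ₗ[K] V),
      fun α => (coordSpan b (I.filter fun i => σ₀ i ≤ α : Finset ι)).map (g.1 : V →ₗ[K] V),
      fun α => ⟨Submodule.map_mono (coordSpan_le_iff.2 fun i hi => ?_), ?_, ?_, ?_⟩,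
      fun α β hαβ => Submodule.map_mono (coordSpan_le_iff.2 fun i hi => ?_),
      hG.trans (hact g hg _ _ (fun _ => rfl) fun _ => rfl)⟩
    · simp only [Finset.coe_filter, Set.mem_ofPred_eq] at hi ⊢
      exact ⟨hi.1, hi.2.le⟩
    · refine le_of_le_of_eq (Submodule.map_mono (coordSpan_le_iff.2 ?_)) (map_coordSpan_self hg)
      exact Finset.coe_subset.2 (Finset.filter_subset _ _)
    · exact (LinearEquiv.finrank_map_eq g.1 _).trans (finrank_coordSpan b _)
    · exact (LinearEquiv.finrank_map_eq g.1 _).trans (finrank_coordSpan b _)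
    · simp only [Finset.coe_filter, Set.mem_ofPred_eq] at hi ⊢
      exact ⟨hi.1, hi.2.trans_lt hαβ⟩

/-- Weak compatibility bounds the vectors of `b` missing from `l`; this is the reverse bound. If `l
j` is not in `b`, its coordinate functional vanishes on every `b i` belonging to `l`, so being
nonzero it must detect one of the finitely many remaining `b i`. -/
theorem finite_notMem_range {b l : Basis ι K V} (h : (Set.range b \ Set.range l).Finite) :
    {j | l j ∉ Set.range b}.Finite := by
  classical
  have hfin : (⋃ v ∈ Set.range b \ Set.range l, ((l.repr v).support : Set ι)).Finite :=
    h.biUnion fun v _ => (l.repr v).support.finite_toSet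
  refine hfin.subset fun j hj => ?_
  by_contra hc
  simp only [Set.mem_iUnion, not_exists] at hc
  have h0 : l.coord j = 0 := by
    refine b.ext fun i => ?_
    by_cases hi : b i ∈ Set.range l
    · obtain ⟨k, hk⟩ := hi
      have hkj : k ≠ j := fun h => hj ⟨i, by rw [← h, hk]⟩
      simp [← hk, hkj]
    · have := hc (b i) ⟨⟨i, rfl⟩, hi⟩
      simpa using this
  have h1 : l.coord j (l j) = 1 := by simp
  rw [h0] at h1
  simp at h1

theorem eq_inf_sup_coordSpan {b l : Basis ι K V} {I : Finset ι}
    (hl : ∀ j, l j ∈ coordSpan b (I : Set ι) ∨ ∃ i ∉ I, l j = b i) (T : Set ι) :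
    coordSpan l T = coordSpan l T ⊓ coordSpan b (I : Set ι) ⊔
      coordSpan b {i | i ∉ I ∧ b i ∈ coordSpan l T} := by
  refine le_antisymm (Submodule.span_le.2 ?_) (sup_le inf_le_left (Submodule.span_le.2 ?_))
  · rintro _ ⟨j, hj, rfl⟩
    have hj' : l j ∈ coordSpan l T := basis_mem_coordSpan.2 hj
    rcases hl j with h | ⟨i, hi, h⟩
    · exact Submodule.mem_sup_left ⟨hj', h⟩
    · refine Submodule.mem_sup_right ?_
      rw [h]
      exact basis_mem_coordSpan.2 ⟨hi, h ▸ hj'⟩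
  · rintro _ ⟨i, hi, rfl⟩
    exact hi.2

/-- Take `I = E n` so large that `⟨I⟩` contains `U` and all vectors of the adapted basis that are
not in `b`. Each member of `G` then splits into its part in `⟨I⟩` and basis vectors outside `I`.
Equality of the sums with `⟨I⟩` identifies the outside part with that of `F`, and the intersection
dimensions with `⟨I⟩` are those of `F`. -/
theorem exists_mem_flPiece {b : Basis ι K V} {E : ℕ → Finset ι} (hE : Monotone E)
    (hEι : ∀ i, ∃ n, i ∈ E n) {σ₀ : ι → A} (G : Fl b (flagOf b σ₀)) :
    ∃ n, G ∈ flPiece b σ₀ (E n) := by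
  classical
  obtain ⟨G, hFw, ⟨l, ⟨hgf, s, hs, hcomp⟩, hfin⟩, φ, U, hU, hφ⟩ := G
  obtain ⟨S, hS⟩ := (Submodule.fg_iff_finiteDimensional U).2 hU
  obtain ⟨n, hn⟩ := exists_mem_coordSpan hE hEι b
    (S.finite_toSet.union ((finite_notMem_range hfin).image l))
  set I := E n with hI
  have hUI : U ≤ coordSpan b (I : Set ι) := by
    rw [← hS, Submodule.span_le]
    exact fun v hv => hn (Or.inl hv)
  have hl : ∀ j, l j ∈ coordSpan b (I : Set ι) ∨ ∃ i ∉ I, l j = b i := by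
    intro j
    by_cases hj : l j ∈ Set.range b
    · obtain ⟨i, hi⟩ := hj
      by_cases hiI : i ∈ I
      · exact Or.inl (hi ▸ basis_mem_coordSpan.2 hiI)
      · exact Or.inr ⟨i, hiI, hi.symm⟩
    · exact Or.inl (hn (Or.inr ⟨j, hj, rfl⟩))
  have hset : ∀ W ∈ G, ∃ T, W = coordSpan l T := by
    intro W hW
    obtain ⟨p, hp, rfl | rfl⟩ := hgf.consec W hW
    · exact ⟨_, (hcomp p hp).1⟩
    · exact ⟨_, (hcomp p hp).2⟩
  have hdec : ∀ (W : flagOf b σ₀) (T : Set ι), W.1 = coordSpan b T →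
      (φ W : Submodule K V) =
        (φ W : Submodule K V) ⊓ coordSpan b (I : Set ι) ⊔ coordSpan b {i | i ∉ I ∧ i ∈ T} := by
    intro W T hT
    obtain ⟨T', hT'⟩ := hset _ (φ W).2
    have hd := eq_inf_sup_coordSpan hl T'
    rw [← hT'] at hd
    have hsup := sup_eq_of_le hUI (hφ W).1
    have hset' : {i | i ∉ I ∧ b i ∈ (φ W : Submodule K V)} = {i | i ∉ I ∧ i ∈ T} := by
      have h1 : (φ W : Submodule K V) ⊔ coordSpan b (I : Set ι) =
          coordSpan b (I ∪ {i | i ∉ I ∧ b i ∈ (φ W : Submodule K V)}) := by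
        rw [← coordSpan_sup]
        refine le_antisymm (sup_le ?_ le_sup_left) (sup_le le_sup_right ?_)
        · conv_lhs => rw [hd]
          exact sup_le_sup inf_le_right le_rfl
        · refine (le_sup_right.trans hd.ge).trans le_sup_left
      rw [h1, hT, coordSpan_sup] at hsup
      have h2 := coordSpan_injective b hsup
      ext i
      have h3 := Set.ext_iff.1 h2 i
      simp only [Set.mem_union, Finset.mem_coe, Set.mem_ofPred_eq] at h3 ⊢
      tauto
    rw [← hset']
    exact hd
  refine ⟨n, fun α => (φ ⟨lower b σ₀ α, lower_mem b σ₀ α⟩ : Submodule K V) ⊓ coordSpan b I,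
    fun α => (φ ⟨upper b σ₀ α, upper_mem b σ₀ α⟩ : Submodule K V) ⊓ coordSpan b I,
    fun α => ⟨inf_le_inf_right _ (φ.monotone (lower_le_upper b σ₀ α)), inf_le_right, ?_, ?_⟩,
    fun α β hαβ => inf_le_inf_right _ (φ.monotone (upper_le_lower b σ₀ hαβ)), ?_⟩
  · rw [finrank_inf_eq_of_le hUI (hφ _).1 (hφ _).2]
    show finrank K (coordSpan b {i | σ₀ i < α} ⊓ coordSpan b (I : Set ι) : Submodule K V) = _
    rw [coordSpan_inf, inter_coe_eq_filter, finrank_coordSpan]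
  · rw [finrank_inf_eq_of_le hUI (hφ _).1 (hφ _).2]
    show finrank K (coordSpan b {i | σ₀ i ≤ α} ⊓ coordSpan b (I : Set ι) : Submodule K V) = _
    rw [coordSpan_inf, inter_coe_eq_filter, finrank_coordSpan]
  · ext W
    constructor
    · intro hW
      obtain ⟨⟨W', α, hα⟩, hW'⟩ := φ.surjective ⟨W, hW⟩
      obtain rfl : (φ ⟨W', α, hα⟩ : Submodule K V) = W := by rw [hW']
      rcases hα with rfl | rfl
      · exact ⟨α, Or.inl (hdec _ _ rfl)⟩
      · exact ⟨α, Or.inr (hdec _ _ rfl)⟩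
    · rintro ⟨α, rfl | rfl⟩
      · have := hdec ⟨lower b σ₀ α, lower_mem b σ₀ α⟩ _ rfl
        refine Eq.subst (motive := (· ∈ G)) this (φ _).2
      · have := hdec ⟨upper b σ₀ α, upper_mem b σ₀ α⟩ _ rfl
        refine Eq.subst (motive := (· ∈ G)) this (φ _).2

end Flags

/-! ## The Bruhat decomposition -/

section Perm

variable {K : Type*} [Field K] {V : Type*} [AddCommGroup V] [Module K V] {ι : Type*}

/-- The permutation matrix of a finitary permutation. -/
noncomputable def permGL (b : Basis ι K V) (w : WInf ι) : GLInf b :=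
  ⟨b.equiv b w.1, by
    refine Set.Finite.subset w.2 fun i hi h => hi ?_
    simp [h]⟩

theorem permGL_apply (b : Basis ι K V) (w : WInf ι) (i : ι) : (permGL b w).1 (b i) = b (w.1 i) := by
  simp [permGL]

theorem map_permGL (b : Basis ι K V) (w : WInf ι) (S : Set ι) :
    (coordSpan b S).map ((permGL b w).1 : V →ₗ[K] V) = coordSpan b (w.1 '' S) := by
  rw [coordSpan, Submodule.map_span, ← Set.image_comp, coordSpan, ← Set.image_comp]
  congr 1
  exact Set.image_congr fun i _ => permGL_apply b w i

theorem map_permGL_preimage {C : Type*} (b : Basis ι K V) (w : WInf ι) (σ : ι → C) (T : Set C) :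
    (coordSpan b (σ ⁻¹' T)).map ((permGL b w).1 : V →ₗ[K] V) = coordSpan b (wact w σ ⁻¹' T) := by
  rw [map_permGL]
  congr 1
  ext i
  constructor
  · rintro ⟨j, hj, rfl⟩
    simpa [wact] using hj
  · intro hi
    exact ⟨(w.1)⁻¹ i, hi, by simp⟩

variable {A : Type*} [LinearOrder A]

theorem map_permGL_upper (b : Basis ι K V) (w : WInf ι) (σ : ι → A) (α : A) :
    (upper b σ α).map ((permGL b w).1 : V →ₗ[K] V) = upper b (wact w σ) α :=
  map_permGL_preimage b w σ (Set.Iic α)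

theorem map_permGL_lower (b : Basis ι K V) (w : WInf ι) (σ : ι → A) (α : A) :
    (lower b σ α).map ((permGL b w).1 : V →ₗ[K] V) = lower b (wact w σ) α :=
  map_permGL_preimage b w σ (Set.Iio α)

theorem act_eq_of_forall_map_eq {b : Basis ι K V} {σ τ : ι → A} {g h : GLInf b}
    (hl : ∀ α, (lower b σ α).map (g.1 : V →ₗ[K] V) = (lower b τ α).map (h.1 : V →ₗ[K] V))
    (hu : ∀ α, (upper b σ α).map (g.1 : V →ₗ[K] V) = (upper b τ α).map (h.1 : V →ₗ[K] V)) :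
    act g.1 (flagOf b σ) = act h.1 (flagOf b τ) := by
  ext W
  constructor
  · rintro ⟨_, ⟨α, rfl | rfl⟩, rfl⟩
    · exact ⟨_, lower_mem b τ α, (hl α).symm⟩
    · exact ⟨_, upper_mem b τ α, (hu α).symm⟩
  · rintro ⟨_, ⟨α, rfl | rfl⟩, rfl⟩
    · exact ⟨_, lower_mem b σ α, hl α⟩
    · exact ⟨_, upper_mem b σ α, hu α⟩

theorem act_permGL (b : Basis ι K V) (w : WInf ι) (σ : ι → A) :
    act (permGL b w).1 (flagOf b σ) = flagOf b (wact w σ) := by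
  rw [← act_one (flagOf b (wact w σ))]
  refine act_eq_of_forall_map_eq (g := permGL b w) (h := 1) (fun α => ?_) fun α => ?_
  · exact (map_permGL_lower b w σ α).trans (Submodule.map_id _).symm
  · exact (map_permGL_upper b w σ α).trans (Submodule.map_id _).symm

theorem act_mul_permGL (b : Basis ι K V) (g : GLInf b) (w : WInf ι) (σ : ι → A) :
    act (g * permGL b w).1 (flagOf b σ) = act g.1 (flagOf b (wact w σ)) := by
  rw [← act_permGL]
  exact act_mul _ _ _

theorem cell_subset_Fl {b : Basis ι K V} {σ₀ : ι → A} (hσ₀ : Function.Surjective σ₀)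
    (B : Subgroup (GLInf b)) {σ : ι → A} (hσ : σ ∈ WOrbit σ₀) :
    cell b B σ ⊆ Fl b (flagOf b σ₀) := by
  rintro G ⟨h, _, rfl⟩
  obtain ⟨w, rfl⟩ := hσ
  simp only [← act_mul_permGL]
  exact act_mem_Fl b hσ₀ _

theorem permGL_mem_glPiece {b : Basis ι K V} {w : WInf ι} {I : Finset ι}
    (hw : ∀ i ∉ I, w.1 i = i) : permGL b w ∈ glPiece b I := by
  refine ⟨fun i hi => by rw [permGL_apply, hw i hi], fun i hi => ?_⟩
  rw [permGL_apply]
  refine basis_mem_coordSpan.2 ?_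
  by_contra h
  have := hw _ h
  rw [w.1.injective this] at h
  exact h hi

/-- On the finite set `I`, the condition `< α` is the condition `≤ β` for the largest value `β < α`
taken by either map. If there is none, both sides are empty. -/
theorem card_filter_lt_eq {I : Finset ι} {σ τ : ι → A}
    (h : ∀ α, (I.filter fun i => σ i ≤ α).card = (I.filter fun i => τ i ≤ α).card) (α : A) :
    (I.filter fun i => σ i < α).card = (I.filter fun i => τ i < α).card := by
  classical
  set S := (I.image σ ∪ I.image τ).filter (· < α) with hS
  by_cases hne : S.Nonempty
  · have key : ∀ ρ : ι → A, (∀ i ∈ I, ρ i < α → ρ i ∈ S) →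
        (I.filter fun i => ρ i < α) = I.filter fun i => ρ i ≤ S.max' hne := by
      intro ρ hρ
      refine Finset.filter_congr fun i hi => ⟨fun h => S.le_max' _ (hρ i hi h), fun h => ?_⟩
      exact h.trans_lt (Finset.mem_filter.1 (S.max'_mem hne)).2
    rw [key σ fun i hi h' => Finset.mem_filter.2 ⟨Finset.mem_union_left _
        (Finset.mem_image_of_mem σ hi), h'⟩, key τ fun i hi h' => Finset.mem_filter.2
        ⟨Finset.mem_union_right _ (Finset.mem_image_of_mem τ hi), h'⟩]
    exact h _
  · rw [Finset.not_nonempty_iff_eq_empty] at hne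
    rw [Finset.filter_false_of_mem, Finset.filter_false_of_mem]
    · intro i hi h'
      exact Finset.notMem_empty (τ i) (hne ▸ Finset.mem_filter.2 ⟨Finset.mem_union_right _
        (Finset.mem_image_of_mem τ hi), h'⟩)
    · intro i hi h'
      exact Finset.notMem_empty (σ i) (hne ▸ Finset.mem_filter.2 ⟨Finset.mem_union_left _
        (Finset.mem_image_of_mem σ hi), h'⟩)

/-- Two maps that agree off `I` and take each value equally often on `I` differ by a permutation
of `I`. -/
theorem exists_perm_of_card_eq {I : Finset ι} {σ σ₀ : ι → A} (hoff : ∀ i ∉ I, σ i = σ₀ i)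
    (h : ∀ α, (I.filter fun i => σ i ≤ α).card = (I.filter fun i => σ₀ i ≤ α).card) :
    ∃ w : WInf ι, (∀ i ∉ I, w.1 i = i) ∧ σ = wact w σ₀ := by
  classical
  have hfib : ∀ (ρ : ι → A) (α : A), Fintype.card {x : I // ρ x = α} +
      (I.filter fun i => ρ i < α).card = (I.filter fun i => ρ i ≤ α).card := by
    intro ρ α
    have h1 : Fintype.card {x : I // ρ x = α} = (I.filter fun i => ρ i = α).card := by
      rw [Fintype.card_subtype, ← Finset.card_map (Function.Embedding.subtype _)]
      congr 1
      ext i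
      simp only [Finset.mem_map, Finset.mem_filter, Finset.mem_univ, true_and,
        Function.Embedding.coe_subtype, Subtype.exists, exists_and_left, exists_prop]
      constructor
      · rintro ⟨j, hj, hjI, rfl⟩
        exact ⟨hjI, hj⟩
      · rintro ⟨hi, h⟩
        exact ⟨i, h, hi, rfl⟩
    rw [h1, ← Finset.card_union_of_disjoint]
    · congr 1
      ext i
      simp only [Finset.mem_union, Finset.mem_filter]
      rw [← and_or_left, le_iff_eq_or_lt]
    · rw [Finset.disjoint_filter]
      intro i _ h1 h2
      exact h2.ne h1
  have hcard : ∀ α, Fintype.card {x : I // σ x = α} = Fintype.card {x : I // σ₀ x = α} := by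
    intro α
    have h1 := hfib σ α
    have h2 := hfib σ₀ α
    rw [card_filter_lt_eq h, h] at h1
    omega
  -- Fibres of equal size are matched one by one. The resulting permutation satisfies `σ = σ₀ ∘ v`,
  -- and since `wact` composes with the inverse, the witness is `v⁻¹`.
  let e : I ≃ I := (Equiv.sigmaFiberEquiv fun x : I => σ x).symm.trans
    ((Equiv.sigmaCongrRight fun α => Fintype.equivOfCardEq (hcard α)).trans
      (Equiv.sigmaFiberEquiv fun x : I => σ₀ x))
  have he : ∀ x : I, σ₀ (e x) = σ x := fun x =>
    (Fintype.equivOfCardEq (hcard (σ x)) ⟨x, rfl⟩).2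
  let v : Equiv.Perm ι := Equiv.Perm.ofSubtype (p := fun i => i ∈ I) e
  have hv : ∀ i ∉ I, v i = i := fun i hi => Equiv.Perm.ofSubtype_apply_of_not_mem _ hi
  have hvinv : ∀ i ∉ I, v⁻¹ i = i := fun i hi => by
    rw [Equiv.Perm.inv_eq_iff_eq, hv i hi]
  refine ⟨⟨v⁻¹, I.finite_toSet.subset fun i hi => ?_⟩, hvinv, ?_⟩
  · by_contra h
    exact hi (hvinv i h)
  · funext i
    show σ i = σ₀ ((v⁻¹)⁻¹ i)
    rw [inv_inv]
    by_cases hi : i ∈ I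
    · rw [show v i = e ⟨i, hi⟩ from Equiv.Perm.ofSubtype_apply_of_mem (p := fun i => i ∈ I) e hi, he]
    · rw [hv i hi, hoff i hi]

end Perm

/-! ### Triangular representatives and relative position -/

section Bruhat

variable {K : Type*} [Field K] {V : Type*} [AddCommGroup V] [Module K V] {ι : Type*}
  [LinearOrder ι] {A : Type*} [LinearOrder A]

theorem map_eq_of_triangular {b : Basis ι K V} {g : GLInf b} (hg : ∀ i j, ent g i j ≠ 0 → i ≤ j)
    {T : Set ι} (hT : IsLowerSet T) :
    (coordSpan b T).map (g.1 : V →ₗ[K] V) = coordSpan b T := by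
  obtain ⟨I, hI⟩ := exists_finset_mem_glPiece g
  refine map_eq_of_le hI ?_
  rw [Submodule.map_span_le]
  rintro _ ⟨j, hj, rfl⟩
  exact mem_coordSpan.2 fun i hi => hT (hg i j hi) hj

/-- Preserving the flag as a set already means preserving each member, because a commensuration is
unique; hence no element can shift the members along the chain. -/
theorem mem_flagStabilizer_maxFlag {b : Basis ι K V} {g : GLInf b} :
    g ∈ flagStabilizer b (maxFlag b) ↔ ∀ i j, ent g i j ≠ 0 → i ≤ j := by
  constructor
  · intro hg i j hij
    have h1 : act g.1 (flagOf b (id : ι → ι)) = act (1 : GLInf b).1 (flagOf b (id : ι → ι)) :=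
      (show act g.1 (maxFlag b) = maxFlag b from hg).trans (act_one _).symm
    have h2 := map_eq_of_act_eq h1 (upper_mem b id j)
    have h3 : g.1 (b j) ∈ (upper b (id : ι → ι) j).map (g.1 : V →ₗ[K] V) :=
      ⟨b j, basis_mem_coordSpan.2 (le_refl j), rfl⟩
    rw [h2] at h3
    have h4 : g.1 (b j) ∈ upper b (id : ι → ι) j := by
      have : (upper b (id : ι → ι) j).map ((1 : GLInf b).1 : V →ₗ[K] V) = upper b id j :=
        Submodule.map_id _
      rwa [this] at h3
    exact mem_coordSpan.1 h4 i hij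
  · intro hg
    show act g.1 (flagOf b (id : ι → ι)) = flagOf b (id : ι → ι)
    conv_rhs => rw [← act_one (flagOf b (id : ι → ι))]
    refine act_eq_of_forall_map_eq (h := 1) (fun α => ?_) fun α => ?_
    · exact (map_eq_of_triangular hg (isLowerSet_Iio α)).trans (Submodule.map_id _).symm
    · exact (map_eq_of_triangular hg (isLowerSet_Iic α)).trans (Submodule.map_id _).symm

/-- The coordinates indexed by `J` are injective on `M`: the leading coordinate of a nonzero vector
is one of them. -/
theorem finrank_le_card_of_leading (b : Basis ι K V) (M : Submodule K V) (J : Finset ι)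
    (hJ : ∀ v ∈ M, ∀ e, b.repr v e ≠ 0 → (∀ k, b.repr v k ≠ 0 → k ≤ e) → e ∈ J) :
    finrank K M ≤ J.card := by
  classical
  let f : M →ₗ[K] (J → K) := LinearMap.pi fun e => (b.coord e).comp M.subtype
  have hf : Function.Injective f := by
    rw [← LinearMap.ker_eq_bot, LinearMap.ker_eq_bot']
    intro v hv
    by_contra hne
    have hsupp : (b.repr (v : V)).support.Nonempty := by
      rw [Finsupp.support_nonempty_iff]
      simpa using hne
    have hmax := Finset.max'_mem _ hsupp
    have hin := hJ v v.2 _ (by simpa using hmax)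
      fun k hk => Finset.le_max' _ k (Finsupp.mem_support_iff.2 hk)
    have h0 := congrFun hv ⟨_, hin⟩
    exact (Finsupp.mem_support_iff.1 hmax) h0
  have := LinearMap.finrank_le_finrank_of_injective hf
  simpa using this

/-- The Bruhat decomposition in `G(I)`. -/
theorem exists_triangular_act_eq {b : Basis ι K V} (σ₀ : ι → A) {I : Finset ι} {g : GLInf b}
    (hg : g ∈ glPiece b I) : ∃ w : WInf ι, (∀ i ∉ I, w.1 i = i) ∧ ∃ h ∈ glPiece b I,
      (∀ i j, ent h i j ≠ 0 → i ≤ j) ∧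
      act g.1 (flagOf b σ₀) = act h.1 (flagOf b (wact w σ₀)) := by
  classical
  let M : A → Submodule K V := fun α =>
    (coordSpan b (I.filter fun i => σ₀ i ≤ α : Finset ι)).map (g.1 : V →ₗ[K] V)
  have hMmono : ∀ {α β}, α ≤ β → M α ≤ M β := fun {α β} h => Submodule.map_mono
    (coordSpan_le_iff.2 (Finset.coe_subset.2 fun i hi => by
      simp only [Finset.mem_filter] at hi ⊢
      exact ⟨hi.1, hi.2.trans h⟩))
  have hMrank : ∀ α, finrank K (M α) = (I.filter fun i => σ₀ i ≤ α).card := fun α =>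
    (LinearEquiv.finrank_map_eq g.1 _).trans (finrank_coordSpan b _)
  have hMle : ∀ α, M α ≤ coordSpan b (I : Set ι) := fun α => by
    refine le_of_le_of_eq (Submodule.map_mono (coordSpan_le_iff.2 ?_)) (map_coordSpan_self hg)
    exact Finset.coe_subset.2 (Finset.filter_subset _ _)
  -- `jump e α` says that `M α` contains a vector with leading index `e`. The minimum defining `σ e`
  -- is taken over the finite set of values of `σ₀` on `I`, since `A` need not be well ordered.
  let jump : ι → A → Prop := fun e α => ∃ v ∈ M α, b.repr v e ≠ 0 ∧ ∀ k, b.repr v k ≠ 0 → k ≤ e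
  have hjump : ∀ e ∈ I, ((I.image σ₀).filter (jump e)).Nonempty := by
    intro e he
    obtain ⟨i, hi, hmax⟩ := Finset.exists_max_image I σ₀ ⟨e, he⟩
    refine ⟨σ₀ i, Finset.mem_filter.2 ⟨Finset.mem_image_of_mem _ hi, b e, ?_, by simp, ?_⟩⟩
    · have : (I.filter fun j => σ₀ j ≤ σ₀ i) = I := Finset.filter_true_of_mem hmax
      simp only [M]
      rw [this, map_coordSpan_self hg]
      exact basis_mem_coordSpan.2 he
    · intro k hk
      simp only [Basis.repr_self, Finsupp.single_apply] at hk
      by_contra h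
      exact hk (if_neg fun h' => h h'.ge)
  let σ : ι → A := fun e => if he : e ∈ I then ((I.image σ₀).filter (jump e)).min' (hjump e he)
    else σ₀ e
  have hσI : ∀ e (he : e ∈ I), σ e = ((I.image σ₀).filter (jump e)).min' (hjump e he) :=
    fun e he => dif_pos he
  have hσoff : ∀ e ∉ I, σ e = σ₀ e := fun e he => dif_neg he
  have hσjump : ∀ e ∈ I, jump e (σ e) := fun e he => by
    rw [hσI e he]
    exact (Finset.mem_filter.1 (Finset.min'_mem _ _)).2
  have hσle : ∀ e ∈ I, ∀ α, jump e α → σ e ≤ α := by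
    rintro e he α ⟨v, hv, hve, hvk⟩
    -- An arbitrary `α` is rounded down to the largest value of `σ₀` on `I` below it, which does not
    -- change `M α`; so `σ e` is minimal among all of `A`.
    have hne : (I.filter fun i => σ₀ i ≤ α).Nonempty := by
      by_contra h
      rw [Finset.not_nonempty_iff_eq_empty] at h
      have h0 := hMrank α
      rw [h, Finset.card_empty] at h0
      have : FiniteDimensional K (M α) := Submodule.finiteDimensional_of_le (hMle α)
      rw [Submodule.finrank_eq_zero.1 h0, Submodule.mem_bot] at hv
      simp [hv] at hve
    obtain ⟨i, hi, hmax⟩ := Finset.exists_max_image _ σ₀ hne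
    have hiI := (Finset.mem_filter.1 hi).1
    have hiα := (Finset.mem_filter.1 hi).2
    have hfil : (I.filter fun j => σ₀ j ≤ α) = I.filter fun j => σ₀ j ≤ σ₀ i := by
      ext j
      simp only [Finset.mem_filter]
      exact ⟨fun h => ⟨h.1, hmax j (Finset.mem_filter.2 h)⟩, fun h => ⟨h.1, h.2.trans hiα⟩⟩
    refine le_trans ?_ hiα
    rw [hσI e he]
    refine Finset.min'_le _ _ (Finset.mem_filter.2 ⟨Finset.mem_image_of_mem _ hiI, v, ?_, hve, hvk⟩)
    simpa only [M, hfil] using hv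
  choose! v hv hve hvk using hσjump
  have hli := linearIndependent_of_triangular b hve hvk
  obtain ⟨h, hh, hhv⟩ := exists_glPiece_of_linearIndependent b I (u := v)
    (fun i hi => hMle _ (hv i hi)) hli
  have hle : ∀ α, (coordSpan b (I.filter fun i => σ i ≤ α : Finset ι)).map (h.1 : V →ₗ[K] V) ≤
      M α := by
    intro α
    rw [Submodule.map_span_le]
    rintro _ ⟨i, hi, rfl⟩
    obtain ⟨hiI, hiα⟩ := Finset.mem_filter.1 (Finset.mem_coe.1 hi)
    have h1 := hMmono hiα (hv i hiI)
    rwa [← hhv i hiI] at h1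
  -- One inequality holds because `h` embeds the coordinate space of `σ` in `M α`, the other because
  -- the leading indices of `M α` all have `σ`-value at most `α`. Equality makes `σ` a permutation
  -- of `σ₀` and makes the inclusions `hle` equalities.
  have hcard : ∀ α, (I.filter fun i => σ i ≤ α).card = (I.filter fun i => σ₀ i ≤ α).card := by
    intro α
    have hfd : FiniteDimensional K (M α) := Submodule.finiteDimensional_of_le (hMle α)
    apply le_antisymm
    · have h1 := Submodule.finrank_mono (hle α)
      rw [hMrank] at h1
      refine le_trans (le_of_eq ?_) h1
      exact ((LinearEquiv.finrank_map_eq h.1 _).trans (finrank_coordSpan b _)).symm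
    · rw [← hMrank]
      refine finrank_le_card_of_leading b _ _ fun u hu e he hek => ?_
      have heI : e ∈ I := mem_coordSpan.1 (hMle α hu) e he
      exact Finset.mem_filter.2 ⟨heI, hσle e heI α ⟨u, hu, he, hek⟩⟩
  obtain ⟨w, hwI, hw⟩ := exists_perm_of_card_eq hσoff hcard
  refine ⟨w, hwI, h, hh, fun i j hij => ?_, ?_⟩
  · by_cases hj : j ∈ I
    · rw [ent, hhv j hj] at hij
      exact hvk j hj i hij
    · rw [ent_of_notMem_right hh hj] at hij
      by_contra hne
      exact hij (if_neg fun h => hne h.le)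
  · rw [← hw]
    have hoffset : ∀ p : A → Prop, {i | p (σ₀ i)} \ (I : Set ι) = {i | p (σ i)} \ (I : Set ι) := by
      intro p
      ext i
      simp only [Set.mem_sdiff, Set.mem_ofPred_eq, Finset.mem_coe]
      constructor
      · rintro ⟨h1, h2⟩
        exact ⟨by rwa [hσoff i h2], h2⟩
      · rintro ⟨h1, h2⟩
        exact ⟨by rwa [hσoff i h2] at h1, h2⟩
    have hfd : ∀ (k : GLInf b) (J : Finset ι), FiniteDimensional K
        ((coordSpan b (J : Set ι)).map (k.1 : V →ₗ[K] V)) := fun k J => inferInstance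
    refine act_eq_of_forall_map_eq (fun α => ?_) fun α => ?_
    · refine (map_coordSpan_eq_sup hg _).trans (Eq.trans ?_ (map_coordSpan_eq_sup hh _).symm)
      rw [hoffset (· < α), inter_coe_eq_filter, inter_coe_eq_filter]
      congr 1
      symm
      refine Submodule.eq_of_le_of_finrank_eq ?_ ?_
      · rw [Submodule.map_span_le]
        rintro _ ⟨i, hi, rfl⟩
        obtain ⟨hiI, hiα⟩ := Finset.mem_filter.1 (Finset.mem_coe.1 hi)
        have h1 := hv i hiI
        rw [← hhv i hiI] at h1
        refine Submodule.map_mono (coordSpan_le_iff.2 (Finset.coe_subset.2 fun j hj => ?_)) h1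
        simp only [Finset.mem_filter] at hj ⊢
        exact ⟨hj.1, hj.2.trans_lt hiα⟩
      · refine (LinearEquiv.finrank_map_eq h.1 _).trans (Eq.trans ?_
          (LinearEquiv.finrank_map_eq g.1 _).symm)
        rw [finrank_coordSpan, finrank_coordSpan]
        exact card_filter_lt_eq hcard α
    · refine (map_coordSpan_eq_sup hg _).trans (Eq.trans ?_ (map_coordSpan_eq_sup hh _).symm)
      rw [hoffset (· ≤ α), inter_coe_eq_filter, inter_coe_eq_filter]
      congr 1
      symm
      refine Submodule.eq_of_le_of_finrank_eq (hle α) ?_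
      refine (LinearEquiv.finrank_map_eq h.1 _).trans (Eq.trans ?_
          (LinearEquiv.finrank_map_eq g.1 _).symm)
      rw [finrank_coordSpan, finrank_coordSpan]
      exact hcard α

/-- The triangular `h` fixes each member of the reference flag, so it cancels from both
intersections. Between coordinate subspaces they differ exactly when `e` itself is present, that is
when `σ e ≤ α`. -/
theorem isRelPosition_of_triangular {b : Basis ι K V} {σ₀ : ι → A} {h : GLInf b}
    (hh : ∀ i j, ent h i j ≠ 0 → i ≤ j) {w : WInf ι} {G : Set (Submodule K V)}
    (hG : G = act h.1 (flagOf b (wact w σ₀))) {φ : flagOf b σ₀ ≃o G} (hφ : IsCommensuration φ) :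
    IsRelPosition b σ₀ φ (wact w σ₀) := by
  subst hG
  intro e
  have hφu : ∀ α, (φ ⟨upper b σ₀ α, upper_mem b σ₀ α⟩ : Submodule K V) =
      (upper b (wact w σ₀) α).map (h.1 : V →ₗ[K] V) := by
    intro α
    have hchain : IsChain (· ≤ ·) (act h.1 (flagOf b (wact w σ₀))) := by
      rw [act_flagOf]; exact isChain_flagOf _ _
    have hcomm : ∃ ψ : flagOf b σ₀ ≃o act h.1 (flagOf b (wact w σ₀)), IsCommensuration ψ ∧
        ∀ W, (ψ W : Submodule K V) = W.1.map ((h * permGL b w).1 : V →ₗ[K] V) := by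
      rw [← act_mul_permGL]
      exact ⟨actIso _ _, isCommensuration_actIso _ _, fun _ => rfl⟩
    obtain ⟨ψ, hψ, hψW⟩ := hcomm
    rw [commensuration_unique hchain hφ hψ, hψW, ← map_permGL_upper, ← Submodule.map_comp]
    rfl
  have key : {α : A | (φ ⟨upper b σ₀ α, upper_mem b σ₀ α⟩ : Submodule K V) ⊓
      upper b (id : ι → ι) e ≠ (φ ⟨upper b σ₀ α, upper_mem b σ₀ α⟩ : Submodule K V) ⊓
      lower b (id : ι → ι) e} = Set.Ici (wact w σ₀ e) := by
    ext α
    simp only [Set.mem_ofPred_eq, Set.mem_Ici, hφu]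
    have hu : (upper b (id : ι → ι) e).map (h.1 : V →ₗ[K] V) = upper b id e :=
      map_eq_of_triangular hh (isLowerSet_Iic e)
    have hl : (lower b (id : ι → ι) e).map (h.1 : V →ₗ[K] V) = lower b id e :=
      map_eq_of_triangular hh (isLowerSet_Iio e)
    conv_lhs => rw [← hu, ← hl]
    rw [← Submodule.map_inf _ h.1.injective, ← Submodule.map_inf _ h.1.injective,
      (Submodule.map_injective_of_injective h.1.injective).ne_iff]
    have e1 : upper b (wact w σ₀) α ⊓ upper b id e =
      coordSpan b ({i | wact w σ₀ i ≤ α} ∩ {i | i ≤ e}) := coordSpan_inf b _ _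
    have e2 : upper b (wact w σ₀) α ⊓ lower b id e =
      coordSpan b ({i | wact w σ₀ i ≤ α} ∩ {i | i < e}) := coordSpan_inf b _ _
    rw [e1, e2, (coordSpan_injective b).ne_iff]
    constructor
    · intro hne
      by_contra hlt
      refine hne (Set.ext fun i => ⟨fun hi => ⟨hi.1, lt_of_le_of_ne hi.2 ?_⟩,
        fun hi => ⟨hi.1, le_of_lt hi.2⟩⟩)
      rintro rfl
      exact hlt hi.1
    · intro hle heq
      have : e ∈ {i | wact w σ₀ i ≤ α} ∩ {i | i ≤ e} := ⟨hle, le_refl e⟩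
      rw [heq] at this
      exact lt_irrefl e this.2
  rw [key]
  exact isLeast_Ici

theorem exists_cell_of_mem_Fl {b : Basis ι K V} {E : ℕ → Finset ι} (hE : Monotone E)
    (hEι : ∀ i, ∃ n, i ∈ E n) {σ₀ : ι → A} {G : Set (Submodule K V)}
    (hG : G ∈ Fl b (flagOf b σ₀)) :
    ∃ w : WInf ι, G ∈ cell b (flagStabilizer b (maxFlag b)) (wact w σ₀) := by
  obtain ⟨n, hn⟩ := exists_mem_flPiece hE hEι ⟨G, hG⟩
  obtain ⟨g, hg, hgG⟩ := mem_flPiece_iff.1 hn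
  obtain ⟨w, _, h, _, hh, hact⟩ := exists_triangular_act_eq σ₀ hg
  exact ⟨w, h, mem_flagStabilizer_maxFlag.2 hh, hgG.trans hact⟩

theorem mem_cell_iff_isRelPosition {b : Basis ι K V} {E : ℕ → Finset ι} (hE : Monotone E)
    (hEι : ∀ i, ∃ n, i ∈ E n) {σ₀ : ι → A} {G : Set (Submodule K V)}
    (hG : G ∈ Fl b (flagOf b σ₀)) {φ : flagOf b σ₀ ≃o G} (hφ : IsCommensuration φ) {σ : ι → A}
    (hσ : σ ∈ WOrbit σ₀) :
    G ∈ cell b (flagStabilizer b (maxFlag b)) σ ↔ IsRelPosition b σ₀ φ σ := by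
  constructor
  · rintro ⟨h, hh, hGh⟩
    obtain ⟨w, rfl⟩ := hσ
    exact isRelPosition_of_triangular (mem_flagStabilizer_maxFlag.1 hh) hGh hφ
  · intro hrel
    obtain ⟨w, hw⟩ := exists_cell_of_mem_Fl hE hEι hG
    obtain ⟨h, hh, hGh⟩ := id hw
    have hrel' := isRelPosition_of_triangular (mem_flagStabilizer_maxFlag.1 hh) hGh hφ
    rwa [show σ = wact w σ₀ from funext fun e => (hrel e).unique (hrel' e)]

/-- The relative position of `G`, computed with one fixed commensuration, equals both maps. -/
theorem eq_of_mem_cell {b : Basis ι K V} {σ₀ : ι → A} (hσ₀ : Function.Surjective σ₀) {σ τ : ι → A}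
    (hσ : σ ∈ WOrbit σ₀) (hτ : τ ∈ WOrbit σ₀) {G : Set (Submodule K V)}
    (h1 : G ∈ cell b (flagStabilizer b (maxFlag b)) σ)
    (h2 : G ∈ cell b (flagStabilizer b (maxFlag b)) τ) : σ = τ := by
  obtain ⟨_, _, φ, hφ⟩ := cell_subset_Fl hσ₀ _ hσ h1
  obtain ⟨w, rfl⟩ := hσ
  obtain ⟨w', rfl⟩ := hτ
  obtain ⟨h, hh, hG⟩ := h1
  obtain ⟨h', hh', hG'⟩ := h2
  have r1 := isRelPosition_of_triangular (mem_flagStabilizer_maxFlag.1 hh) hG hφ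
  have r2 := isRelPosition_of_triangular (mem_flagStabilizer_maxFlag.1 hh') hG' hφ
  exact funext fun e => (r1 e).unique (r2 e)

end Bruhat

/-! ## The ind-variety structure in terms of the group -/

section Quot

variable {K X Y Z Y' Z' : Type*}

/-- A lift `r` of `π` through `j` turns the topology induced from the codomain of `π` into the plain
quotient topology along `r`. -/
theorem quot_isOpen_iff {S : FunSpace K X} {π : X → Z} {j : Y → Z} (hj : Function.Injective j)
    {r : X → Y} (hr : ∀ x, j (r x) = π x) {O : Set Y} :
    IsOpen[(S.quot π j).top] O ↔ IsOpen[S.top] (r ⁻¹' O) := by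
  have h1 : ∀ W : Set Z, π ⁻¹' W = r ⁻¹' (j ⁻¹' W) := fun W => by
    ext x
    simp [hr]
  constructor
  · rintro ⟨W, hW, rfl⟩
    rw [← h1]
    exact isOpen_coinduced.1 hW
  · intro hO
    refine ⟨j '' O, isOpen_coinduced.2 ?_, hj.preimage_image O⟩
    rwa [h1, hj.preimage_image]

theorem isOpen_indSpace_iff {S : IndSpace K X} {O : Set X} :
    IsOpen[S.top] O ↔ ∀ n, IsOpen[(S.str n).top] {x : S.piece n | x.1 ∈ O} := by
  rw [isOpen_iSup_iff]
  exact forall_congr' fun n => isOpen_coinduced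

theorem isClosed_indSpace_iff {S : IndSpace K X} {Z : Set X} :
    IsClosed[S.top] Z ↔ ∀ n, IsClosed[(S.str n).top] {x : S.piece n | x.1 ∈ Z} := by
  rw [← @isOpen_compl_iff _ _ S.top, isOpen_indSpace_iff]
  exact forall_congr' fun n => @isOpen_compl_iff _ {x : S.piece n | x.1 ∈ Z} (S.str n).top

variable [Field K] {s : Type*}

theorem quot_isReg_iff {c : X → s → K} {π : X → Z} {j : Y → Z} (hj : Function.Injective j)
    {r : X → Y} (hr : ∀ x, j (r x) = π x) {U : Set Y} {f : Y → K} :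
    ((zariski c).quot π j).IsReg U f ↔ (zariski c).IsReg (r ⁻¹' U) (f ∘ r) := by
  have h1 : π ⁻¹' (j '' U) = r ⁻¹' U := by
    ext x
    simp only [Set.mem_preimage, ← hr, hj.mem_set_image]
  constructor
  · rintro ⟨h, hreg, hh⟩
    rw [h1] at hreg
    exact zariski_isReg_congr hreg fun x hx => (hh x (r x) hx (hr x).symm).symm
  · intro hreg
    refine ⟨f ∘ r, by rwa [h1], fun x y _ hxy => ?_⟩
    rw [Function.comp, hj ((hr x).trans hxy)]

/-- Two quotients of the same space: any map compatible with the two projections is a morphism. It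
serves for the isomorphism in (a) and for its inverse. -/
theorem quot_isMor {c : X → s → K} {π : X → Z} {j : Y → Z} (hj : Function.Injective j)
    {r : X → Y} (hr : ∀ x, j (r x) = π x) {π' : X → Z'} {j' : Y' → Z'}
    (hj' : Function.Injective j') {r' : X → Y'} (hr' : ∀ x, j' (r' x) = π' x) {f : Y → Y'}
    (hf : ∀ x, f (r x) = r' x) : ((zariski c).quot π j).IsMor ((zariski c).quot π' j') f := by
  have hpre : ∀ U : Set Y', r ⁻¹' (f ⁻¹' U) = r' ⁻¹' U := fun U => by
    ext x
    simp [hf]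
  refine ⟨continuous_def.2 fun O hO => ?_, fun U h _ hh => ?_⟩
  · rw [quot_isOpen_iff hj hr, hpre]
    exact (quot_isOpen_iff hj' hr').1 hO
  · rw [quot_isReg_iff hj hr, hpre]
    have := (quot_isReg_iff hj' hr').1 hh
    rwa [show (h ∘ f) ∘ r = h ∘ r' from funext fun x => by simp [hf]]

end Quot

/-! ### `Fl(F, E)` as a homogeneous ind-variety -/

section FlInd

variable {K : Type*} [Field K] {V : Type*} [AddCommGroup V] [Module K V] {ι : Type*}
  {A : Type*} [LinearOrder A] {b : Basis ι K V} {σ₀ : ι → A}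

/-- The matrix entries as coordinates on `G(I)`. -/
noncomputable def entCoord (b : Basis ι K V) (I : Finset ι) : glPiece b I → ι × ι → K :=
  fun g p => ent g.1 p.1 p.2

/-- The orbit map `g ↦ gF`. -/
def orbMap (b : Basis ι K V) (hσ₀ : Function.Surjective σ₀) (g : GLInf b) :
    Fl b (flagOf b σ₀) := ⟨act g.1 (flagOf b σ₀), act_mem_Fl b hσ₀ g⟩

theorem orbMap_mem_flPiece (hσ₀ : Function.Surjective σ₀) {I : Finset ι} {g : GLInf b}
    (hg : g ∈ glPiece b I) : orbMap b hσ₀ g ∈ flPiece b σ₀ I := mem_flPiece_iff.2 ⟨g, hg, rfl⟩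

/-- The orbit map `G(I) → Fl(F, I)`. -/
def orbPiece (b : Basis ι K V) (hσ₀ : Function.Surjective σ₀) (I : Finset ι) (g : glPiece b I) :
    flPiece b σ₀ I := ⟨orbMap b hσ₀ g.1, orbMap_mem_flPiece hσ₀ g.2⟩

theorem orbPiece_surjective (hσ₀ : Function.Surjective σ₀) (I : Finset ι) :
    Function.Surjective (orbPiece b hσ₀ I) := by
  rintro ⟨G, hG⟩
  obtain ⟨g, hg, h⟩ := mem_flPiece_iff.1 hG
  exact ⟨⟨g, hg⟩, Subtype.ext (Subtype.ext h.symm)⟩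

theorem flInd_str_isOpen_iff (hσ₀ : Function.Surjective σ₀) {E : ℕ → Finset ι} {n : ℕ}
    {O : Set (flPiece b σ₀ (E n))} : IsOpen[((flInd b E σ₀).str n).top] O ↔
      IsOpen[((glInd b E).str n).top] (orbPiece b hσ₀ (E n) ⁻¹' O) :=
  quot_isOpen_iff (S := (glInd b E).str n) (π := fun g => act g.1.1 (flagOf b σ₀))
    (j := fun x : flPiece b σ₀ (E n) => x.1.1) (r := orbPiece b hσ₀ (E n))
    (Subtype.val_injective.comp Subtype.val_injective) fun _ => rfl

theorem flInd_str_isReg_iff (hσ₀ : Function.Surjective σ₀) {E : ℕ → Finset ι} {n : ℕ}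
    {U : Set (flPiece b σ₀ (E n))} {f : flPiece b σ₀ (E n) → K} :
    ((flInd b E σ₀).str n).IsReg U f ↔
      ((glInd b E).str n).IsReg (orbPiece b hσ₀ (E n) ⁻¹' U) (f ∘ orbPiece b hσ₀ (E n)) :=
  quot_isReg_iff (c := entCoord b (E n)) (π := fun g => act g.1.1 (flagOf b σ₀))
    (j := fun x : flPiece b σ₀ (E n) => x.1.1) (r := orbPiece b hσ₀ (E n))
    (Subtype.val_injective.comp Subtype.val_injective) fun _ => rfl

theorem isClosed_flInd_iff (hσ₀ : Function.Surjective σ₀) {E : ℕ → Finset ι}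
    {Z : Set (Fl b (flagOf b σ₀))} : IsClosed[(flInd b E σ₀).top] Z ↔
      ∀ n, IsClosed[((glInd b E).str n).top] {g : glPiece b (E n) | orbMap b hσ₀ g.1 ∈ Z} := by
  rw [isClosed_indSpace_iff]
  refine forall_congr' fun n => ?_
  refine (@isOpen_compl_iff _ {x : flPiece b σ₀ (E n) | x.1 ∈ Z}
    ((flInd b E σ₀).str n).top).symm.trans ((flInd_str_isOpen_iff hσ₀).trans ?_)
  exact @isOpen_compl_iff _ {g : glPiece b (E n) | orbMap b hσ₀ g.1 ∈ Z} ((glInd b E).str n).top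

/-- `G(E)/P_F → Fl(F, E)` is an isomorphism of ind-varieties. -/
theorem exists_quot_equiv_Fl (hσ₀ : Function.Surjective σ₀) {E : ℕ → Finset ι} (hE : Monotone E)
    (hEι : ∀ i, ∃ n, i ∈ E n) :
    ∃ Φ : (GLInf b ⧸ flagStabilizer b (flagOf b σ₀)) ≃ Fl b (flagOf b σ₀),
      (∀ g : GLInf b, (Φ g : Set (Submodule K V)) = act g.1 (flagOf b σ₀)) ∧
      (quotInd b E (flagStabilizer b (flagOf b σ₀))).IsIso (flInd b E σ₀) Φ := by
  have hrel : ∀ g h : GLInf b, (g : GLInf b ⧸ flagStabilizer b (flagOf b σ₀)) = h ↔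
      orbMap b hσ₀ g = orbMap b hσ₀ h := by
    intro g h
    rw [QuotientGroup.eq]
    have h1 : g⁻¹ * h ∈ flagStabilizer b (flagOf b σ₀) ↔
        act (g.1⁻¹ * h.1) (flagOf b σ₀) = flagOf b σ₀ := Iff.rfl
    rw [h1, act_mul, Subtype.ext_iff]
    show _ ↔ act g.1 (flagOf b σ₀) = act h.1 (flagOf b σ₀)
    constructor
    · intro H
      conv_lhs => rw [← H]
      rw [← act_mul, mul_inv_cancel, act_one]
    · intro H
      rw [← H, ← act_mul, inv_mul_cancel, act_one]
  let f : (GLInf b ⧸ flagStabilizer b (flagOf b σ₀)) → Fl b (flagOf b σ₀) :=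
    Quotient.lift (orbMap b hσ₀) fun g h H => (hrel g h).1 (Quotient.sound H)
  have hf : ∀ g : GLInf b, f g = orbMap b hσ₀ g := fun g => rfl
  have hbij : Function.Bijective f := by
    constructor
    · intro x y
      obtain ⟨g, rfl⟩ := QuotientGroup.mk_surjective x
      obtain ⟨h, rfl⟩ := QuotientGroup.mk_surjective y
      exact (hrel g h).2
    · intro G
      obtain ⟨n, hn⟩ := exists_mem_flPiece hE hEι G
      obtain ⟨g, _, hg⟩ := mem_flPiece_iff.1 hn
      exact ⟨g, Subtype.ext hg.symm⟩
  let Φ := Equiv.ofBijective f hbij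
  have hΦ : ∀ g : GLInf b, Φ g = orbMap b hσ₀ g := fun g => rfl
  have hΦs : ∀ g : GLInf b, Φ.symm (orbMap b hσ₀ g) = g := fun g => by
    rw [← hΦ, Equiv.symm_apply_apply]
  let P := flagStabilizer b (flagOf b σ₀)
  refine ⟨Φ, fun g => rfl, fun n => ⟨n, ?_, ?_⟩, fun n => ⟨n, ?_, ?_⟩⟩
  · rintro _ ⟨g, hg, rfl⟩
    exact orbMap_mem_flPiece hσ₀ hg
  · exact quot_isMor Subtype.val_injective
      (r := fun g : glPiece b (E n) => (⟨(g.1 : GLInf b ⧸ P), g.1, g.2, rfl⟩ :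
        (quotInd b E P).piece n)) (fun _ => rfl)
      (Subtype.val_injective.comp Subtype.val_injective) (r' := orbPiece b hσ₀ (E n))
      (fun _ => rfl) fun g => rfl
  · intro G hG
    obtain ⟨g, hg, h⟩ := mem_flPiece_iff.1 hG
    refine ⟨g, hg, ?_⟩
    rw [show G = orbMap b hσ₀ g from Subtype.ext h]
    exact (hΦs g).symm
  · exact quot_isMor (Subtype.val_injective.comp Subtype.val_injective)
      (r := orbPiece b hσ₀ (E n)) (fun _ => rfl) Subtype.val_injective
      (r' := fun g : glPiece b (E n) => (⟨(g.1 : GLInf b ⧸ P), g.1, g.2, rfl⟩ :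
        (quotInd b E P).piece n)) (fun _ => rfl)
      fun g => Subtype.ext (hΦs g.1)

theorem exists_quot_equiv_WOrbit {ι A : Type*} (σ₀ : ι → A) :
    ∃ Ψ : (WInf ι ⧸ WPar σ₀) ≃ WOrbit σ₀, ∀ w : WInf ι, (Ψ w : ι → A) = wact w σ₀ := by
  have hmul : ∀ w w' : WInf ι, wact (w * w') σ₀ = wact w (wact w' σ₀) := by
    intro w w'
    funext i
    simp [wact]
  have hrel : ∀ w w' : WInf ι, (w : WInf ι ⧸ WPar σ₀) = w' ↔ wact w σ₀ = wact w' σ₀ := by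
    intro w w'
    rw [QuotientGroup.eq]
    have h1 : w⁻¹ * w' ∈ WPar σ₀ ↔ wact (w⁻¹ * w') σ₀ = σ₀ := Iff.rfl
    rw [h1]
    constructor
    · intro H
      conv_lhs => rw [← H]
      rw [← hmul, mul_inv_cancel_left]
    · intro H
      rw [hmul, ← H, ← hmul, inv_mul_cancel]
      rfl
  let f : (WInf ι ⧸ WPar σ₀) → WOrbit σ₀ :=
    Quotient.lift (fun w => (⟨wact w σ₀, w, rfl⟩ : WOrbit σ₀))
      fun w w' H => Subtype.ext ((hrel w w').1 (Quotient.sound H))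
  have hbij : Function.Bijective f := by
    constructor
    · intro x y
      obtain ⟨g, rfl⟩ := QuotientGroup.mk_surjective x
      obtain ⟨h, rfl⟩ := QuotientGroup.mk_surjective y
      exact fun H => (hrel g h).2 (congrArg Subtype.val H)
    · rintro ⟨_, w, rfl⟩
      exact ⟨w, rfl⟩
  exact ⟨Equiv.ofBijective f hbij, fun w => rfl⟩

end FlInd

/-! ## The Bruhat order and prefix counts -/

section BruhatOrder

variable {ι A : Type*} [LinearOrder ι] [LinearOrder A]

/-- The number of `i ∈ I` with `i ≤ k` and `σ i ≤ α`. -/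
def prefixCount (I : Finset ι) (σ : ι → A) (k : ι) (α : A) : ℕ :=
  (I.filter fun i => i ≤ k ∧ σ i ≤ α).card

theorem swap_mem {I : Finset ι} {e j : ι} (he : e ∈ I) (hj : j ∈ I) {i : ι} (hi : i ∈ I) :
    Equiv.swap e j i ∈ I := by
  rw [Equiv.swap_apply_def]
  split_ifs <;> assumption

theorem swap_le {e j k : ι} (he : e ≤ k) (hj : j ≤ k) {i : ι} (hi : i ≤ k) :
    Equiv.swap e j i ≤ k := by
  rw [Equiv.swap_apply_def]
  split_ifs <;> assumption

theorem prefixCount_comp_swap_of_le {I : Finset ι} {e j k : ι} (he : e ∈ I) (hj : j ∈ I)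
    (hek : e ≤ k) (hjk : j ≤ k) (σ : ι → A) (α : A) :
    prefixCount I σ k α ≤ prefixCount I (σ ∘ Equiv.swap e j) k α := by
  refine Finset.card_le_card_of_injOn (Equiv.swap e j) (fun i hi => ?_)
    (Equiv.injective _).injOn
  simp only [Finset.coe_filter, Set.mem_ofPred_eq, Function.comp, Equiv.swap_apply_self] at hi ⊢
  exact ⟨swap_mem he hj hi.1, swap_le hek hjk hi.2.1, hi.2.2⟩

/-- A prefix ending outside `[e, j)` contains both `e` and `j` or neither, so exchanging their
values does not affect the count. -/
theorem prefixCount_comp_swap_eq {I : Finset ι} {e j : ι} (he : e ∈ I) (hj : j ∈ I) (hej : e < j)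
    {k : ι} (hk : ¬ (e ≤ k ∧ k < j)) (σ : ι → A) (α : A) :
    prefixCount I (σ ∘ Equiv.swap e j) k α = prefixCount I σ k α := by
  by_cases hek : e ≤ k
  · have hjk : j ≤ k := by
      by_contra h
      exact hk ⟨hek, not_le.1 h⟩
    refine le_antisymm ?_ (prefixCount_comp_swap_of_le he hj hek hjk σ α)
    have := prefixCount_comp_swap_of_le he hj hek hjk (σ ∘ Equiv.swap e j) α
    rwa [Function.comp_assoc, ← Equiv.Perm.coe_mul, Equiv.swap_mul_self, Equiv.Perm.coe_one,
      Function.comp_id] at this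
  · unfold prefixCount
    congr 1
    refine Finset.filter_congr fun i _ => and_congr_right fun hik => ?_
    have hie : i ≠ e := fun h => hek (h ▸ hik)
    have hij : i ≠ j := fun h => hek (hej.le.trans (h ▸ hik))
    rw [Function.comp, Equiv.swap_apply_of_ne_of_ne hie hij]

/-- Only prefixes containing `e` but not `j` change, and there the value at `e` is replaced by a
larger one. -/
theorem prefixCount_step {I : Finset ι} {e j : ι} (he : e ∈ I) (hj : j ∈ I) (hej : e < j)
    {σ : ι → A} (hσ : σ e < σ j) (k : ι) (α : A) :
    prefixCount I (σ ∘ Equiv.swap e j) k α ≤ prefixCount I σ k α := by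
  by_cases hk : e ≤ k ∧ k < j
  · refine Finset.card_le_card fun i hi => ?_
    simp only [Finset.mem_filter, Function.comp] at hi ⊢
    refine ⟨hi.1, hi.2.1, ?_⟩
    have hij : i ≠ j := fun h => (h ▸ hi.2.1).not_gt hk.2
    by_cases hie : i = e
    · subst hie
      have := hi.2.2
      rw [Equiv.swap_apply_left] at this
      exact hσ.le.trans this
    · have := hi.2.2
      rwa [Equiv.swap_apply_of_ne_of_ne hie hij] at this
  · exact (prefixCount_comp_swap_eq he hj hej hk σ α).le

theorem prefixCount_step_lt {I : Finset ι} {e j : ι} (he : e ∈ I) (hej : e < j) {σ : ι → A}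
    (hσ : σ e < σ j) :
    prefixCount I (σ ∘ Equiv.swap e j) e (σ e) < prefixCount I σ e (σ e) := by
  refine Finset.card_lt_card ?_
  refine (Finset.ssubset_iff_of_subset fun i hi => ?_).2 ⟨e, by simp [he], by simp [hσ]⟩
  simp only [Finset.mem_filter, Function.comp] at hi ⊢
  refine ⟨hi.1, hi.2.1, ?_⟩
  by_cases hie : i = e
  · rw [hie]
  · have := hi.2.2
    rwa [Equiv.swap_apply_of_ne_of_ne hie fun h => (h ▸ hi.2.1).not_gt hej] at this

theorem prefixCount_add_sdiff {I J : Finset ι} (hIJ : I ⊆ J) (σ : ι → A) (k : ι) (α : A) :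
    prefixCount I σ k α + prefixCount (J \ I) σ k α = prefixCount J σ k α := by
  unfold prefixCount
  rw [← Finset.card_union_of_disjoint, ← Finset.filter_union, Finset.union_sdiff_of_subset hIJ]
  exact Finset.disjoint_filter_filter Finset.disjoint_sdiff

/-- The chain from `σ` to `τ` may exchange elements outside `I`. The comparison is made on a set
containing all of them and then restricted to `I`, because `σ` and `τ` contribute equally off `I`.
-/
theorem prefixCount_le_of_bruhatLE {I : Finset ι} {σ τ : ι → A} (hoff : ∀ i ∉ I, σ i = τ i)
    (h : BruhatLE σ τ) (k : ι) (α : A) : prefixCount I τ k α ≤ prefixCount I σ k α := by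
  have key : ∃ J : Finset ι, ∀ J', J ⊆ J' → prefixCount J' τ k α ≤ prefixCount J' σ k α := by
    clear hoff
    induction h with
    | refl => exact ⟨∅, fun _ _ => le_rfl⟩
    | tail _ hstep ih =>
      obtain ⟨J, hJ⟩ := ih
      obtain ⟨e, j, hej, hσ, rfl⟩ := hstep
      refine ⟨insert e (insert j J), fun J' hJ' => ?_⟩
      have he : e ∈ J' := hJ' (by simp)
      have hj : j ∈ J' := hJ' (by simp)
      exact (prefixCount_step he hj hej hσ k α).trans
        (hJ J' fun i hi => hJ' (by simp [hi]))
  obtain ⟨J, hJ⟩ := key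
  have h1 := hJ (J ∪ I) Finset.subset_union_left
  rw [← prefixCount_add_sdiff (Finset.subset_union_right : I ⊆ J ∪ I) σ,
    ← prefixCount_add_sdiff (Finset.subset_union_right : I ⊆ J ∪ I) τ] at h1
  have h2 : prefixCount ((J ∪ I) \ I) σ k α = prefixCount ((J ∪ I) \ I) τ k α := by
    unfold prefixCount
    congr 1
    refine Finset.filter_congr fun i hi => ?_
    rw [hoff i (Finset.mem_sdiff.1 hi).2]
  omega

theorem card_filter_Ioc (I : Finset ι) (p : ι → Prop) [DecidablePred p] (σ : ι → A) {α β : A}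
    (h : α ≤ β) : (I.filter fun i => p i ∧ α < σ i ∧ σ i ≤ β).card +
      (I.filter fun i => p i ∧ σ i ≤ α).card = (I.filter fun i => p i ∧ σ i ≤ β).card := by
  rw [← Finset.card_union_of_disjoint]
  · congr 1
    ext i
    simp only [Finset.mem_union, Finset.mem_filter]
    constructor
    · rintro (⟨h1, h2, _, h3⟩ | ⟨h1, h2, h3⟩)
      · exact ⟨h1, h2, h3⟩
      · exact ⟨h1, h2, h3.trans h⟩
    · rintro ⟨h1, h2, h3⟩
      by_cases h4 : σ i ≤ α
      · exact Or.inr ⟨h1, h2, h4⟩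
      · exact Or.inl ⟨h1, h2, not_le.1 h4, h3⟩
  · rw [Finset.disjoint_filter]
    rintro i _ ⟨_, h1, _⟩ ⟨_, h2⟩
    exact h1.not_ge h2

theorem card_filter_comp_swap {I : Finset ι} {e j : ι} (he : e ∈ I) (hj : j ∈ I) (σ : ι → A)
    (α : A) : (I.filter fun i => (σ ∘ Equiv.swap e j) i ≤ α).card =
      (I.filter fun i => σ i ≤ α).card := by
  refine Finset.card_bij (fun i _ => Equiv.swap e j i) (fun i hi => ?_)
    (fun _ _ _ _ h => (Equiv.injective _) h) fun i hi => ⟨Equiv.swap e j i, ?_, by simp⟩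
  · simp only [Finset.mem_filter, Function.comp] at hi ⊢
    exact ⟨swap_mem he hj hi.1, hi.2⟩
  · simp only [Finset.mem_filter, Function.comp, Equiv.swap_apply_self] at hi ⊢
    exact ⟨swap_mem he hj hi.1, hi.2⟩

/-- If `σ ≠ τ` and the prefix counts of `σ` dominate those of `τ`, then there is a step up from
`σ` that keeps this property. -/
theorem exists_step_of_prefixCount_le {I : Finset ι} {σ τ : ι → A} (hoff : ∀ i ∉ I, σ i = τ i)
    (hcard : ∀ α, (I.filter fun i => σ i ≤ α).card = (I.filter fun i => τ i ≤ α).card)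
    (hle : ∀ k α, prefixCount I τ k α ≤ prefixCount I σ k α) (hne : σ ≠ τ) :
    ∃ e ∈ I, ∃ j ∈ I, e < j ∧ σ e < σ j ∧
      ∀ k α, prefixCount I τ k α ≤ prefixCount I (σ ∘ Equiv.swap e j) k α := by
  have hD : (I.filter fun i => σ i ≠ τ i).Nonempty := by
    by_contra h
    refine hne (funext fun i => ?_)
    by_cases hi : i ∈ I
    · by_contra hi'
      exact h ⟨i, Finset.mem_filter.2 ⟨hi, hi'⟩⟩
    · exact hoff i hi
  -- `e` is the first place where `σ` and `τ` differ. There `σ e < τ e`, for otherwise `τ` would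
  -- have the larger prefix count at `(e, τ e)`.
  obtain ⟨heI, heτ⟩ := Finset.mem_filter.1 (Finset.min'_mem _ hD)
  set e := Finset.min' _ hD with he_def
  have hlt : ∀ i ∈ I, i < e → σ i = τ i := by
    intro i hi hie
    by_contra h
    exact hie.not_ge (Finset.min'_le _ _ (Finset.mem_filter.2 ⟨hi, h⟩))
  have he : σ e < τ e := by
    by_contra h
    have hτe : τ e < σ e := lt_of_le_of_ne (not_lt.1 h) (Ne.symm heτ)
    refine (hle e (τ e)).not_gt (Finset.card_lt_card ?_)
    refine (Finset.ssubset_iff_of_subset fun i hi => ?_).2 ⟨e, by simp [heI], by simp [hτe]⟩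
    simp only [Finset.mem_filter] at hi ⊢
    refine ⟨hi.1, hi.2.1, ?_⟩
    rcases hi.2.1.lt_or_eq with h' | h'
    · rw [← hlt i hi.1 h']
      exact hi.2.2
    · rw [h']
  -- Otherwise `σ` would take values in `(σ e, τ e]` strictly less often on `I` than `τ`, which
  -- takes such a value at `e`; but `hcard` makes these totals equal.
  have hJ : (I.filter fun j => e < j ∧ σ e < σ j ∧ σ j ≤ τ e).Nonempty := by
    by_contra h
    have h1 := card_filter_Ioc I (fun _ => True) σ he.le
    have h2 := card_filter_Ioc I (fun _ => True) τ he.le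
    simp only [true_and] at h1 h2
    rw [hcard, hcard] at h1
    have h3 : (I.filter fun i => σ e < σ i ∧ σ i ≤ τ e).card <
        (I.filter fun i => σ e < τ i ∧ τ i ≤ τ e).card := by
      refine Finset.card_lt_card ((Finset.ssubset_iff_of_subset fun i hi => ?_).2
        ⟨e, by simp [heI, he], by simp⟩)
      simp only [Finset.mem_filter] at hi ⊢
      rcases lt_trichotomy i e with h' | h' | h'
      · rw [← hlt i hi.1 h']
        exact hi
      · rw [h'] at hi
        exact absurd hi.2.1 (lt_irrefl _)
      · exact absurd ⟨i, Finset.mem_filter.2 ⟨hi.1, h', hi.2⟩⟩ h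
    omega
  -- `j` is the first such index after `e`, so between `e` and `j` the map `σ` has no values in `(σ
  -- e, τ e]`.
  obtain ⟨hjI, hej, hσj, hjτ⟩ := Finset.mem_filter.1 (Finset.min'_mem _ hJ)
  set j := Finset.min' _ hJ with hj_def
  have hbetween : ∀ i ∈ I, e < i → i < j → σ e < σ i → σ i ≤ τ e → False := by
    intro i hi h1 h2 h3 h4
    exact h2.not_ge (Finset.min'_le _ _ (Finset.mem_filter.2 ⟨hi, h1, h3, h4⟩))
  refine ⟨e, heI, j, hjI, hej, hσj, fun k α => ?_⟩
  by_cases hk : e ≤ k ∧ k < j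
  swap
  · rw [prefixCount_comp_swap_eq heI hjI hej hk]
    exact hle k α
  have hsame : ∀ i, i ≤ k → i ≠ e → (σ ∘ Equiv.swap e j) i = σ i := by
    intro i hik hie
    rw [Function.comp, Equiv.swap_apply_of_ne_of_ne hie fun h => (h ▸ hik).not_gt hk.2]
  -- Only for these `α` does the exchange lower the count, by at most one, and there is room: in the
  -- prefix, `τ` has strictly more values in `(α, τ e]` than `σ`, while its count at `τ e` is no
  -- larger. So its count at `α` is strictly smaller than that of `σ`.
  by_cases hα : σ e ≤ α ∧ α < σ j
  · have h1 : prefixCount I σ k α ≤ prefixCount I (σ ∘ Equiv.swap e j) k α + 1 := by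
      refine le_trans (Finset.card_le_card fun i hi => ?_) (Finset.card_insert_le e _)
      simp only [Finset.mem_filter, Finset.mem_insert] at hi ⊢
      by_cases hie : i = e
      · exact Or.inl hie
      · exact Or.inr ⟨hi.1, hi.2.1, by rw [hsame i hi.2.1 hie]; exact hi.2.2⟩
    have hατ : α ≤ τ e := hα.2.le.trans hjτ
    have h2 := card_filter_Ioc I (fun i => i ≤ k) σ hατ
    have h3 := card_filter_Ioc I (fun i => i ≤ k) τ hατ
    have h4 : (I.filter fun i => i ≤ k ∧ α < σ i ∧ σ i ≤ τ e).card <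
        (I.filter fun i => i ≤ k ∧ α < τ i ∧ τ i ≤ τ e).card := by
      refine Finset.card_lt_card ((Finset.ssubset_iff_of_subset fun i hi => ?_).2
        ⟨e, by simp [heI, hk.1, hα.2.trans_le hjτ], by simp [hα.1]⟩)
      simp only [Finset.mem_filter] at hi ⊢
      rcases lt_trichotomy i e with h' | h' | h'
      · rw [← hlt i hi.1 h']
        exact hi
      · rw [h'] at hi
        exact absurd hi.2.2.1 (not_lt.2 hα.1)
      · exact (hbetween i hi.1 h' (hi.2.1.trans_lt hk.2) (hα.1.trans_lt hi.2.2.1)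
          hi.2.2.2).elim
    have h5 := hle k (τ e)
    unfold prefixCount at *
    omega
  · refine (hle k α).trans (Finset.card_le_card fun i hi => ?_)
    simp only [Finset.mem_filter] at hi ⊢
    refine ⟨hi.1, hi.2.1, ?_⟩
    by_cases hie : i = e
    · rw [hie, Function.comp, Equiv.swap_apply_left]
      by_contra h
      exact hα ⟨hie ▸ hi.2.2, not_le.1 h⟩
    · rw [hsame i hi.2.1 hie]
      exact hi.2.2

theorem bruhatLE_of_prefixCount_le {I : Finset ι} {σ τ : ι → A} (hoff : ∀ i ∉ I, σ i = τ i)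
    (hcard : ∀ α, (I.filter fun i => σ i ≤ α).card = (I.filter fun i => τ i ≤ α).card)
    (hle : ∀ k α, prefixCount I τ k α ≤ prefixCount I σ k α) : BruhatLE σ τ := by
  classical
  have hS : ∀ i ∈ I, σ i ∈ I.image σ := fun i hi => Finset.mem_image_of_mem σ hi
  -- The value set is frozen, since exchanges within `I` keep the values in `S`. The sum of the
  -- prefix counts over `I` and `S` then drops with every step, strictly at `(e, σ e)`, and serves
  -- as induction measure.
  generalize I.image σ = S at hS
  induction hm : ∑ k ∈ I, ∑ α ∈ S, prefixCount I σ k α using Nat.strong_induction_on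
    generalizing σ with
  | h m ih =>
    by_cases hne : σ = τ
    · rw [hne]
      exact Relation.ReflTransGen.refl
    obtain ⟨e, he, j, hj, hej, hσ, hle'⟩ := exists_step_of_prefixCount_le hoff hcard hle hne
    refine Relation.ReflTransGen.head ⟨e, j, hej, hσ, rfl⟩
      (ih _ ?_ ?_ (fun α => ?_) hle' (fun i hi => ?_) rfl)
    · rw [← hm]
      refine Finset.sum_lt_sum (fun k _ => Finset.sum_le_sum fun α _ =>
        prefixCount_step he hj hej hσ k α) ⟨e, he, Finset.sum_lt_sum (fun α _ =>
        prefixCount_step he hj hej hσ e α) ⟨σ e, hS e he, prefixCount_step_lt he hej hσ⟩⟩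
    · intro i hi
      rw [Function.comp, Equiv.swap_apply_of_ne_of_ne (fun h : i = e => hi (h ▸ he))
        (fun h : i = j => hi (h ▸ hj))]
      exact hoff i hi
    · rw [card_filter_comp_swap he hj]
      exact hcard α
    · exact hS _ (swap_mem he hj hi)

/-- The two relations make all prefix counts equal. If the maps differed, a further step up from `σ`
would still dominate `τ` although it strictly lowers one count. -/
theorem bruhatLE_antisymm {I : Finset ι} {σ τ : ι → A} (hoff : ∀ i ∉ I, σ i = τ i)
    (hcard : ∀ α, (I.filter fun i => σ i ≤ α).card = (I.filter fun i => τ i ≤ α).card)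
    (h1 : BruhatLE σ τ) (h2 : BruhatLE τ σ) : σ = τ := by
  by_contra hne
  have hle := prefixCount_le_of_bruhatLE hoff h1
  have hge := prefixCount_le_of_bruhatLE (fun i hi => (hoff i hi).symm) h2
  obtain ⟨e, he, j, hj, hej, hσ, h⟩ := exists_step_of_prefixCount_le hoff hcard hle hne
  exact absurd ((hge e (σ e)).trans (h e (σ e))) (prefixCount_step_lt he hej hσ).not_ge

end BruhatOrder

/-! ## Semicontinuity of the rank -/

section Rank

variable {K : Type*} [Field K]

/-- First pick independent rows spanning the row space, then independent columns of what is left;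
both selections have as many members as the rank. -/
theorem exists_submatrix_det_ne_zero {m n : Type*} [Fintype m] [Fintype n] (M : Matrix m n K) :
    ∃ (k : ℕ) (f : Fin k → m) (g : Fin k → n), k = M.rank ∧ (M.submatrix f g).det ≠ 0 := by
  classical
  obtain ⟨κ, a, ha, hspan, hli⟩ := exists_linearIndependent' K M.row
  have : Finite κ := Finite.of_injective a ha
  have := Fintype.ofFinite κ
  let N : Matrix κ n K := M.submatrix a id
  have hN : LinearIndependent K N.row := hli
  have hNr : N.rank = M.rank := by
    rw [Matrix.rank_eq_finrank_span_row, Matrix.rank_eq_finrank_span_row]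
    exact congrArg (fun W : Submodule K (n → K) => finrank K W) hspan
  obtain ⟨κ', a', ha', hspan', hli'⟩ := exists_linearIndependent' K N.col
  have : Finite κ' := Finite.of_injective a' ha'
  have := Fintype.ofFinite κ'
  have hcard' : Fintype.card κ' = M.rank := by
    rw [← hNr, Matrix.rank_eq_finrank_span_cols, ← hspan', finrank_span_eq_card hli']
  have hcard : Fintype.card κ = M.rank := by rw [← hNr, hN.rank_matrix]
  let e : Fin M.rank ≃ κ := (Fintype.equivFinOfCardEq hcard).symm
  let e' : Fin M.rank ≃ κ' := (Fintype.equivFinOfCardEq hcard').symm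
  refine ⟨M.rank, a ∘ e, a' ∘ e', rfl, ?_⟩
  have h1 : LinearIndependent K (N.submatrix id (a' ∘ e')).col := hli'.comp _ e'.injective
  have h2 : LinearIndependent K (M.submatrix (a ∘ e) (a' ∘ e')).col := by
    have h3 := h1.map' (LinearEquiv.funCongrLeft K K e).toLinearMap (LinearEquiv.ker _)
    exact h3
  exact (Matrix.isUnit_iff_isUnit_det _).1 (Matrix.linearIndependent_cols_iff_isUnit.1 h2)
    |>.ne_zero

/-- A nonvanishing minor of maximal size stays nonzero on an open set, so the rank cannot drop
there. -/
theorem isClosed_rank_le {X s : Type*} {c : X → s → K} {m n : Type*} [Fintype m] [Fintype n]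
    {M : X → Matrix m n K} (hM : ∀ i j, (fun x => M x i j) ∈ polyFun c) (r : ℕ) :
    IsClosed[(zariski c).top] {x | (M x).rank ≤ r} := by
  let _ := (zariski c).top
  refine ⟨isOpen_iff_forall_mem_open.2 fun x hx => ?_⟩
  obtain ⟨k, f, g, hk, hdet⟩ := exists_submatrix_det_ne_zero (M x)
  refine ⟨{y | ((M y).submatrix f g).det ≠ 0}, fun y hy => ?_,
    isOpen_ne_zariski (det_mem_polyFun fun i j => hM (f i) (g j)), hdet⟩
  have h1 := Matrix.rank_of_det_ne_zero hy
  have h2 := Matrix.rank_submatrix_le (M y) f g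
  rw [h1, Fintype.card_fin, hk] at h2
  simp only [Set.mem_compl_iff, Set.mem_ofPred_eq, not_le] at hx ⊢
  omega

end Rank

/-! ### Schubert sets, closures of cells and local closedness -/

section Schubert

variable {K : Type*} [Field K] {V : Type*} [AddCommGroup V] [Module K V] {ι : Type*}

/-- Rank–nullity for the rows `R` and columns `J` of `g`: its kernel corresponds to the vectors of
`g⟨J⟩` whose coordinates in `R ∩ I` vanish. Rows outside `I` are zero on `J ⊆ I` and impose nothing.
-/
theorem finrank_map_inf_add_rank {b : Basis ι K V} {I J : Finset ι} (hJ : J ⊆ I) {g : GLInf b}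
    (hg : g ∈ glPiece b I) (R : Finset ι) :
    finrank K ((coordSpan b (J : Set ι)).map (g.1 : V →ₗ[K] V) ⊓ coordSpan b {i | i ∉ R ∨ i ∉ I} :
      Submodule K V) + (Matrix.of fun (i : (R : Finset ι)) (j : J) => ent g i j).rank = J.card := by
  classical
  set M : Matrix R J K := Matrix.of fun (i : (R : Finset ι)) (j : J) => ent g i j with hM
  let T : (J → K) →ₗ[K] V :=
    (g.1 : V →ₗ[K] V).comp (Fintype.linearCombination K fun j : J => b j)
  have hli : LinearIndependent K fun j : J => b j :=
    b.linearIndependent.comp _ Subtype.val_injective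
  have hT : Function.Injective T := g.1.injective.comp
    (linearIndependent_iff_injective_fintypeLinearCombination.1 hli)
  have hrange : LinearMap.range T = (coordSpan b (J : Set ι)).map (g.1 : V →ₗ[K] V) := by
    rw [LinearMap.range_comp, Fintype.range_linearCombination]
    congr 2
    ext v
    simp
  have hrepr : ∀ x i, b.repr (T x) i = ∑ j : J, ent g i j * x j := by
    intro x i
    simp [T, Fintype.linearCombination_apply, ent, mul_comm]
  have hker : LinearMap.ker M.mulVecLin = (coordSpan b {i | i ∉ R ∨ i ∉ I}).comap T := by
    ext x
    rw [LinearMap.mem_ker, Submodule.mem_comap, mem_coordSpan]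
    constructor
    · intro hx i hi
      by_contra hc
      simp only [Set.mem_ofPred_eq, not_or, not_not] at hc
      have := congrFun hx ⟨i, hc.1⟩
      rw [Matrix.mulVecLin_apply, Matrix.mulVec, dotProduct] at this
      exact hi ((hrepr x i).trans this)
    · intro hx
      funext i
      rw [Matrix.mulVecLin_apply, Matrix.mulVec, dotProduct]
      show ∑ j : J, ent g i j * x j = 0
      rw [← hrepr]
      by_contra hne
      rcases hx i hne with h | h
      · exact h i.2
      · rw [hrepr] at hne
        refine hne (Finset.sum_eq_zero fun j _ => ?_)
        rw [ent_of_notMem_left hg h, if_neg fun hij => h (by rw [hij]; exact hJ j.2), zero_mul]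
  have h1 : (coordSpan b (J : Set ι)).map (g.1 : V →ₗ[K] V) ⊓ coordSpan b {i | i ∉ R ∨ i ∉ I} =
      (LinearMap.ker M.mulVecLin).map T := by
    rw [hker, Submodule.map_comap_eq, hrange]
  rw [h1, ← (Submodule.equivMapOfInjective T hT _).finrank_eq, Matrix.rank, add_comm,
    LinearMap.finrank_range_add_finrank_ker]
  simp

theorem isClosed_le_finrank {b : Basis ι K V} {I J : Finset ι} (hJ : J ⊆ I) (R : Finset ι)
    (r : ℕ) : IsClosed[(zariski (entCoord b I)).top] {g : glPiece b I | r ≤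
      finrank K ((coordSpan b (J : Set ι)).map (g.1.1 : V →ₗ[K] V) ⊓
        coordSpan b {i | i ∉ R ∨ i ∉ I} : Submodule K V)} := by
  by_cases hr : r ≤ J.card
  · have h := isClosed_rank_le (c := entCoord b I)
      (M := fun g => Matrix.of fun (i : (R : Finset ι)) (j : J) => ent g.1 i j)
      (fun i j => coord_mem_polyFun (entCoord b I) ((i : ι), (j : ι))) (J.card - r)
    convert h using 1
    ext g
    have := finrank_map_inf_add_rank hJ g.2 R
    simp only [Set.mem_ofPred_eq]
    omega
  · have : {g : glPiece b I | r ≤ finrank K ((coordSpan b (J : Set ι)).map (g.1.1 : V →ₗ[K] V) ⊓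
        coordSpan b {i | i ∉ R ∨ i ∉ I} : Submodule K V)} = ∅ := by
      ext g
      have := finrank_map_inf_add_rank hJ g.2 R
      simp only [Set.mem_ofPred_eq, Set.mem_empty_iff_false, iff_false]
      omega
    rw [this]
    exact @isClosed_empty _ (zariski (entCoord b I)).top

theorem isClosed_preimage_of_le {b : Basis ι K V} {I J : Finset ι} (hIJ : I ⊆ J)
    {Z : Set (GLInf b)} (hZ : IsClosed[(zariski (entCoord b J)).top] {g : glPiece b J | g.1 ∈ Z}) :
    IsClosed[(zariski (entCoord b I)).top] {g : glPiece b I | g.1 ∈ Z} := by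
  have hc : Continuous[(zariski (entCoord b I)).top, (zariski (entCoord b J)).top]
      (fun g : glPiece b I => (⟨g.1, glPiece_mono hIJ g.2⟩ : glPiece b J)) :=
    continuous_zariski fun p => coord_mem_polyFun (entCoord b I) p
  exact @IsClosed.preimage _ _ (zariski (entCoord b I)).top (zariski (entCoord b J)).top _ hc _ hZ

variable {A : Type*} [LinearOrder A]

theorem wact_of_notMem {I : Finset ι} {w : WInf ι} (hw : ∀ i ∉ I, w.1 i = i) {A : Type*}
    (σ₀ : ι → A) {i : ι}    (hi : i ∉ I) : wact w σ₀ i = σ₀ i := by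
  have : (w.1)⁻¹ i = i := by rw [Equiv.Perm.inv_eq_iff_eq, hw i hi]
  rw [wact, this]

theorem perm_mem {I : Finset ι} {w : WInf ι} (hw : ∀ i ∉ I, w.1 i = i) {i : ι} (hi : i ∈ I) :
    w.1 i ∈ I := by
  by_contra h
  have := w.1.injective (hw _ h)
  rw [this] at h
  exact h hi

theorem card_filter_wact {I : Finset ι} {w : WInf ι} (hw : ∀ i ∉ I, w.1 i = i) (σ₀ : ι → A)
    (α : A) : (I.filter fun i => wact w σ₀ i ≤ α).card = (I.filter fun i => σ₀ i ≤ α).card := by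
  have hinv : ∀ i ∉ I, (w⁻¹ : WInf ι).1 i = i := fun i hi => by
    show (w.1)⁻¹ i = i
    rw [Equiv.Perm.inv_eq_iff_eq, hw i hi]
  symm
  refine Finset.card_bij (fun i _ => w.1 i) (fun i hi => ?_) (fun _ _ _ _ h => w.1.injective h)
    fun i hi => ⟨(w.1)⁻¹ i, ?_, by simp⟩
  · simp only [Finset.mem_filter] at hi ⊢
    exact ⟨perm_mem hw hi.1, by simpa [wact] using hi.2⟩
  · simp only [Finset.mem_filter] at hi ⊢
    exact ⟨perm_mem hinv hi.1, hi.2⟩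

variable [LinearOrder ι]

/-- The rank function of a point of the cell of `σ` is given by the prefix counts of `σ`. -/
theorem finrank_eq_prefixCount {b : Basis ι K V} {σ₀ : ι → A} {I : Finset ι} {g h : GLInf b}
    (hg : g ∈ glPiece b I) (hh : h ∈ glPiece b I) (htri : ∀ i j, ent h i j ≠ 0 → i ≤ j)
    {w : WInf ι} (hact : act g.1 (flagOf b σ₀) = act h.1 (flagOf b (wact w σ₀)))
    (k : ι) (α : A) :
    finrank K ((coordSpan b (I.filter fun i => σ₀ i ≤ α : Finset ι)).map (g.1 : V →ₗ[K] V) ⊓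
      coordSpan b {i | i ∉ I.filter (k < ·) ∨ i ∉ I} : Submodule K V) =
        prefixCount I (wact w σ₀) k α := by
  have e1 : (upper b σ₀ α).map (g.1 : V →ₗ[K] V) =
      (upper b (wact w σ₀) α).map (h.1 : V →ₗ[K] V) := by
    rw [← act_mul_permGL] at hact
    rw [map_eq_of_act_eq hact (upper_mem b σ₀ α), ← map_permGL_upper, ← Submodule.map_comp]
    rfl
  have e2 : ∀ (p : GLInf b) (hp : p ∈ glPiece b I) (σ : ι → A),
      (coordSpan b (I.filter fun i => σ i ≤ α : Finset ι)).map (p.1 : V →ₗ[K] V) =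
        (upper b σ α).map (p.1 : V →ₗ[K] V) ⊓ coordSpan b (I : Set ι) := by
    intro p hp σ
    rw [map_inf_coordSpan hp, ← inter_coe_eq_filter, ← coordSpan_inf]
    rfl
  have e3 : (coordSpan b (I.filter fun i => σ₀ i ≤ α : Finset ι)).map (g.1 : V →ₗ[K] V) ⊓
      coordSpan b {i | i ∉ I.filter (k < ·) ∨ i ∉ I} =
      (coordSpan b (I.filter fun i => i ≤ k ∧ wact w σ₀ i ≤ α : Finset ι)).map
        (h.1 : V →ₗ[K] V) := by
    have e4 : coordSpan b (I : Set ι) ⊓ coordSpan b {i | i ∉ I.filter (k < ·) ∨ i ∉ I} =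
        coordSpan b (I : Set ι) ⊓ coordSpan b {i | i ≤ k} := by
      rw [coordSpan_inf, coordSpan_inf]
      congr 1
      ext i
      simp only [Finset.mem_filter, Set.mem_inter_iff, Finset.mem_coe, Set.mem_ofPred_eq, not_and,
        not_lt]
      tauto
    rw [e2 g hg, inf_assoc, e4, ← inf_assoc, e1, ← e2 h hh]
    have e5 : (coordSpan b {i | i ≤ k}).map (h.1 : V →ₗ[K] V) = coordSpan b {i | i ≤ k} :=
      map_eq_of_triangular htri (isLowerSet_Iic k)
    conv_lhs => rw [← e5]
    rw [← Submodule.map_inf _ h.1.injective, coordSpan_inf]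
    congr 2
    ext i
    simp only [Finset.coe_filter, Set.mem_inter_iff, Set.mem_ofPred_eq]
    tauto
  rw [e3]
  exact (LinearEquiv.finrank_map_eq h.1 _).trans (finrank_coordSpan b _)

/-- The union of the cells below `τ`. -/
def schubert (b : Basis ι K V) (σ₀ τ : ι → A) : Set (Fl b (flagOf b σ₀)) :=
  {G | ∃ σ ∈ WOrbit σ₀, BruhatLE σ τ ∧ G.1 ∈ cell b (flagStabilizer b (maxFlag b)) σ}

theorem exists_support_subset {E : ℕ → Finset ι} (hE : Monotone E) (hEι : ∀ i, ∃ n, i ∈ E n)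
    (w : WInf ι) (n : ℕ) : ∃ m, n ≤ m ∧ ∀ i ∉ E m, w.1 i = i := by
  obtain ⟨m, hm⟩ := exists_subset_of_exhaustion hE hEι w.2
  refine ⟨max n m, le_max_left _ _, fun i hi => ?_⟩
  by_contra h
  exact hi (hE (le_max_right n m) (hm h))

/-- The intersection dimensions of a flag in the cell of `σ` are the prefix counts of `σ`, and
domination of prefix counts is the Bruhat order. This replaces a union of cells by rank
inequalities. -/
theorem mem_schubert_iff {b : Basis ι K V} {σ₀ : ι → A} (hσ₀ : Function.Surjective σ₀)
    {I : Finset ι} {w : WInf ι} (hw : ∀ i ∉ I, w.1 i = i) {g : GLInf b} (hg : g ∈ glPiece b I) :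
    orbMap b hσ₀ g ∈ schubert b σ₀ (wact w σ₀) ↔ ∀ k α, prefixCount I (wact w σ₀) k α ≤
      finrank K ((coordSpan b (I.filter fun i => σ₀ i ≤ α : Finset ι)).map (g.1 : V →ₗ[K] V) ⊓
        coordSpan b {i | i ∉ I.filter (k < ·) ∨ i ∉ I} : Submodule K V) := by
  obtain ⟨w', hw', h, hh, htri, hact⟩ := exists_triangular_act_eq σ₀ hg
  have hoff : ∀ i ∉ I, wact w' σ₀ i = wact w σ₀ i := fun i hi => by
    rw [wact_of_notMem hw σ₀ hi, wact_of_notMem hw' σ₀ hi]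
  have hcell : (orbMap b hσ₀ g).1 ∈ cell b (flagStabilizer b (maxFlag b)) (wact w' σ₀) :=
    ⟨h, mem_flagStabilizer_maxFlag.2 htri, hact⟩
  simp only [finrank_eq_prefixCount hg hh htri hact]
  constructor
  · rintro ⟨σ, hσ, hle, hmem⟩
    rw [eq_of_mem_cell hσ₀ hσ ⟨w', rfl⟩ hmem hcell] at hle
    exact prefixCount_le_of_bruhatLE hoff hle
  · intro hle
    refine ⟨_, ⟨w', rfl⟩, bruhatLE_of_prefixCount_le hoff (fun α => ?_) hle, hcell⟩
    rw [card_filter_wact hw, card_filter_wact hw']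

theorem isClosed_schubert {b : Basis ι K V} {E : ℕ → Finset ι} (hE : Monotone E)
    (hEι : ∀ i, ∃ n, i ∈ E n) {σ₀ : ι → A} (hσ₀ : Function.Surjective σ₀) {τ : ι → A}
    (hτ : τ ∈ WOrbit σ₀) : IsClosed[(flInd b E σ₀).top] (schubert b σ₀ τ) := by
  obtain ⟨w, rfl⟩ := hτ
  rw [isClosed_flInd_iff hσ₀]
  intro n
  obtain ⟨m, hnm, hm⟩ := exists_support_subset hE hEι w n
  -- The rank conditions describe the Schubert set only on a piece that contains the support of `w`;
  -- on the smaller piece closedness is inherited.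
  refine isClosed_preimage_of_le (Z := {g | orbMap b hσ₀ g ∈ schubert b σ₀ (wact w σ₀)})
    (hE hnm) ?_
  have : {g : glPiece b (E m) | orbMap b hσ₀ g.1 ∈ schubert b σ₀ (wact w σ₀)} = ⋂ k, ⋂ α,
      {g : glPiece b (E m) | prefixCount (E m) (wact w σ₀) k α ≤ finrank K
        ((coordSpan b ((E m).filter fun i => σ₀ i ≤ α : Finset ι)).map (g.1.1 : V →ₗ[K] V) ⊓
          coordSpan b {i | i ∉ (E m).filter (k < ·) ∨ i ∉ E m} : Submodule K V)} := by
    ext g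
    simp only [Set.mem_iInter]
    exact mem_schubert_iff hσ₀ hm g.2
  show IsClosed[(zariski (entCoord b (E m))).top] {g : glPiece b (E m) |
    orbMap b hσ₀ g.1 ∈ schubert b σ₀ (wact w σ₀)}
  rw [this]
  let _ := (zariski (entCoord b (E m))).top
  exact isClosed_iInter fun k => isClosed_iInter fun α =>
    isClosed_le_finrank (Finset.filter_subset _ _) _ _

/-- The transvection `b j ↦ b j + s • b i`. -/
noncomputable def transv (b : Basis ι K V) {i j : ι} (hij : i ≠ j) (s : K) : GLInf b :=
  ⟨LinearEquiv.transvection (f := b.coord j) (v := s • b i) (by simp [hij]), by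
    refine (Set.finite_singleton j).subset fun k hk => ?_
    by_contra h
    have hkj : k ≠ j := h
    exact hk (by simp [LinearMap.transvection.apply, hkj])⟩

theorem transv_apply_same (b : Basis ι K V) {i j : ι} (hij : i ≠ j) (s : K) :
    (transv b hij s).1 (b j) = b j + s • b i := by
  simp [transv, LinearMap.transvection.apply]

theorem transv_apply_ne (b : Basis ι K V) {i j : ι} (hij : i ≠ j) (s : K) {k : ι} (hk : k ≠ j) :
    (transv b hij s).1 (b k) = b k := by
  simp [transv, LinearMap.transvection.apply, hk]

theorem transv_mem_glPiece (b : Basis ι K V) {i j : ι} (hij : i ≠ j) (s : K) {I : Finset ι}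
    (hi : i ∈ I) (hj : j ∈ I) : transv b hij s ∈ glPiece b I := by
  refine ⟨fun k hk => transv_apply_ne b hij s fun h : k = j => hk (h ▸ hj), fun k hk => ?_⟩
  by_cases h : k = j
  · rw [h, transv_apply_same]
    exact add_mem (basis_mem_coordSpan.2 hj) (Submodule.smul_mem _ _ (basis_mem_coordSpan.2 hi))
  · rw [transv_apply_ne b hij s h]
    exact basis_mem_coordSpan.2 hk

theorem transv_triangular (b : Basis ι K V) {i j : ι} (hij : i < j) (s : K) (k l : ι)
    (hkl : ent (transv b hij.ne s) k l ≠ 0) : k ≤ l := by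
  by_contra h
  rw [ent] at hkl
  by_cases hl : l = j
  · subst hl
    rw [transv_apply_same] at hkl
    have h1 : l ≠ k := fun h' => h h'.ge
    have h2 : i ≠ k := fun h' => h (h' ▸ hij.le)
    simp [h1, h2] at hkl
  · rw [transv_apply_ne b _ s hl] at hkl
    have h1 : l ≠ k := fun h' => h h'.ge
    simp [h1] at hkl

/-- In the plane of `b e` and `b j` the vectors `b e + s • b j` and `b j + s⁻¹ • b e` are
proportional, so `v (b e)` is `u (s • b j)`. The remaining hypotheses say that `T` contains the
indices needed to hit the images of `S`. -/
theorem map_exchange_le {b : Basis ι K V} {e j : ι} (hej : e ≠ j) {s : K} (hs : s ≠ 0)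
    {v u : GLInf b} (hve : v.1 (b e) = b e + s • b j) (hvn : ∀ i, i ≠ e → v.1 (b i) = b i)
    (huj : u.1 (b j) = b j + s⁻¹ • b e) (hun : ∀ i, i ≠ j → u.1 (b i) = b i) {S T : Set ι}
    (h : ∀ i, i ≠ e → i ≠ j → i ∈ S → i ∈ T) (he : e ∈ S → j ∈ T) (hj : j ∈ S → e ∈ T ∧ j ∈ T) :
    (coordSpan b S).map (v.1 : V →ₗ[K] V) ≤ (coordSpan b T).map (u.1 : V →ₗ[K] V) := by
  rw [Submodule.map_span_le]
  rintro _ ⟨i, hi, rfl⟩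
  show v.1 (b i) ∈ (coordSpan b T).map (u.1 : V →ₗ[K] V)
  by_cases hie : i = e
  · have h1 : u.1 (s • b j) = v.1 (b i) := by
      rw [map_smul, huj, hie, hve, smul_add, smul_smul, mul_inv_cancel₀ hs, one_smul, add_comm]
    rw [← h1]
    exact Submodule.mem_map_of_mem (Submodule.smul_mem _ s (basis_mem_coordSpan.2 (he (hie ▸ hi))))
  by_cases hij : i = j
  · have hT := hj (hij ▸ hi)
    have h1 : u.1 (b j - s⁻¹ • b e) = v.1 (b i) := by
      rw [map_sub, map_smul, huj, hun e hej, hvn i hie, add_sub_cancel_right, hij]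
    rw [← h1]
    exact Submodule.mem_map_of_mem (sub_mem (basis_mem_coordSpan.2 hT.2)
      (Submodule.smul_mem _ _ (basis_mem_coordSpan.2 hT.1)))
  · have h1 : u.1 (b i) = v.1 (b i) := by rw [hun i hij, hvn i hie]
    rw [← h1]
    exact Submodule.mem_map_of_mem (basis_mem_coordSpan.2 (h i hie hij hi))

/-- Since `σ e < σ j`, a member of the flag meets the plane of `b e` and `b j` in zero, in the line
of the smaller index, or in everything. The translates of that line by `v` and by `u` agree once the
two indices are exchanged. -/
theorem act_eq_of_exchange {b : Basis ι K V} {σ : ι → A} {e j : ι} (hej : e ≠ j) (hσ : σ e < σ j)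
    {s : K} (hs : s ≠ 0) {v u : GLInf b} (hve : v.1 (b e) = b e + s • b j)
    (hvn : ∀ i, i ≠ e → v.1 (b i) = b i) (huj : u.1 (b j) = b j + s⁻¹ • b e)
    (hun : ∀ i, i ≠ j → u.1 (b i) = b i) :
    act v.1 (flagOf b σ) = act u.1 (flagOf b (σ ∘ Equiv.swap e j)) := by
  have key : ∀ T : Set A, IsLowerSet T → (coordSpan b (σ ⁻¹' T)).map (v.1 : V →ₗ[K] V) =
      (coordSpan b ((σ ∘ Equiv.swap e j) ⁻¹' T)).map (u.1 : V →ₗ[K] V) := by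
    intro T hT
    have hmem : ∀ i, i ≠ e → i ≠ j → (i ∈ (σ ∘ Equiv.swap e j) ⁻¹' T ↔ i ∈ σ ⁻¹' T) := by
      intro i hie hij
      rw [Set.mem_preimage, Function.comp, Equiv.swap_apply_of_ne_of_ne hie hij, Set.mem_preimage]
    have hmeme : e ∈ (σ ∘ Equiv.swap e j) ⁻¹' T ↔ j ∈ σ ⁻¹' T := by simp
    have hmemj : j ∈ (σ ∘ Equiv.swap e j) ⁻¹' T ↔ e ∈ σ ⁻¹' T := by simp
    have hlow : j ∈ σ ⁻¹' T → e ∈ σ ⁻¹' T := fun h => hT hσ.le h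
    refine le_antisymm (map_exchange_le hej hs hve hvn huj hun (fun i hie hij => (hmem i hie hij).2)
      hmemj.2 fun h => ⟨hmeme.2 h, hmemj.2 (hlow h)⟩) ?_
    exact map_exchange_le hej.symm (inv_ne_zero hs) huj hun (by rwa [inv_inv]) hvn
      (fun i hij hie => (hmem i hie hij).1) hmemj.1
      fun h => ⟨hmeme.1 h, hlow (hmeme.1 h)⟩
  have hl : ∀ (ρ : ι → A) (α : A), lower b ρ α = coordSpan b (ρ ⁻¹' Set.Iio α) := fun _ _ => rfl
  have hu : ∀ (ρ : ι → A) (α : A), upper b ρ α = coordSpan b (ρ ⁻¹' Set.Iic α) := fun _ _ => rfl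
  refine act_eq_of_forall_map_eq (fun α => ?_) fun α => ?_
  · rw [hl, hl]
    exact key _ (isLowerSet_Iio α)
  · rw [hu, hu]
    exact key _ (isLowerSet_Iic α)

theorem act_transv_eq {b : Basis ι K V} {σ : ι → A} {e j : ι} (hej : e ≠ j) (hσ : σ e < σ j)
    {s : K} (hs : s ≠ 0) : act (transv b hej.symm s).1 (flagOf b σ) =
      act (transv b hej s⁻¹).1 (flagOf b (σ ∘ Equiv.swap e j)) :=
  act_eq_of_exchange hej hσ hs (transv_apply_same b _ s) (fun _ hi => transv_apply_ne b _ s hi)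
    (transv_apply_same b _ _) fun _ hi => transv_apply_ne b _ _ hi

theorem comp_swap_mem_WOrbit {A : Type*} {σ₀ σ : ι → A} (hσ : σ ∈ WOrbit σ₀) (e j : ι) :
    σ ∘ Equiv.swap e j ∈ WOrbit σ₀ := by
  obtain ⟨w, rfl⟩ := hσ
  have hs : Equiv.swap e j ∈ WInf ι := by
    refine ((Set.finite_singleton j).insert e).subset fun i hi => ?_
    by_contra h
    simp only [Set.mem_insert_iff, Set.mem_singleton_iff, not_or] at h
    exact hi (Equiv.swap_apply_of_ne_of_ne h.1 h.2)
  refine ⟨⟨_, hs⟩ * w, funext fun i => ?_⟩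
  simp [wact]

/-- The curve `s ↦ h x(s) F_σ`, with `x(s)` the transvection adding `s • b j` to `b e`, passes
through the given point at `s = 0`. For `s ≠ 0` the exchange identity puts it in the cell of `τ`. A
closed subset of the line containing all `s ≠ 0` contains `0`, as the field is infinite. -/
theorem mem_closed_of_step [Infinite K] {b : Basis ι K V} {E : ℕ → Finset ι} (hE : Monotone E)
    (hEι : ∀ i, ∃ n, i ∈ E n) {σ₀ : ι → A} (hσ₀ : Function.Surjective σ₀) {σ τ : ι → A}
    (hσ : σ ∈ WOrbit σ₀) (hstep : BruhatStep σ τ) {Z : Set (Fl b (flagOf b σ₀))}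
    (hZ : IsClosed[(flInd b E σ₀).top] Z)
    (hτZ : cellIn b σ₀ (flagStabilizer b (maxFlag b)) τ ⊆ Z) :
    cellIn b σ₀ (flagStabilizer b (maxFlag b)) σ ⊆ Z := by
  classical
  rintro ⟨G, hG⟩ ⟨h, hh, hGh⟩
  obtain ⟨w, rfl⟩ := hσ
  obtain ⟨e, j, hej, hσ, rfl⟩ := hstep
  obtain ⟨n₁, hn₁⟩ := exists_mem_glPiece hE hEι h
  obtain ⟨n₂, hn₂⟩ := exists_mem_glPiece hE hEι (permGL b w)
  obtain ⟨n₃, hn₃⟩ := hEι e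
  obtain ⟨n₄, hn₄⟩ := hEι j
  set n := max (max n₁ n₂) (max n₃ n₄) with hn
  have h1 : h ∈ glPiece b (E n) := glPiece_mono (hE (by omega)) hn₁
  have h2 : permGL b w ∈ glPiece b (E n) := glPiece_mono (hE (by omega)) hn₂
  have h3 : e ∈ E n := hE (by omega) hn₃
  have h4 : j ∈ E n := hE (by omega) hn₄
  let γ : ↥(Set.univ : Set K) → glPiece b (E n) := fun s =>
    ⟨h * (transv b hej.ne' s.1 * permGL b w), (glSub b (E n)).mul_mem h1
      ((glSub b (E n)).mul_mem (transv_mem_glPiece b _ _ h4 h3) h2)⟩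
  have hγ : ∀ s : ↥(Set.univ : Set K), (orbMap b hσ₀ (γ s).1).1 =
      act h.1 (act (transv b hej.ne' s.1).1 (flagOf b (wact w σ₀))) := by
    intro s
    show act (h.1 * ((transv b hej.ne' s.1).1 * (permGL b w).1)) (flagOf b σ₀) = _
    rw [act_mul, act_mul, act_permGL]
  have hcoord : ∀ p, (fun s => entCoord b (E n) (γ s) p) ∈ polyFun (lineCoord Set.univ) := by
    rintro ⟨i, k⟩
    have : ∀ s, entCoord b (E n) (γ s) (i, k) =
        ent h i (w.1 k) + (if w.1 k = e then ent h i j else 0) * lineCoord Set.univ s () := by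
      intro s
      show b.repr (h.1 ((transv b hej.ne' s.1).1 ((permGL b w).1 (b k)))) i = _
      rw [permGL_apply]
      by_cases hk : w.1 k = e
      · rw [hk, transv_apply_same]
        simp [ent, lineCoord, mul_comm]
      · rw [transv_apply_ne _ _ _ hk]
        simp [ent, hk]
    simp only [this]
    exact add_mem_polyFun (const_mem_polyFun _ _)
      (mul_mem_polyFun (const_mem_polyFun _ _) (coord_mem_polyFun (lineCoord Set.univ) ()))
  have hcl := (isClosed_flInd_iff hσ₀).1 hZ n
  have hcl' : IsClosed[(zariski (lineCoord (Set.univ : Set K))).top]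
      {s | orbMap b hσ₀ (γ s).1 ∈ Z} :=
    @IsClosed.preimage _ _ (zariski (lineCoord (Set.univ : Set K))).top
      (zariski (entCoord b (E n))).top _ (continuous_zariski hcoord) _ hcl
  have hne : ∀ s : ↥(Set.univ : Set K), s.1 ≠ 0 → orbMap b hσ₀ (γ s).1 ∈ Z := by
    intro s hs
    refine hτZ ⟨h * transv b hej.ne s.1⁻¹, mul_mem hh
      (mem_flagStabilizer_maxFlag.2 (transv_triangular b hej _)), ?_⟩
    rw [hγ, act_transv_eq hej.ne hσ hs, ← act_mul]
    rfl
  have h0 : orbMap b hσ₀ (γ ⟨0, trivial⟩).1 ∈ Z := by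
    by_contra hc
    have hopen : IsOpen[(zariski (lineCoord (Set.univ : Set K))).top]
        {s | orbMap b hσ₀ (γ s).1 ∈ Z}ᶜ :=
      (@isOpen_compl_iff _ _ (zariski (lineCoord (Set.univ : Set K))).top).2 hcl'
    obtain ⟨f, hf, hf0, hfs⟩ := exists_polyFun_of_isOpen hopen (x := ⟨0, trivial⟩) hc
    have hfin := (finite_zeros_of_mem_polyFun hf hf0).insert (⟨0, trivial⟩ : (Set.univ : Set K))
    have : Infinite (Set.univ : Set K) := Set.infinite_univ.to_subtype
    obtain ⟨s, hs⟩ := hfin.exists_notMem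
    simp only [Set.mem_insert_iff, Set.mem_ofPred_eq, not_or] at hs
    exact hfs s hs.2 (hne s fun h => hs.1 (Subtype.ext h))
  have hfinal : orbMap b hσ₀ (γ ⟨0, trivial⟩).1 = ⟨G, hG⟩ := by
    apply Subtype.ext
    rw [hγ]
    have : transv b hej.ne' (0 : K) = 1 := by
      refine GLInf_ext fun i => ?_
      by_cases hi : i = e
      · rw [hi, transv_apply_same, zero_smul, add_zero]
        rfl
      · exact transv_apply_ne _ _ _ hi
    rw [this, hGh]
    congr 1
    exact act_one _
  rwa [← hfinal]

theorem cellIn_subset_closure_iff [Infinite K] {b : Basis ι K V} {E : ℕ → Finset ι}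
    (hE : Monotone E) (hEι : ∀ i, ∃ n, i ∈ E n) {σ₀ : ι → A} (hσ₀ : Function.Surjective σ₀)
    {σ τ : ι → A} (hσ : σ ∈ WOrbit σ₀) (hτ : τ ∈ WOrbit σ₀) :
    cellIn b σ₀ (flagStabilizer b (maxFlag b)) σ ⊆ @closure _ (flInd b E σ₀).top
      (cellIn b σ₀ (flagStabilizer b (maxFlag b)) τ) ↔ BruhatLE σ τ := by
  let _ := (flInd b E σ₀).top
  constructor
  · intro h
    have hsub : closure (cellIn b σ₀ (flagStabilizer b (maxFlag b)) τ) ⊆ schubert b σ₀ τ :=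
      closure_minimal (fun G hG => ⟨τ, hτ, Relation.ReflTransGen.refl, hG⟩)
        (isClosed_schubert hE hEι hσ₀ hτ)
    have hmem : flagOf b σ ∈ cell b (flagStabilizer b (maxFlag b)) σ :=
      ⟨1, one_mem _, (act_one _).symm⟩
    obtain ⟨σ', hσ', hle, hm⟩ := hsub (h (a := ⟨flagOf b σ, cell_subset_Fl hσ₀ _ hσ hmem⟩) hmem)
    rwa [eq_of_mem_cell hσ₀ hσ hσ' hmem hm]
  · intro hle
    have key : ∀ ρ, BruhatLE ρ τ → ρ ∈ WOrbit σ₀ →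
        cellIn b σ₀ (flagStabilizer b (maxFlag b)) ρ ⊆
          closure (cellIn b σ₀ (flagStabilizer b (maxFlag b)) τ) := by
      intro ρ hρ
      induction hρ using Relation.ReflTransGen.head_induction_on with
      | refl => exact fun _ => subset_closure
      | head hstep _ ih =>
        intro hρ
        refine mem_closed_of_step hE hEι hσ₀ hρ hstep isClosed_closure (ih ?_)
        obtain ⟨e, j, _, _, rfl⟩ := hstep
        exact comp_swap_mem_WOrbit hρ e j
    exact key σ hle hσ

theorem bruhatLE_antisymm_of_mem {σ₀ σ τ : ι → A} (hσ : σ ∈ WOrbit σ₀) (hτ : τ ∈ WOrbit σ₀)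
    (h1 : BruhatLE σ τ) (h2 : BruhatLE τ σ) : σ = τ := by
  obtain ⟨w, rfl⟩ := hσ
  obtain ⟨w', rfl⟩ := hτ
  have hfin := Set.Finite.union w.2 w'.2
  have hw : ∀ i ∉ hfin.toFinset, w.1 i = i := fun i hi => by
    by_contra h
    exact hi (hfin.mem_toFinset.2 (Or.inl h))
  have hw' : ∀ i ∉ hfin.toFinset, w'.1 i = i := fun i hi => by
    by_contra h
    exact hi (hfin.mem_toFinset.2 (Or.inr h))
  refine bruhatLE_antisymm (I := hfin.toFinset) (fun i hi => ?_) (fun α => ?_) h1 h2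
  · exact (wact_of_notMem hw _ hi).trans (wact_of_notMem hw' _ hi).symm
  · show (Finset.filter (fun i => wact w σ₀ i ≤ α) _).card =
      (Finset.filter (fun i => wact w' σ₀ i ≤ α) _).card
    rw [card_filter_wact hw, card_filter_wact hw']

theorem finite_wact {A : Type*} (σ₀ : ι → A) (I : Finset ι) :
    {σ : ι → A | ∃ w : WInf ι, (∀ i ∉ I, w.1 i = i) ∧ σ = wact w σ₀}.Finite := by
  classical
  refine (Set.finite_range fun (f : I → I) (i : ι) =>
    if h : i ∈ I then σ₀ (f ⟨i, h⟩) else σ₀ i).subset ?_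
  rintro _ ⟨w, hw, rfl⟩
  have hinv : ∀ i ∉ I, (w⁻¹ : WInf ι).1 i = i := fun i hi => by
    show (w.1)⁻¹ i = i
    rw [Equiv.Perm.inv_eq_iff_eq, hw i hi]
  refine ⟨fun i => ⟨(w.1)⁻¹ i, perm_mem hinv i.2⟩, funext fun i => ?_⟩
  by_cases hi : i ∈ I
  · simp only [hi, dif_pos]
    rfl
  · simp only [hi, dif_neg, not_false_iff]
    exact (wact_of_notMem hw σ₀ hi).symm

/-- The cell is the closed Schubert set minus the union `Y` of the strictly lower cells. `Y` may
involve infinitely many cells, but on `E n` only rearrangements of `σ₀` by permutations of `E n`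
occur. There `Y` is a finite union of Schubert sets. -/
theorem isLocallyClosed_cellIn {b : Basis ι K V} {E : ℕ → Finset ι} (hE : Monotone E)
    (hEι : ∀ i, ∃ n, i ∈ E n) {σ₀ : ι → A} (hσ₀ : Function.Surjective σ₀) {τ : ι → A}
    (hτ : τ ∈ WOrbit σ₀) : @IsLocallyClosed _ (flInd b E σ₀).top
      (cellIn b σ₀ (flagStabilizer b (maxFlag b)) τ) := by
  let Y : Set (Fl b (flagOf b σ₀)) := {G | ∃ σ ∈ WOrbit σ₀, BruhatLE σ τ ∧ σ ≠ τ ∧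
    G.1 ∈ cell b (flagStabilizer b (maxFlag b)) σ}
  have hY : IsClosed[(flInd b E σ₀).top] Y := by
    rw [isClosed_flInd_iff hσ₀]
    intro n
    have hset : {g : glPiece b (E n) | orbMap b hσ₀ g.1 ∈ Y} =
        ⋃ σ ∈ {σ : ι → A | ∃ w : WInf ι, (∀ i ∉ E n, w.1 i = i) ∧ σ = wact w σ₀} ∩
          {σ | BruhatLE σ τ ∧ σ ≠ τ}, {g : glPiece b (E n) | orbMap b hσ₀ g.1 ∈ schubert b σ₀ σ} := by
      ext g
      simp only [Set.mem_iUnion, exists_prop]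
      constructor
      · rintro ⟨σ, hσ, hle, hne, hm⟩
        obtain ⟨w, hw, h, _, htri, hact⟩ := exists_triangular_act_eq σ₀ g.2
        have hm' : (orbMap b hσ₀ g.1).1 ∈ cell b (flagStabilizer b (maxFlag b)) (wact w σ₀) :=
          ⟨h, mem_flagStabilizer_maxFlag.2 htri, hact⟩
        obtain rfl := eq_of_mem_cell hσ₀ hσ ⟨w, rfl⟩ hm hm'
        exact ⟨_, ⟨⟨w, hw, rfl⟩, hle, hne⟩, _, hσ, Relation.ReflTransGen.refl, hm⟩
      · rintro ⟨_, ⟨⟨w, hw, rfl⟩, hle, hne⟩, ρ, hρ, hρle, hm⟩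
        refine ⟨ρ, hρ, hρle.trans hle, ?_, hm⟩
        rintro rfl
        exact hne (bruhatLE_antisymm_of_mem ⟨w, rfl⟩ hρ hle hρle)
    have hfin := (finite_wact σ₀ (E n)).inter_of_left {σ | BruhatLE σ τ ∧ σ ≠ τ}
    show IsClosed[(zariski (entCoord b (E n))).top] {g : glPiece b (E n) | orbMap b hσ₀ g.1 ∈ Y}
    rw [hset]
    let _ := (zariski (entCoord b (E n))).top
    refine hfin.isClosed_biUnion fun σ hσ => ?_
    obtain ⟨⟨w, _, rfl⟩, _⟩ := hσ
    exact (isClosed_flInd_iff hσ₀).1 (isClosed_schubert hE hEι hσ₀ ⟨w, rfl⟩) n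
  let _ := (flInd b E σ₀).top
  refine ⟨Yᶜ, schubert b σ₀ τ, hY.isOpen_compl, isClosed_schubert hE hEι hσ₀ hτ, ?_⟩
  ext G
  constructor
  · intro hG
    refine ⟨?_, τ, hτ, Relation.ReflTransGen.refl, hG⟩
    rintro ⟨σ, hσ, _, hne, hm⟩
    exact hne (eq_of_mem_cell hσ₀ hσ hτ hm hG)
  · rintro ⟨hGY, σ, hσ, hle, hm⟩
    by_cases hne : σ = τ
    · exact hne ▸ hm
    · exact absurd ⟨σ, hσ, hle, hne, hm⟩ hGY

end Schubert

/-! ## Charts on the cells -/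

section Chart

variable {K : Type*} [Field K] {V : Type*} [AddCommGroup V] [Module K V] {ι : Type*}

theorem ent_mul_permGL {b : Basis ι K V} (g : GLInf b) (w : WInf ι) (i j : ι) :
    ent (g * permGL b w) i j = ent g i (w.1 j) := by
  show b.repr (g.1 ((permGL b w).1 (b j))) i = _
  rw [permGL_apply]
  rfl

theorem mem_glPiece_of_ent [DecidableEq ι] {b : Basis ι K V} {g : GLInf b} {I : Finset ι}
    (h : ∀ i j, ent g i j ≠ 0 → i ≠ j → i ∈ I ∧ j ∈ I) (h1 : ∀ i ∉ I, ent g i i = 1) :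
    g ∈ glPiece b I := by
  refine ⟨fun j hj => b.repr.injective (Finsupp.ext fun i => ?_), fun j hj => ?_⟩
  · by_cases hij : i = j
    · subst hij
      rw [Basis.repr_self, Finsupp.single_eq_same]
      exact h1 i hj
    · rw [Basis.repr_self, Finsupp.single_eq_of_ne hij]
      by_contra hne
      exact hj (h i j hne hij).2
  · refine mem_coordSpan.2 fun i hi => ?_
    by_cases hij : i = j
    · rw [hij]; exact hj
    · exact (h i j hi hij).1

theorem map_eq_map_of_le {b : Basis ι K V} {I : Finset ι} {g h : GLInf b} (hg : g ∈ glPiece b I)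
    (hh : h ∈ glPiece b I) {W : Submodule K V}
    (hle : W.map (g.1 : V →ₗ[K] V) ≤ W.map (h.1 : V →ₗ[K] V)) :
    W.map (g.1 : V →ₗ[K] V) = W.map (h.1 : V →ₗ[K] V) :=
  eq_of_le_of_sup_eq hle ((map_sup_coordSpan hg W).trans (map_sup_coordSpan hh W).symm)
    ((finrank_map_inf_coordSpan hg W).trans (finrank_map_inf_coordSpan hh W).symm)

variable {A : Type*} [LinearOrder A]

/-- The submatrix of `g` with rows and columns in `{i ∈ I | σ i ≤ α}`. -/
noncomputable def minorMat {b : Basis ι K V} (I : Finset ι) (σ : ι → A) (α : A) (g : GLInf b) :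
    Matrix {k // k ∈ I.filter fun i => σ i ≤ α} {k // k ∈ I.filter fun i => σ i ≤ α} K :=
  Matrix.of fun k l => ent g k l

/-- Both matrices send `⟨J⟩`, `J = {i ∈ I | σ i ≤ α}`, to the same space, so the `J`-columns of `h`
are combinations of those of `g`. -/
theorem exists_minorMat_mul {b : Basis ι K V} {I : Finset ι} {σ : ι → A} {g h : GLInf b}
    (hg : g ∈ glPiece b I) (hh : h ∈ glPiece b I)
    (hact : act g.1 (flagOf b σ) = act h.1 (flagOf b σ)) (α : A) :
    ∃ P : Matrix {k // k ∈ I.filter fun i => σ i ≤ α} {k // k ∈ I.filter fun i => σ i ≤ α} K,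
      ∀ i l, ent h i l.1 = ∑ k, ent g i k.1 * P k l := by
  set J := I.filter fun i => σ i ≤ α with hJ
  have hmap : (coordSpan b (J : Set ι)).map (g.1 : V →ₗ[K] V) =
      (coordSpan b (J : Set ι)).map (h.1 : V →ₗ[K] V) := by
    have e2 : ∀ (p : GLInf b) (hp : p ∈ glPiece b I),
        (coordSpan b (J : Set ι)).map (p.1 : V →ₗ[K] V) =
          (upper b σ α).map (p.1 : V →ₗ[K] V) ⊓ coordSpan b (I : Set ι) := by
      intro p hp
      rw [map_inf_coordSpan hp, hJ, ← inter_coe_eq_filter, ← coordSpan_inf]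
      rfl
    rw [e2 g hg, e2 h hh, map_eq_of_act_eq hact (upper_mem b σ α)]
  have hcol : ∀ l : {k // k ∈ J}, ∃ v ∈ coordSpan b (J : Set ι), g.1 v = h.1 (b l) := by
    intro l
    have h1 : h.1 (b l) ∈ (coordSpan b (J : Set ι)).map (h.1 : V →ₗ[K] V) :=
      Submodule.mem_map_of_mem (basis_mem_coordSpan.2 l.2)
    rw [← hmap] at h1
    exact h1
  choose v hv hvl using hcol
  refine ⟨Matrix.of fun k l => b.repr (v l) k.1, fun i l => ?_⟩
  rw [ent, ← hvl l, repr_apply_eq_sum g (hv l) i, ← Finset.sum_coe_sort J]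
  rfl

variable [DecidableEq ι]

/-- The numerator of the chart coordinate in row `i` and column `j`; the denominator is the
determinant of `minorMat`. -/
noncomputable def chartNum {b : Basis ι K V} {I : Finset ι} (σ : ι → A) (i : ι) {j : ι}
    (hj : j ∈ I) (g : GLInf b) : K :=
  ∑ k : {k // k ∈ I.filter fun i => σ i ≤ σ j},
    ent g i k * (minorMat I σ (σ j) g).adjugate k ⟨j, Finset.mem_filter.2 ⟨hj, le_rfl⟩⟩

/-- Replacing `g` by `h` multiplies the relevant columns by `P` on the right, and the adjugate by
`adj P` on the left. Numerator and denominator both acquire the factor `det P`, so their quotient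
depends on the flag alone. -/
theorem exists_chart_factor {b : Basis ι K V} {I : Finset ι} {σ : ι → A} {g h : GLInf b}
    (hg : g ∈ glPiece b I) (hh : h ∈ glPiece b I)
    (hact : act g.1 (flagOf b σ) = act h.1 (flagOf b σ)) {j : ι} (hj : j ∈ I) :
    ∃ d : K, (minorMat I σ (σ j) h).det = (minorMat I σ (σ j) g).det * d ∧
      ∀ i, chartNum σ i hj h = chartNum σ i hj g * d := by
  obtain ⟨P, hP⟩ := exists_minorMat_mul hg hh hact (σ j)
  have hM : minorMat I σ (σ j) h = minorMat I σ (σ j) g * P := by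
    ext k l
    rw [Matrix.mul_apply]
    exact hP k l
  refine ⟨P.det, by rw [hM, Matrix.det_mul], fun i => ?_⟩
  have hrow : ∀ (p : GLInf b), chartNum σ i hj p =
      ((Matrix.of fun (_ : Unit) (k : {k // k ∈ I.filter fun i => σ i ≤ σ j}) => ent p i k) *
        (minorMat I σ (σ j) p).adjugate) () ⟨j, Finset.mem_filter.2 ⟨hj, le_rfl⟩⟩ := fun p => rfl
  have hN : (Matrix.of fun (_ : Unit) (k : {k // k ∈ I.filter fun i => σ i ≤ σ j}) => ent h i k) =
      (Matrix.of fun (_ : Unit) (k : {k // k ∈ I.filter fun i => σ i ≤ σ j}) => ent g i k) * P := by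
    ext _ l
    rw [Matrix.mul_apply]
    exact hP i l
  rw [hrow, hrow, hN, hM, Matrix.adjugate_mul_distrib, Matrix.mul_assoc,
    ← Matrix.mul_assoc P, Matrix.mul_adjugate, Matrix.smul_mul, Matrix.one_mul, Matrix.mul_smul,
    Matrix.smul_apply, smul_eq_mul, mul_comm]

end Chart

/-! ### Unipotent representatives of the points of a cell -/

section Uni

variable {K : Type*} [Field K] {V : Type*} [AddCommGroup V] [Module K V] {ι : Type*}
  [LinearOrder ι] {A : Type*} [LinearOrder A] {b : Basis ι K V}

/-- The pairs counted by the inversion number. -/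
def invSet (σ : ι → A) : Set (ι × ι) := {p | p.1 < p.2 ∧ σ p.2 < σ p.1}

/-- `u` is unipotent and its nonzero off-diagonal entries sit at the inversions of `σ`. -/
def IsUni (σ : ι → A) (u : GLInf b) : Prop :=
  (∀ i, ent u i i = 1) ∧ ∀ i j, i ≠ j → ent u i j ≠ 0 → (i, j) ∈ invSet σ

theorem IsUni.triangular {σ : ι → A} {u : GLInf b} (hu : IsUni σ u) (i j : ι)
    (h : ent u i j ≠ 0) : i ≤ j := by
  by_cases hij : i = j
  · exact hij.le
  · exact (hu.2 i j hij h).1.le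

theorem exists_isUni (b : Basis ι K V) {σ : ι → A} {I : Finset ι} {c : ι → ι → K}
    (hc : ∀ i j, c i j ≠ 0 → i ∈ I ∧ j ∈ I ∧ (i, j) ∈ invSet σ) :
    ∃ u ∈ glPiece b I, IsUni σ u ∧ ∀ i j, i ≠ j → ent u i j = c i j := by
  let v : ι → V := fun j => b j + ∑ i ∈ I, c i j • b i
  have hrepr : ∀ i j, b.repr (v j) i = (if i = j then 1 else 0) + c i j := by
    intro i j
    simp only [v, map_add, Basis.repr_self, map_sum, map_smul, Finsupp.coe_add, Pi.add_apply,
      Finsupp.coe_finsetSum, Finset.sum_apply, Finsupp.coe_smul, Pi.smul_apply, smul_eq_mul,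
      Finsupp.single_apply, mul_ite, mul_one, mul_zero]
    congr 1
    · simp only [eq_comm]
    · rw [Finset.sum_ite_eq' I i]
      split_ifs with h
      · rfl
      · by_contra hne
        exact h (hc i j (Ne.symm hne)).1
  have hcdiag : ∀ i, c i i = 0 := fun i => by
    by_contra h
    exact lt_irrefl i (hc i i h).2.2.1
  have hle : ∀ i j, b.repr (v j) i ≠ 0 → i ≠ j → c i j ≠ 0 := by
    intro i j h hij
    rwa [hrepr, if_neg hij, zero_add] at h
  have hdiag : ∀ i, b.repr (v i) i = 1 := fun i => by rw [hrepr, hcdiag]; simp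
  have hli := linearIndependent_of_triangular b (I := I) (u := v)
    (fun i _ => by rw [hdiag]; exact one_ne_zero) fun i _ k hk => by
      by_cases h : k = i
      · exact h.le
      · exact (hc k i (hle k i hk h)).2.2.1.le
  obtain ⟨u, hu, huv⟩ := exists_glPiece_of_linearIndependent b I (u := v) (fun j hj =>
    mem_coordSpan.2 fun i hi => by
      by_cases h : i = j
      · rw [h]; exact hj
      · exact (hc i j (hle i j hi h)).1) hli
  have hent : ∀ i j, ent u i j = (if i = j then 1 else 0) + c i j := by
    intro i j
    by_cases hj : j ∈ I
    · rw [ent, huv j hj, hrepr]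
    · rw [ent_of_notMem_right hu hj]
      have : c i j = 0 := by
        by_contra h
        exact hj (hc i j h).2.1
      rw [this, add_zero]
  refine ⟨u, hu, ⟨fun i => by rw [hent, hcdiag]; simp, fun i j hij h => ?_⟩, fun i j hij => ?_⟩
  · rw [hent, if_neg hij, zero_add] at h
    exact (hc i j h).2.2
  · rw [hent, if_neg hij, zero_add]

/-- A zero diagonal entry would send `b i` into the span of the earlier basis vectors, which `h`
maps onto itself. -/
theorem diag_ne_zero_of_triangular {h : GLInf b} (htri : ∀ i j, ent h i j ≠ 0 → i ≤ j) (i : ι) :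
    ent h i i ≠ 0 := by
  intro h0
  have h1 : h.1 (b i) ∈ coordSpan b {k | k < i} := mem_coordSpan.2 fun k hk =>
    lt_of_le_of_ne (htri k i hk) fun hki : k = i => hk (by rw [hki]; exact h0)
  have e : (coordSpan b {k | k < i}).map (h.1 : V →ₗ[K] V) = coordSpan b {k | k < i} :=
    map_eq_of_triangular htri fun _ _ h2 h3 => lt_of_le_of_lt h2 h3
  rw [← e] at h1
  obtain ⟨v, hv, hvi⟩ := h1
  have hvi' : h.1 v = h.1 (b i) := hvi
  rw [h.1.injective hvi'] at hv
  have h4 : i ∈ {k | k < i} := basis_mem_coordSpan.1 hv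
  exact lt_irrefl i h4

/-- Every point of the cell of `σ` has a representative in the unipotent group of `σ`. -/
theorem exists_isUni_act_eq {σ : ι → A} {I : Finset ι} {h : GLInf b} (hh : h ∈ glPiece b I)
    (htri : ∀ i j, ent h i j ≠ 0 → i ≤ j) :
    ∃ u ∈ glPiece b I, IsUni σ u ∧ act h.1 (flagOf b σ) = act u.1 (flagOf b σ) := by
  have hcol : ∀ j ∈ I, ∃ x ∈ coordSpan b (I.filter fun k => k ≤ j ∧ σ k ≤ σ j : Finset ι),
      b.repr (h.1 x) j = 1 ∧ ∀ i, i ≠ j → b.repr (h.1 x) i ≠ 0 → i ∈ I ∧ (i, j) ∈ invSet σ := by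
    intro j hj
    -- Columns in `S` may be combined into column `j` without leaving the flag or the triangular
    -- shape. The square block on `S` is triangular and invertible, so the combination can be made
    -- the unit vector `j` on the rows of `S`; the other rows that can survive are inversions.
    set S := I.filter fun k => k ≤ j ∧ σ k ≤ σ j with hS
    have hjS : j ∈ S := Finset.mem_filter.2 ⟨hj, le_rfl, le_rfl⟩
    let M : Matrix {k // k ∈ S} {k // k ∈ S} K := Matrix.of fun k l => ent h k l
    have hM : M.det ≠ 0 := by
      have hbt : M.BlockTriangular id := fun k l hkl => by
        by_contra hne
        exact (htri k l hne).not_gt hkl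
      rw [Matrix.det_of_isUpperTriangular hbt]
      exact Finset.prod_ne_zero_iff.2 fun k _ => diag_ne_zero_of_triangular htri k
    let q : {k // k ∈ S} → K := M⁻¹.mulVec (Pi.single ⟨j, hjS⟩ 1)
    have hq : M.mulVec q = Pi.single ⟨j, hjS⟩ 1 := by
      rw [Matrix.mulVec_mulVec, Matrix.mul_nonsing_inv _ (isUnit_iff_ne_zero.2 hM),
        Matrix.one_mulVec]
    let x : V := ∑ k, q k • b k.1
    have hrepr : ∀ i, b.repr (h.1 x) i = ∑ k : {k // k ∈ S}, ent h i k * q k := by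
      intro i
      simp [x, ent, mul_comm]
    have hreprS : ∀ i (hi : i ∈ S), b.repr (h.1 x) i =
        (Pi.single ⟨j, hjS⟩ 1 : {k // k ∈ S} → K) ⟨i, hi⟩ := by
      intro i hi
      rw [hrepr, ← hq]
      rfl
    refine ⟨x, Submodule.sum_mem _ fun k _ => Submodule.smul_mem _ _ (basis_mem_coordSpan.2 k.2),
      by rw [hreprS j hjS]; simp, fun i hij hi => ?_⟩
    have hiS : i ∉ S := fun hiS => hi (by
      rw [hreprS i hiS, Pi.single_eq_of_ne]
      exact fun h' => hij (congrArg Subtype.val h'))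
    rw [hrepr] at hi
    obtain ⟨k, _, hk⟩ := Finset.exists_ne_zero_of_sum_ne_zero hi
    have hik := left_ne_zero_of_mul hk
    have hkS := Finset.mem_filter.1 k.2
    have hiI : i ∈ I := by
      by_contra hiI
      rw [ent_of_notMem_left hh hiI] at hik
      refine hik (if_neg fun h' => hiI ?_)
      rw [h']
      exact hkS.1
    have hilej : i ≤ j := (htri i k hik).trans hkS.2.1
    refine ⟨hiI, lt_of_le_of_ne hilej hij, ?_⟩
    by_contra hσ
    exact hiS (Finset.mem_filter.2 ⟨hiI, hilej, not_lt.1 hσ⟩)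
  choose! x hx hxj hxi using hcol
  have hsub : ∀ j ∈ I, x j ∈ coordSpan b (I : Set ι) := fun j hj =>
    coordSpan_le_iff.2 (Finset.coe_subset.2 (Finset.filter_subset _ _)) (hx j hj)
  have hle : ∀ j ∈ I, ∀ i, b.repr (h.1 (x j)) i ≠ 0 → i ≤ j := by
    intro j hj i hi
    by_cases hij : i = j
    · exact hij.le
    · exact (hxi j hj i hij hi).2.1.le
  have hli := linearIndependent_of_triangular b (I := I) (u := fun j => h.1 (x j))
    (fun j hj => by rw [hxj j hj]; exact one_ne_zero) hle
  obtain ⟨u, hu, huv⟩ := exists_glPiece_of_linearIndependent b I (u := fun j => h.1 (x j))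
    (fun j hj => by
      have h1 : h.1 (x j) ∈ (coordSpan b (I : Set ι)).map (h.1 : V →ₗ[K] V) :=
        Submodule.mem_map_of_mem (hsub j hj)
      rwa [map_coordSpan_self hh] at h1) hli
  have key : ∀ T : Set A, IsLowerSet T → (coordSpan b (σ ⁻¹' T)).map (h.1 : V →ₗ[K] V) =
      (coordSpan b (σ ⁻¹' T)).map (u.1 : V →ₗ[K] V) := by
    intro T hT
    symm
    refine map_eq_map_of_le hu hh ?_
    rw [Submodule.map_span_le]
    rintro _ ⟨j, hj, rfl⟩
    show u.1 (b j) ∈ (coordSpan b (σ ⁻¹' T)).map (h.1 : V →ₗ[K] V)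
    by_cases hjI : j ∈ I
    · rw [huv j hjI]
      refine Submodule.mem_map_of_mem (coordSpan_le_iff.2 (fun k hk => ?_) (hx j hjI))
      exact hT (Finset.mem_filter.1 hk).2.2 hj
    · rw [hu.1 j hjI, ← hh.1 j hjI]
      exact Submodule.mem_map_of_mem (basis_mem_coordSpan.2 hj)
  refine ⟨u, hu, ⟨fun i => ?_, fun i j hij hne => ?_⟩, ?_⟩
  · by_cases hi : i ∈ I
    · rw [ent, huv i hi, hxj i hi]
    · rw [ent_of_notMem_right hu hi, if_pos rfl]
  · by_cases hj : j ∈ I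
    · rw [ent, huv j hj] at hne
      exact (hxi j hj i hij hne).2
    · rw [ent_of_notMem_right hu hj, if_neg hij] at hne
      exact absurd rfl hne
  · have hl : ∀ α : A, lower b σ α = coordSpan b (σ ⁻¹' Set.Iio α) := fun _ => rfl
    have hu : ∀ α : A, upper b σ α = coordSpan b (σ ⁻¹' Set.Iic α) := fun _ => rfl
    refine act_eq_of_forall_map_eq (fun α => ?_) fun α => ?_
    · rw [hl]
      exact key _ (isLowerSet_Iio α)
    · rw [hu]
      exact key _ (isLowerSet_Iic α)

theorem IsUni.det_minorMat {σ : ι → A} {u : GLInf b} (hu : IsUni σ u) (I : Finset ι) (α : A) :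
    (minorMat I σ α u).det = 1 := by
  have hbt : (minorMat I σ α u).BlockTriangular id := fun k l hkl => by
    by_contra hne
    exact (hu.triangular k l hne).not_gt hkl
  rw [Matrix.det_of_isUpperTriangular hbt]
  exact Finset.prod_eq_one fun k _ => hu.1 k

/-- An off-diagonal entry of column `j` sits in a row with value above `σ j`, hence outside the
minor. So that column of the minor is a unit vector; the determinant being one, the same column of
the adjugate is too. -/
theorem IsUni.chartNum_eq {σ : ι → A} {u : GLInf b} (hu : IsUni σ u) {I : Finset ι} (i : ι) {j : ι}
    (hj : j ∈ I) : chartNum σ i hj u = ent u i j := by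
  set M := minorMat I σ (σ j) u with hM
  have hjJ : j ∈ I.filter fun i => σ i ≤ σ j := Finset.mem_filter.2 ⟨hj, le_rfl⟩
  have hcol : M.col ⟨j, hjJ⟩ = Pi.single ⟨j, hjJ⟩ 1 := by
    funext k
    by_cases hk : k = ⟨j, hjJ⟩
    · rw [hk, Pi.single_eq_same]
      exact hu.1 j
    · rw [Pi.single_eq_of_ne hk]
      by_contra hne
      exact (hu.2 k j (fun h => hk (Subtype.ext h)) hne).2.not_ge (Finset.mem_filter.1 k.2).2
  have hadj : ∀ k, M.adjugate k ⟨j, hjJ⟩ =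
      (Pi.single ⟨j, hjJ⟩ 1 : {k // k ∈ I.filter fun i => σ i ≤ σ j} → K) k := by
    intro k
    have h1 : M.adjugate.mulVec (M.col ⟨j, hjJ⟩) = Pi.single ⟨j, hjJ⟩ 1 := by
      have h2 : M.col ⟨j, hjJ⟩ = M.mulVec (Pi.single ⟨j, hjJ⟩ 1) := by simp
      rw [h2, Matrix.mulVec_mulVec, Matrix.adjugate_mul, hM, hu.det_minorMat, one_smul,
        Matrix.one_mulVec]
    rw [← h1, hcol]
    simp
  rw [chartNum, Finset.sum_eq_single ⟨j, hjJ⟩]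
  · rw [hadj, Pi.single_eq_same, mul_one]
  · intro k _ hk
    rw [hadj, Pi.single_eq_of_ne hk, mul_zero]
  · simp

theorem IsUni.eq_of_act_eq {σ : ι → A} {u v : GLInf b} (hu : IsUni σ u) (hv : IsUni σ v)
    (hact : act u.1 (flagOf b σ) = act v.1 (flagOf b σ)) : u = v := by
  obtain ⟨I₁, h₁⟩ := exists_finset_mem_glPiece u
  obtain ⟨I₂, h₂⟩ := exists_finset_mem_glPiece v
  refine ext_ent fun i j => ?_
  -- The index set is enlarged by `j` because the chart coordinate of column `j` needs `j` in the
  -- piece.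
  have hj : j ∈ insert j (I₁ ∪ I₂) := Finset.mem_insert_self _ _
  have h1 : I₁ ⊆ insert j (I₁ ∪ I₂) := Finset.subset_union_left.trans (Finset.subset_insert _ _)
  have h2 : I₂ ⊆ insert j (I₁ ∪ I₂) := Finset.subset_union_right.trans (Finset.subset_insert _ _)
  obtain ⟨d, hd, hchart⟩ := exists_chart_factor (glPiece_mono h1 h₁) (glPiece_mono h2 h₂) hact hj
  rw [hu.det_minorMat, hv.det_minorMat, one_mul] at hd
  have := hchart i
  rw [hu.chartNum_eq, hv.chartNum_eq, ← hd, mul_one] at this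
  exact this.symm

end Uni

/-! ## The cells are affine spaces -/

section Mor

variable {K : Type*} [Field K] {G X Y Z s t : Type*}

/-- A map into a quotient is a morphism once it lifts to a polynomial map upstairs. Regular
functions of the induced structure extend only locally, so regularity is checked on open pieces. -/
theorem isMor_induced_of_lift {S : FunSpace K Z} {c : G → s → K} {r : G → Z}
    (hS : (zariski c).IsMor S r) {j : Y → Z} {d : X → t → K} {ψ : X → G}
    (hψ : ∀ k, (fun x => c (ψ x) k) ∈ polyFun d) {f : X → Y} (hf : ∀ x, j (f x) = r (ψ x)) :
    (zariski d).IsMor (S.induced j) f := by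
  have hψm := zariski_isMor (d := c) hψ
  have hpre : ∀ W : Set Z, f ⁻¹' (j ⁻¹' W) = ψ ⁻¹' (r ⁻¹' W) := fun W => by
    ext x
    simp [hf]
  have hopen : ∀ W, IsOpen[S.top] W → IsOpen[(zariski d).top] (f ⁻¹' (j ⁻¹' W)) := fun W hW => by
    rw [hpre]
    exact continuous_def.1 hψm.1 _ (continuous_def.1 hS.1 W hW)
  refine ⟨continuous_def.2 ?_, fun U h _ hh => zariski_isReg_local fun x hx => ?_⟩
  · rintro _ ⟨W, hW, rfl⟩
    exact hopen W hW
  · obtain ⟨W, h', hW, hxW, hreg, heq⟩ := hh (f x) hx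
    refine ⟨f ⁻¹' (j ⁻¹' W), hopen W hW, hxW, ?_⟩
    have h1 := hψm.2 _ _ (continuous_def.1 hS.1 W hW) (hS.2 W h' hW hreg)
    refine zariski_isReg_congr (zariski_isReg_mono (W := f ⁻¹' U ∩ f ⁻¹' (j ⁻¹' W)) ?_ h1) ?_
    · rw [hpre]
      exact Set.inter_subset_right
    · rintro y ⟨hyU, hyW⟩
      show h (f y) = h' (r (ψ y))
      rw [heq (f y) hyU hyW, hf]

/-- The coordinates of `f` are restrictions of functions regular on an open set around the image.
Polynomials in them, and quotients where the denominator does not vanish, extend the pulled-back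
functions locally. -/
theorem isMor_of_induced {S : FunSpace K Z} {c : G → s → K} {r : G → Z}
    (hopen : ∀ {O}, IsOpen[S.top] O ↔ IsOpen[(zariski c).top] (r ⁻¹' O))
    (hreg : ∀ {U h}, S.IsReg U h ↔ (zariski c).IsReg (r ⁻¹' U) (h ∘ r))
    {j : Y → Z} {d : X → t → K} {f : Y → X} {W : Set Z} (hW : IsOpen[(zariski c).top] (r ⁻¹' W))
    {H : t → Z → K} (hH : ∀ k, (zariski c).IsReg (r ⁻¹' W) (H k ∘ r)) (hjW : ∀ y, j y ∈ W)
    (hf : ∀ y k, d (f y) k = H k (j y)) : (S.induced j).IsMor (zariski d) f := by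
  have hev : ∀ p : MvPolynomial t K, (zariski c).IsReg (r ⁻¹' W)
      fun g => MvPolynomial.eval (fun k => H k (r g)) p := fun p => zariski_isReg_eval hH p
  have hdf : ∀ y, d (f y) = fun k => H k (j y) := fun y => funext fun k => hf y k
  have hne : ∀ p : MvPolynomial t K,
      IsOpen[S.top] {z | z ∈ W ∧ MvPolynomial.eval (fun k => H k z) p ≠ 0} := fun p =>
    hopen.2 (isOpen_ne_of_zariski_isReg hW (hev p))
  refine ⟨continuous_generateFrom_iff.2 ?_, fun U h _ hh y hy => ?_⟩
  · rintro _ ⟨p, rfl⟩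
    refine ⟨_, hne p, ?_⟩
    ext y
    simp [hjW, hdf]
  · obtain ⟨p, q, hq, heq⟩ := hh (f y) hy
    refine ⟨_, fun z => MvPolynomial.eval (fun k => H k z) p *
      (MvPolynomial.eval (fun k => H k z) q)⁻¹, hne q, ⟨hjW y, by rwa [← hdf]⟩, hreg.2 ?_, ?_⟩
    · exact zariski_isReg_mul (zariski_isReg_mono (fun g hg => hg.1) (hev p))
        (zariski_isReg_inv (zariski_isReg_mono (fun g hg => hg.1) (hev q)) fun g hg => hg.2)
    · rintro z hz ⟨_, hzq⟩
      rw [← hdf] at hzq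
      have h1 := heq (f z) hz hzq
      rw [hdf, div_eq_mul_inv] at h1
      exact h1

end Mor

theorem exists_equiv_lt_encard {α : Type*} {S : Set α} (hS : S.Countable) :
    Nonempty (S ≃ {i : ℕ // (i : ℕ∞) < S.encard}) := by
  by_cases hfin : S.Finite
  · have : Fintype S := hfin.fintype
    have h1 : S.encard = (Fintype.card S : ℕ∞) := by
      rw [← hfin.cast_ncard_eq, Set.ncard_eq_toFinset_card', Set.toFinset_card]
    refine ⟨(Fintype.equivFin S).trans (Fin.equivSubtype.trans (Equiv.subtypeEquivRight fun i => ?_))⟩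
    rw [h1, Nat.cast_lt]
  · have := hS.to_subtype
    have := (Set.infinite_coe_iff.2 hfin)
    obtain ⟨e⟩ := nonempty_equiv_of_countable (α := S) (β := ℕ)
    refine ⟨e.trans (Equiv.subtypeUnivEquiv fun i => ?_).symm⟩
    rw [Set.encard_eq_top hfin]
    exact ENat.natCast_lt_top i

/-! ### The isomorphism of a cell with affine space -/

section Cell

variable {K : Type*} [Field K] {V : Type*} [AddCommGroup V] [Module K V] {ι : Type*}
  {A : Type*} [LinearOrder A] {b : Basis ι K V} {σ₀ : ι → A}

theorem flInd_isMor_orbPiece (hσ₀ : Function.Surjective σ₀) (E : ℕ → Finset ι) (n : ℕ) :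
    (zariski (entCoord b (E n))).IsMor ((flInd b E σ₀).str n) (orbPiece b hσ₀ (E n)) :=
  ⟨continuous_def.2 fun _ hO => (flInd_str_isOpen_iff hσ₀).1 hO,
    fun _ _ _ hh => (flInd_str_isReg_iff hσ₀).1 hh⟩

theorem wact_inv_of_eq {ι A : Type*} {σ₀ : ι → A} {w : WInf ι} {σ : ι → A} (hw : wact w σ₀ = σ) : wact w⁻¹ σ = σ₀ := by
  subst hw
  funext i
  simp [wact]

theorem minorMat_mem_polyFun {I J : Finset ι} (w : WInf ι) (σ : ι → A) (α : A)
    (k l : {k // k ∈ J.filter fun i => σ i ≤ α}) :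
    (fun g : glPiece b I => minorMat J σ α (g.1 * permGL b w) k l) ∈ polyFun (entCoord b I) := by
  have : (fun g : glPiece b I => minorMat J σ α (g.1 * permGL b w) k l) =
      fun g => entCoord b I g (k, w.1 l) := funext fun g => ent_mul_permGL g.1 w k l
  rw [this]
  exact coord_mem_polyFun _ _

theorem chartNum_mem_polyFun [DecidableEq ι] {I J : Finset ι} (w : WInf ι) (σ : ι → A) (i : ι)
    {j : ι} (hj : j ∈ J) :
    (fun g : glPiece b I => chartNum σ i hj (g.1 * permGL b w)) ∈ polyFun (entCoord b I) := by
  refine sum_mem_polyFun _ fun k _ => mul_mem_polyFun ?_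
    (adjugate_mem_polyFun (minorMat_mem_polyFun w σ (σ j)) _ _)
  simp only [ent_mul_permGL]
  exact coord_mem_polyFun (entCoord b I) (i, w.1 k)

variable [LinearOrder ι]

theorem mem_cell_of_triangular {σ : ι → A} {h : GLInf b} (htri : ∀ i j, ent h i j ≠ 0 → i ≤ j) :
    act h.1 (flagOf b σ) ∈ cell b (flagStabilizer b (maxFlag b)) σ :=
  ⟨h, mem_flagStabilizer_maxFlag.2 htri, rfl⟩

theorem exists_isUni_of_mem_flPiece (hσ₀ : Function.Surjective σ₀) {σ : ι → A}
    (hσ : σ ∈ WOrbit σ₀) {I : Finset ι} {z : Fl b (flagOf b σ₀)}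
    (hz : z ∈ cellIn b σ₀ (flagStabilizer b (maxFlag b)) σ) (hzI : z ∈ flPiece b σ₀ I) :
    (∃ w : WInf ι, (∀ i ∉ I, w.1 i = i) ∧ wact w σ₀ = σ) ∧
      ∃ u ∈ glPiece b I, IsUni σ u ∧ z.1 = act u.1 (flagOf b σ) := by
  obtain ⟨g, hg, hgz⟩ := mem_flPiece_iff.1 hzI
  obtain ⟨w, hw, h, hh, htri, hact⟩ := exists_triangular_act_eq σ₀ hg
  have hwσ : wact w σ₀ = σ := by
    refine eq_of_mem_cell hσ₀ ⟨w, rfl⟩ hσ ?_ hz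
    rw [hgz, hact]
    exact mem_cell_of_triangular htri
  refine ⟨⟨w, hw, hwσ⟩, ?_⟩
  obtain ⟨u, hu, hun, hua⟩ := exists_isUni_act_eq (σ := σ) hh htri
  exact ⟨u, hu, hun, by rw [hgz, hact, hwσ, hua]⟩

/-- An enumeration `ε` of the inversions turns a point `x` into a unipotent matrix `u x`, and `x ↦
(u x) F_σ` is a bijection onto the cell. This map lifts polynomially to the group, and the inverse
is given by the Cramer quotients. -/
theorem exists_cellIn_equiv_affineSpc {E : ℕ → Finset ι} (hE : Monotone E)
    (hEι : ∀ i, ∃ n, i ∈ E n) (hσ₀ : Function.Surjective σ₀) {σ : ι → A} (hσ : σ ∈ WOrbit σ₀) :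
    ∃ f : cellIn b σ₀ (flagStabilizer b (maxFlag b)) σ ≃ AffineSpc K (nInv σ),
      ((flInd b E σ₀).sub (cellIn b σ₀ (flagStabilizer b (maxFlag b)) σ)).IsIso
        (affineInd K (nInv σ)) f := by
  classical
  have hcount : Countable ι := by
    have h1 : (⋃ n, (E n : Set ι)) = Set.univ := Set.eq_univ_of_forall fun i =>
      Set.mem_iUnion.2 (hEι i)
    rw [← Set.countable_univ_iff, ← h1]
    exact Set.countable_iUnion fun n => (E n).countable_toSet
  obtain ⟨ε⟩ := exists_equiv_lt_encard (Set.to_countable (invSet σ))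
  have hN : (invSet σ).encard = nInv σ := rfl
  let c : AffineSpc K (nInv σ) → ι → ι → K := fun x i j =>
    if h : (i, j) ∈ invSet σ then x.1 (ε ⟨(i, j), h⟩).1 else 0
  have hcε : ∀ x (p : invSet σ), c x p.1.1 p.1.2 = x.1 (ε p).1 := fun x p => dif_pos p.2
  -- the matrices with bounded coordinates live in one piece
  have hbound : ∀ n, ∃ m, ∀ x ∈ (affineInd K (nInv σ)).piece n, ∀ i j, c x i j ≠ 0 →
      i ∈ E m ∧ j ∈ E m ∧ (i, j) ∈ invSet σ := by
    intro n
    have hfin : {p : invSet σ | (ε p).1 < n}.Finite :=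
      Set.Finite.preimage ((Subtype.val_injective.comp ε.injective).injOn) (Set.finite_lt_nat n)
    have hfin' : ((fun p : invSet σ => p.1.1) '' {p | (ε p).1 < n} ∪
      (fun p : invSet σ => p.1.2) '' {p | (ε p).1 < n}).Finite := (hfin.image _).union (hfin.image _)
    obtain ⟨m, hm⟩ := exists_subset_of_exhaustion hE hEι hfin'
    refine ⟨m, fun x hx i j hij => ?_⟩
    have hinv : (i, j) ∈ invSet σ := by
      by_contra h
      exact hij (dif_neg h)
    have hlt : (ε ⟨(i, j), hinv⟩).1 < n := by
      by_contra h
      refine hij ?_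
      rw [hcε x ⟨(i, j), hinv⟩]
      exact hx _ (not_lt.1 h)
    exact ⟨hm (Or.inl ⟨_, hlt, rfl⟩), hm (Or.inr ⟨_, hlt, rfl⟩), hinv⟩
  have hpiece : ∀ x : AffineSpc K (nInv σ), ∃ n, x ∈ (affineInd K (nInv σ)).piece n := by
    intro x
    refine ⟨x.1.support.sup id + 1, fun i hi => ?_⟩
    by_contra h
    have := Finset.le_sup (f := id) (Finsupp.mem_support_iff.2 h)
    simp only [id] at this
    omega
  have hex : ∀ x, ∃ u : GLInf b, IsUni σ u ∧ (∀ i j, i ≠ j → ent u i j = c x i j) := by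
    intro x
    obtain ⟨n, hn⟩ := hpiece x
    obtain ⟨m, hm⟩ := hbound n
    obtain ⟨u, _, hu, h⟩ := exists_isUni b (hm x hn)
    exact ⟨u, hu, h⟩
  choose u hu huc using hex
  have hux : ∀ x (p : invSet σ), ent (u x) p.1.1 p.1.2 = x.1 (ε p).1 := fun x p => by
    rw [huc x _ _ p.2.1.ne, hcε]
  have hcoord : ∀ x (k : ℕ) (hk : (k : ℕ∞) < nInv σ), x.1 k =
      ent (u x) (ε.symm ⟨k, hk⟩).1.1 (ε.symm ⟨k, hk⟩).1.2 := fun x k hk => by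
    rw [hux, Equiv.apply_symm_apply]
  have hux_eq : ∀ x v, IsUni σ v → (∀ p : invSet σ, ent v p.1.1 p.1.2 = x.1 (ε p).1) → v = u x := by
    intro x v hv h
    refine ext_ent fun i j => ?_
    by_cases hij : i = j
    · rw [hij, hv.1, (hu x).1]
    · by_cases hinv : (i, j) ∈ invSet σ
      · exact (h ⟨(i, j), hinv⟩).trans (hux x ⟨(i, j), hinv⟩).symm
      · have h1 : ent v i j = 0 := by
          by_contra hne
          exact hinv (hv.2 i j hij hne)
        have h2 : ent (u x) i j = 0 := by
          by_contra hne
          exact hinv ((hu x).2 i j hij hne)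
        rw [h1, h2]
  have hmem : ∀ x, act (u x).1 (flagOf b σ) ∈ cell b (flagStabilizer b (maxFlag b)) σ := fun x =>
    mem_cell_of_triangular (hu x).triangular
  let F : AffineSpc K (nInv σ) → cellIn b σ₀ (flagStabilizer b (maxFlag b)) σ := fun x =>
    ⟨⟨act (u x).1 (flagOf b σ), cell_subset_Fl hσ₀ _ hσ (hmem x)⟩, hmem x⟩
  -- a unipotent matrix is one of the chosen ones
  have hsurj : ∀ v : GLInf b, IsUni σ v → ∃ x, v = u x := by
    intro v hv
    obtain ⟨I, hI⟩ := exists_finset_mem_glPiece v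
    let S : Set ℕ := {k | ∃ hk : (k : ℕ∞) < nInv σ,
      ent v (ε.symm ⟨k, hk⟩).1.1 (ε.symm ⟨k, hk⟩).1.2 ≠ 0}
    have hS : S.Finite := by
      have h1 : {p : invSet σ | ent v p.1.1 p.1.2 ≠ 0}.Finite := by
        refine Set.Finite.of_finite_image (f := Subtype.val)
          ((I ×ˢ I).finite_toSet.subset ?_) Subtype.val_injective.injOn
        rintro _ ⟨p, hp, rfl⟩
        refine Finset.mem_coe.2 (Finset.mem_product.2 ⟨?_, ?_⟩)
        · by_contra h
          exact hp (by rw [ent_of_notMem_left hI h, if_neg p.2.1.ne])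
        · by_contra h
          exact hp (by rw [ent_of_notMem_right hI h, if_neg p.2.1.ne])
      refine (h1.image fun p => (ε p).1).subset ?_
      rintro k ⟨hk, hne⟩
      exact ⟨ε.symm ⟨k, hk⟩, hne, by simp⟩
    let y : ℕ →₀ K := Finsupp.ofSupportFinite (fun k => if hk : (k : ℕ∞) < nInv σ then
      ent v (ε.symm ⟨k, hk⟩).1.1 (ε.symm ⟨k, hk⟩).1.2 else 0) (hS.subset fun k hk => by
        by_cases h : (k : ℕ∞) < nInv σ
        · exact ⟨h, by simpa [h] using hk⟩
        · simp [h] at hk)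
    refine ⟨⟨y, fun i hi => dif_neg hi.not_gt⟩, hux_eq _ v hv fun p => ?_⟩
    show _ = y (ε p).1
    have hp : ((ε p).1 : ℕ∞) < nInv σ := (ε p).2
    have hp' : ε.symm ⟨(ε p).1, hp⟩ = p := ε.symm_apply_apply p
    rw [show y (ε p).1 = ent v (ε.symm ⟨(ε p).1, hp⟩).1.1 (ε.symm ⟨(ε p).1, hp⟩).1.2 from dif_pos hp,
      hp']
  have hFbij : Function.Bijective F := by
    constructor
    · intro x y hxy
      have h1 : u x = u y := (hu x).eq_of_act_eq (hu y)
        (congrArg (fun z => (z.1.1 : Set (Submodule K V))) hxy)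
      refine Subtype.ext (Finsupp.ext fun k => ?_)
      by_cases hk : (k : ℕ∞) < nInv σ
      · rw [hcoord x k hk, hcoord y k hk, h1]
      · rw [x.2 k (not_lt.1 hk), y.2 k (not_lt.1 hk)]
    · rintro ⟨z, hz⟩
      obtain ⟨n, hn⟩ := exists_mem_flPiece hE hEι z
      obtain ⟨_, v, _, hv, hvz⟩ := exists_isUni_of_mem_flPiece hσ₀ hσ hz hn
      obtain ⟨x, rfl⟩ := hsurj v hv
      exact ⟨x, Subtype.ext (Subtype.ext hvz.symm)⟩
  let f := Equiv.ofBijective F hFbij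
  have hpt : ∀ n (z : cellIn b σ₀ (flagStabilizer b (maxFlag b)) σ), z.1 ∈ flPiece b σ₀ (E n) →
      u (f.symm z) ∈ glPiece b (E n) ∧ z.1.1 = act (u (f.symm z)).1 (flagOf b σ) := by
    intro n z hz
    obtain ⟨_, v, hvn, hv, hvz⟩ := exists_isUni_of_mem_flPiece hσ₀ hσ z.2 hz
    have h1 : z.1.1 = act (u (f.symm z)).1 (flagOf b σ) :=
      (congrArg (fun z => (z.1.1 : Set (Submodule K V))) (f.apply_symm_apply z)).symm
    exact ⟨(hv.eq_of_act_eq (hu _) (hvz.symm.trans h1)) ▸ hvn, h1⟩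
  refine ⟨f.symm, fun n => ?_, fun n => ?_⟩
  · -- from the cell to the affine space
    let X := {z : cellIn b σ₀ (flagStabilizer b (maxFlag b)) σ // z.1 ∈ flPiece b σ₀ (E n)}
    obtain ⟨m, hm⟩ : ∃ m, ∀ p : invSet σ, p.1.1 ∈ E n → p.1.2 ∈ E n → (ε p).1 < m := by
      have hfin : {p : invSet σ | p.1.1 ∈ E n ∧ p.1.2 ∈ E n}.Finite := by
        refine Set.Finite.of_finite_image (f := Subtype.val)
          ((E n ×ˢ E n).finite_toSet.subset ?_) Subtype.val_injective.injOn
        rintro _ ⟨p, hp, rfl⟩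
        exact Finset.mem_coe.2 (Finset.mem_product.2 hp)
      obtain ⟨M, hM⟩ := (hfin.image fun p => (ε p).1).bddAbove
      exact ⟨M + 1, fun p h1 h2 => Nat.lt_succ_of_le (hM ⟨p, ⟨h1, h2⟩, rfl⟩)⟩
    have hzero : ∀ z : cellIn b σ₀ (flagStabilizer b (maxFlag b)) σ, z.1 ∈ flPiece b σ₀ (E n) →
        ∀ p : invSet σ, ¬ (p.1.1 ∈ E n ∧ p.1.2 ∈ E n) → (f.symm z).1 (ε p).1 = 0 := by
      intro z hz p hp
      rw [← hux]
      by_cases h : p.1.1 ∈ E n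
      · rw [ent_of_notMem_right (hpt n z hz).1 (fun h' => hp ⟨h, h'⟩), if_neg p.2.1.ne]
      · rw [ent_of_notMem_left (hpt n z hz).1 h, if_neg p.2.1.ne]
    refine ⟨m, fun z hz k hk => ?_, ?_⟩
    · by_cases hkN : (k : ℕ∞) < nInv σ
      · have h1 := hzero z hz (ε.symm ⟨k, hkN⟩)
        rw [Equiv.apply_symm_apply] at h1
        refine h1 fun h2 => ?_
        have := hm _ h2.1 h2.2
        rw [Equiv.apply_symm_apply] at this
        exact this.not_ge hk
      · exact (f.symm z).2 k (not_lt.1 hkN)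
    -- If the cell misses this piece the map has empty domain, and `W = ∅` suffices. Otherwise a
    -- point of the cell supplies a permutation `w` supported on `E n` with `w · σ₀ = σ`.
    · by_cases hne : Nonempty X
      swap
      · refine isMor_of_induced (flInd_str_isOpen_iff hσ₀) (flInd_str_isReg_iff hσ₀)
          (W := ∅) (H := fun _ _ => 0) ?_ (fun k => ?_) (fun y => (hne ⟨y⟩).elim)
          fun y => (hne ⟨y⟩).elim
        · exact @isOpen_empty _ (zariski (entCoord b (E n))).top
        · exact zariski_isReg_of_polyFun (const_mem_polyFun _ 0)
      obtain ⟨z₀⟩ := hne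
      obtain ⟨⟨w, hw, hwσ⟩, _⟩ := exists_isUni_of_mem_flPiece hσ₀ hσ z₀.1.2 z₀.2
      have hw' : ∀ i ∉ E n, (w⁻¹).1 i = i := fun i hi => Equiv.Perm.inv_eq_iff_eq.2 (hw i hi).symm
      -- Right translation by `w⁻¹` rewrites `gF_{σ₀}` as a translate of `F_σ`, to which the chart
      -- of `σ` applies.
      have hT : ∀ g : glPiece b (E n), g.1 * permGL b w⁻¹ ∈ glPiece b (E n) := fun g =>
        (glSub b (E n)).mul_mem g.2 (permGL_mem_glPiece hw')
      have hTact : ∀ g : glPiece b (E n), act (g.1 * permGL b w⁻¹).1 (flagOf b σ) =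
          act g.1.1 (flagOf b σ₀) := fun g => by
        rw [act_mul_permGL, wact_inv_of_eq hwσ]
      have hfac : ∀ g h : glPiece b (E n), orbPiece b hσ₀ (E n) g = orbPiece b hσ₀ (E n) h →
          ∀ {j : ι} (hj : j ∈ E n), ∃ d : K,
          (minorMat (E n) σ (σ j) (h.1 * permGL b w⁻¹)).det =
            (minorMat (E n) σ (σ j) (g.1 * permGL b w⁻¹)).det * d ∧
          ∀ i, chartNum σ i hj (h.1 * permGL b w⁻¹) = chartNum σ i hj (g.1 * permGL b w⁻¹) * d := by
        intro g h hgh j hj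
        refine exists_chart_factor (hT g) (hT h) ?_ hj
        rw [hTact, hTact]
        exact congrArg (fun z => (z.1.1 : Set (Submodule K V))) hgh
      -- A set-theoretic section defines the chart functions on flags; no regularity of `s` is
      -- needed, since by `hfac` another representative changes numerator and denominator by the
      -- same factor.
      choose s hs using orbPiece_surjective (b := b) hσ₀ (E n)
      let W : Set (flPiece b σ₀ (E n)) := {z | ∀ j ∈ E n,
        (minorMat (E n) σ (σ j) ((s z).1 * permGL b w⁻¹)).det ≠ 0}
      let H : ℕ → flPiece b σ₀ (E n) → K := fun k z =>
        if h : ∃ hk : (k : ℕ∞) < nInv σ, (ε.symm ⟨k, hk⟩).1.2 ∈ E n then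
          chartNum σ (ε.symm ⟨k, h.1⟩).1.1 h.2 ((s z).1 * permGL b w⁻¹) *
            (minorMat (E n) σ (σ (ε.symm ⟨k, h.1⟩).1.2) ((s z).1 * permGL b w⁻¹)).det⁻¹
        else 0
      have hWpre : orbPiece b hσ₀ (E n) ⁻¹' W = ⋂ j ∈ E n, {g : glPiece b (E n) |
          (minorMat (E n) σ (σ j) (g.1 * permGL b w⁻¹)).det ≠ 0} := by
        ext g
        simp only [Set.mem_iInter]
        refine forall₂_congr fun j hj => not_congr ⟨fun h0 => ?_, fun h0 => ?_⟩
        · obtain ⟨d, hd, _⟩ := hfac _ _ (hs (orbPiece b hσ₀ (E n) g)) hj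
          rw [hd, h0, zero_mul]
        · obtain ⟨d, hd, _⟩ := hfac _ _ (hs (orbPiece b hσ₀ (E n) g)).symm hj
          rw [hd, h0, zero_mul]
      -- On the cell the representative is compared with the unipotent one, whose minors are one. So
      -- the determinant is a nonzero `d` and the quotient is a matrix entry of `u`.
      have hdetW : ∀ z : X, ∀ {j : ι} (hj : j ∈ E n), ∃ d : K, d ≠ 0 ∧
          (minorMat (E n) σ (σ j) ((s ⟨z.1.1, z.2⟩).1 * permGL b w⁻¹)).det = d ∧
          ∀ i, chartNum σ i hj ((s ⟨z.1.1, z.2⟩).1 * permGL b w⁻¹) =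
            ent (u (f.symm z.1)) i j * d := by
        intro z j hj
        obtain ⟨hun, huz⟩ := hpt n z.1 z.2
        have hact : act (u (f.symm z.1)).1 (flagOf b σ) =
            act ((s ⟨z.1.1, z.2⟩).1 * permGL b w⁻¹).1 (flagOf b σ) := by
          rw [hTact, ← huz]
          exact (congrArg (fun z => (z.1.1 : Set (Submodule K V))) (hs ⟨z.1.1, z.2⟩)).symm
        obtain ⟨d, hd, hc⟩ := exists_chart_factor hun (hT _) hact hj
        obtain ⟨d', hd', _⟩ := exists_chart_factor (hT _) hun hact.symm hj
        rw [(hu _).det_minorMat, one_mul] at hd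
        rw [(hu _).det_minorMat, hd] at hd'
        refine ⟨d, fun h0 => ?_, hd, fun i => by rw [hc, (hu _).chartNum_eq]⟩
        rw [h0, zero_mul] at hd'
        exact one_ne_zero hd'
      have hWopen : IsOpen[(zariski (entCoord b (E n))).top] (orbPiece b hσ₀ (E n) ⁻¹' W) := by
        let _ := (zariski (entCoord b (E n))).top
        rw [hWpre]
        exact isOpen_biInter_finset fun j _ =>
          isOpen_ne_zariski (det_mem_polyFun (minorMat_mem_polyFun w⁻¹ σ (σ j)))
      have hHreg : ∀ k, (zariski (entCoord b (E n))).IsReg (orbPiece b hσ₀ (E n) ⁻¹' W)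
          (H k ∘ orbPiece b hσ₀ (E n)) := by
        intro k
        by_cases h : ∃ hk : (k : ℕ∞) < nInv σ, (ε.symm ⟨k, hk⟩).1.2 ∈ E n
        · have h1 : (zariski (entCoord b (E n))).IsReg (orbPiece b hσ₀ (E n) ⁻¹' W) fun g =>
              chartNum σ (ε.symm ⟨k, h.1⟩).1.1 h.2 (g.1 * permGL b w⁻¹) *
              (minorMat (E n) σ (σ (ε.symm ⟨k, h.1⟩).1.2) (g.1 * permGL b w⁻¹)).det⁻¹ := by
            refine zariski_isReg_mul (zariski_isReg_of_polyFun (chartNum_mem_polyFun _ _ _ _))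
              (zariski_isReg_inv (zariski_isReg_of_polyFun
                (det_mem_polyFun (minorMat_mem_polyFun w⁻¹ σ _))) fun g hg => ?_)
            rw [hWpre] at hg
            exact Set.mem_iInter₂.1 hg _ h.2
          refine zariski_isReg_congr h1 fun g hg => ?_
          show H k (orbPiece b hσ₀ (E n) g) = _
          have hg' := Set.mem_iInter₂.1 (hWpre ▸ hg) _ h.2
          obtain ⟨d, hd, hc⟩ := hfac _ _ (hs (orbPiece b hσ₀ (E n) g)) h.2
          have hg'' : (minorMat (E n) σ (σ (ε.symm ⟨k, h.1⟩).1.2) (g.1 * permGL b w⁻¹)).det ≠ 0 :=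
            hg'
          rw [hd] at hg''
          have hd0 := right_ne_zero_of_mul hg''
          rw [show H k (orbPiece b hσ₀ (E n) g) = _ from dif_pos h, hd, hc]
          field_simp
        · have h1 : H k ∘ orbPiece b hσ₀ (E n) = fun _ => 0 := funext fun g => dif_neg h
          rw [h1]
          exact zariski_isReg_of_polyFun (const_mem_polyFun _ 0)
      refine isMor_of_induced (flInd_str_isOpen_iff hσ₀) (flInd_str_isReg_iff hσ₀)
        (W := W) (H := H) hWopen hHreg (fun z j hj => ?_) fun z k => ?_
      · obtain ⟨d, hd0, hd, _⟩ := hdetW z hj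
        exact fun h0 => hd0 (hd.symm.trans h0)
      · show (f.symm z.1).1 k = H k ⟨z.1.1, z.2⟩
        by_cases h : ∃ hk : (k : ℕ∞) < nInv σ, (ε.symm ⟨k, hk⟩).1.2 ∈ E n
        · obtain ⟨d, hd0, hd, hc⟩ := hdetW z h.2
          rw [show H k ⟨z.1.1, z.2⟩ = _ from dif_pos h, hd, hc, hcoord _ k h.1, mul_assoc,
            mul_inv_cancel₀ hd0, mul_one]
        · rw [show H k ⟨z.1.1, z.2⟩ = 0 from dif_neg h]
          by_cases hkN : (k : ℕ∞) < nInv σ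
          · have h1 := hzero z.1 z.2 (ε.symm ⟨k, hkN⟩)
            rw [Equiv.apply_symm_apply] at h1
            exact h1 fun h2 => h ⟨hkN, h2.2⟩
          · exact (f.symm z.1).2 k (not_lt.1 hkN)
  · -- from the affine space to the cell
    obtain ⟨w, hwσ⟩ := hσ
    obtain ⟨m₀, hm₀⟩ := hbound n
    obtain ⟨m, hmm, hw⟩ := exists_support_subset hE hEι w m₀
    -- The lift to the group is `u x · w`, whose entries are constants or single coordinates of `x`;
    -- `m` is chosen to contain both the bounded inversions and the support of `w`.
    have hum : ∀ x ∈ (affineInd K (nInv σ)).piece n, u x * permGL b w ∈ glPiece b (E m) := by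
      intro x hx
      refine (glSub b (E m)).mul_mem (glPiece_mono (hE hmm) (mem_glPiece_of_ent ?_ ?_))
        (permGL_mem_glPiece hw)
      · intro i j hne hij
        rw [huc x i j hij] at hne
        have := hm₀ x hx i j hne
        exact ⟨this.1, this.2.1⟩
      · exact fun i _ => (hu x).1 i
    have hact : ∀ x, act (u x * permGL b w).1 (flagOf b σ₀) = act (u x).1 (flagOf b σ) := fun x => by
      rw [act_mul_permGL]
      exact congrArg (fun ρ => act (u x).1 (flagOf b ρ)) hwσ
    refine ⟨m, fun x hx => mem_flPiece_iff.2 ⟨_, hum x hx, (hact x).symm⟩, ?_⟩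
    refine isMor_induced_of_lift (flInd_isMor_orbPiece hσ₀ E m)
      (ψ := fun x => ⟨u x.1 * permGL b w, hum x.1 x.2⟩) ?_ fun x => by
        refine Subtype.ext (Subtype.ext ?_)
        exact (hact x.1).symm
    rintro ⟨i, j⟩
    show (fun x : (affineInd K (nInv σ)).piece n => ent (u x.1 * permGL b w) i j) ∈ _
    simp only [ent_mul_permGL]
    by_cases hij : i = w.1 j
    · have : (fun x : (affineInd K (nInv σ)).piece n => ent (u x.1) i (w.1 j)) = fun _ => 1 :=
        funext fun x => by rw [← hij]; exact (hu x.1).1 i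
      rw [this]
      exact const_mem_polyFun _ 1
    · simp only [huc _ _ _ hij]
      by_cases hinv : (i, w.1 j) ∈ invSet σ
      · have : (fun x : (affineInd K (nInv σ)).piece n => c x.1 i (w.1 j)) =
            fun x => x.1.1 (ε ⟨_, hinv⟩).1 := funext fun x => dif_pos hinv
        rw [this]
        exact coord_mem_polyFun (fun (x : (affineInd K (nInv σ)).piece n) (i : ℕ) => x.1.1 i) _
      · have : (fun x : (affineInd K (nInv σ)).piece n => c x.1 i (w.1 j)) =
            fun x => 0 := funext fun x => dif_neg hinv
        rw [this]
        exact const_mem_polyFun _ 0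

end Cell

/-! ## Solvable connected matrix groups containing the diagonal torus -/

/-- With finitely many closed fibres each fibre is also open, so on a connected space there is only
one. The topology on the group need not make it a topological group. -/
theorem eq_of_finite_range {G X : Type*} [TopologicalSpace G] [PreconnectedSpace G] {F : G → X}
    (hfin : (Set.range F).Finite) (hcl : ∀ x, IsClosed {g | F g = x}) (g h : G) : F g = F h := by
  have hclopen : IsClopen {k | F k = F h} := by
    refine ⟨hcl _, ?_⟩
    have h1 : {k | F k = F h}ᶜ = ⋃ x ∈ Set.range F \ {F h}, {k | F k = x} := by
      ext k
      simp only [Set.mem_compl_iff, Set.mem_ofPred_eq, Set.mem_iUnion]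
      exact ⟨fun hk => ⟨F k, ⟨⟨k, rfl⟩, hk⟩, rfl⟩, fun ⟨x, hx, hkx⟩ => by rw [hkx]; exact hx.2⟩
    rw [← isClosed_compl_iff, h1]
    exact (hfin.subset Set.sdiff_subset).isClosed_biUnion fun x _ => hcl x
  have : g ∈ {k | F k = F h} := by
    rw [hclopen.eq_univ ⟨h, rfl⟩]
    trivial
  exact this

theorem finite_pow_card_eq_one (K : Type*) [Field K] (C : Type*) [Fintype C] [Nonempty C] : {c : K | c ^ Fintype.card C = 1}.Finite := by
  refine (Polynomial.nthRootsFinset (Fintype.card C) (1 : K)).finite_toSet.subset fun c hc => ?_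
  exact (Polynomial.mem_nthRootsFinset Fintype.card_pos 1).2 hc

section LieKolchin

open scoped commutatorElement

variable {K : Type*} [Field K] {C : Type*} [Fintype C] [DecidableEq C] {G : Type*} [Group G]
  (ρ : G →* Matrix C C K)

/-- `N` acts by scalar matrices. -/
def ActsByScalars (N : Subgroup G) : Prop := ∀ a ∈ N, ∃ c : K, ρ a = c • 1

variable {ρ}

theorem exists_row_ne_zero [Nonempty C] (g : G) (k : C) : ∃ l, ρ g k l ≠ 0 := by
  by_contra! h
  have h1 : (ρ g * ρ g⁻¹) k k = 1 := by
    rw [← map_mul, mul_inv_cancel, map_one, Matrix.one_apply_eq]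
  rw [Matrix.mul_apply, Finset.sum_eq_zero fun l _ => by rw [h l, zero_mul]] at h1
  exact zero_ne_one h1

theorem conj_mem_span {N : Subgroup G} [hN : N.Normal] (g : G) {X : Matrix C C K}
    (hX : X ∈ Submodule.span K (ρ '' N)) : ρ g * X * ρ g⁻¹ ∈ Submodule.span K (ρ '' N) := by
  induction hX using Submodule.span_induction with
  | mem x hx =>
    obtain ⟨a, ha, rfl⟩ := hx
    rw [← map_mul, ← map_mul]
    exact Submodule.subset_span ⟨_, hN.conj_mem a ha g, rfl⟩
  | zero => simp
  | add x y _ _ hx hy =>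
    rw [mul_add, add_mul]
    exact add_mem hx hy
  | smul c x _ hx =>
    rw [Matrix.mul_smul, Matrix.smul_mul]
    exact Submodule.smul_mem _ c hx

theorem commute_of_mem_span {S : Set (Matrix C C K)} (hS : ∀ a ∈ S, ∀ b ∈ S, a * b = b * a)
    {X Y : Matrix C C K} (hX : X ∈ Submodule.span K S) (hY : Y ∈ Submodule.span K S) :
    X * Y = Y * X := by
  induction hX, hY using Submodule.span_induction₂ with
  | mem_mem x y hx hy => exact hS x hx y hy
  | zero_left y hy => simp
  | zero_right x hx => simp
  | add_left x y z _ _ _ h1 h2 => rw [add_mul, mul_add, h1, h2]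
  | add_right x y z _ _ _ h1 h2 => rw [add_mul, mul_add, h1, h2]
  | smul_left r x y _ _ h => rw [Matrix.smul_mul, Matrix.mul_smul, h]
  | smul_right r x y _ _ h => rw [Matrix.smul_mul, Matrix.mul_smul, h]

/-- Conjugation by a one-parameter diagonal matrix rescales a row and a column. -/
theorem exists_conj_mem_span {N : Subgroup G} [hN : N.Normal]
    (htorus : ∀ d : C → K, (∀ i, d i ≠ 0) → ∃ g, ρ g = Matrix.diagonal d) (i : C) {s : K}
    (hs : s ≠ 0) {X : Matrix C C K} (hX : X ∈ Submodule.span K (ρ '' N)) :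
    (Matrix.of fun k l => (if k = i then s else 1) * X k l * (if l = i then s⁻¹ else 1)) ∈
      Submodule.span K (ρ '' N) := by
  obtain ⟨g, hg⟩ := htorus (fun k => if k = i then s else 1) fun k => by
    split_ifs
    exacts [hs, one_ne_zero]
  have hginv : ρ g⁻¹ = Matrix.diagonal fun k => if k = i then s⁻¹ else 1 := by
    have h1 : ρ g⁻¹ * ρ g = 1 := by rw [← map_mul, inv_mul_cancel, map_one]
    have h2 : ρ g * (Matrix.diagonal fun k => if k = i then s⁻¹ else 1) = 1 := by
      rw [hg, Matrix.diagonal_mul_diagonal, ← Matrix.diagonal_one]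
      congr 1
      funext k
      split_ifs
      · exact mul_inv_cancel₀ hs
      · exact mul_one _
    exact left_inv_eq_right_inv h1 h2
  have := conj_mem_span (N := N) g hX
  rw [hg, hginv] at this
  convert this using 1
  ext k l
  simp [Matrix.diagonal_mul, Matrix.mul_diagonal]

/-- A commutator that is scalar has determinant one. -/
theorem pow_card_of_commutator {a b : G} {c : K} (h : ρ ⁅a, b⁆ = c • 1) :
    c ^ Fintype.card C = 1 := by
  have h1 : (ρ ⁅a, b⁆).det = 1 := by
    have h2 : ((Matrix.detMonoidHom.comp ρ : G →* K)) ⁅a, b⁆ = 1 := by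
      have hu : ∀ g, (Matrix.detMonoidHom.comp ρ : G →* K) g *
          (Matrix.detMonoidHom.comp ρ : G →* K) g⁻¹ = 1 := fun g => by
        rw [← map_mul, mul_inv_cancel, map_one]
      rw [commutatorElement_def, map_mul, map_mul, map_mul]
      linear_combination (Matrix.detMonoidHom.comp ρ : G →* K) b *
        (Matrix.detMonoidHom.comp ρ : G →* K) b⁻¹ * hu a + hu b
    exact h2
  rw [h, Matrix.det_smul, Matrix.det_one, mul_one] at h1
  exact h1

/-- If the commutators of a family with a fixed element are scalar, they are constant. -/
theorem commutator_eq_of_scalar [TopologicalSpace G] [PreconnectedSpace G]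
    {P : G → Matrix C C K} {Q : G → Matrix C C K} {x : G → G} {y : G}
    (hcl : ∀ c : K, IsClosed {g | P g = c • Q g})
    (hPQ : ∀ g (c : K), ρ ⁅x g, y⁆ = c • 1 ↔ P g = c • Q g)
    (hsc : ∀ g, ∃ c : K, ρ ⁅x g, y⁆ = c • 1) (g h : G) : ρ ⁅x g, y⁆ = ρ ⁅x h, y⁆ := by
  rcases isEmpty_or_nonempty C with hC | hC
  · exact Subsingleton.elim _ _
  refine eq_of_finite_range (F := fun g => ρ ⁅x g, y⁆) ?_ ?_ g h
  · refine ((finite_pow_card_eq_one K C).image fun c => c • (1 : Matrix C C K)).subset ?_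
    rintro _ ⟨g, rfl⟩
    obtain ⟨c, hc⟩ := hsc g
    exact ⟨c, pow_card_of_commutator hc, hc.symm⟩
  · intro M
    by_cases hM : ∃ c : K, M = c • 1
    · obtain ⟨c, rfl⟩ := hM
      simp only [hPQ]
      exact hcl c
    · convert isClosed_empty (X := G) using 1
      refine Set.eq_empty_of_forall_notMem fun g hg => hM ?_
      obtain ⟨c, hc⟩ := hsc g
      exact ⟨c, hg.symm.trans hc⟩

theorem isClosed_eq_smul [TopologicalSpace G]
    (hcl : ∀ f ∈ polyFun (fun (g : G) (p : C × C) => ρ g p.1 p.2), IsClosed {g | f g = 0})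
    {P Q : G → Matrix C C K}
    (hP : ∀ i j, (fun g => P g i j) ∈ polyFun (fun (g : G) (p : C × C) => ρ g p.1 p.2))
    (hQ : ∀ i j, (fun g => Q g i j) ∈ polyFun (fun (g : G) (p : C × C) => ρ g p.1 p.2)) (c : K) :
    IsClosed {g | P g = c • Q g} := by
  have : {g | P g = c • Q g} = ⋂ i, ⋂ j, {g | P g i j - c * Q g i j = 0} := by
    ext g
    simp only [Set.mem_iInter, Set.mem_ofPred_eq, sub_eq_zero, ← Matrix.ext_iff, Matrix.smul_apply,
      smul_eq_mul]
  rw [this]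
  exact isClosed_iInter fun i => isClosed_iInter fun j =>
    hcl _ (sub_mem_polyFun (hP i j) (mul_mem_polyFun (const_mem_polyFun _ c) (hQ i j)))

/-- A scalar commutator has determinant one, so it takes finitely many values; by connectedness it
is the value at `g = 1`, which is trivial. -/
theorem commute_of_commutator_scalar [TopologicalSpace G] [PreconnectedSpace G]
    (hcl : ∀ f ∈ polyFun (fun (g : G) (p : C × C) => ρ g p.1 p.2), IsClosed {g | f g = 0})
    {a : G} (hsc : ∀ g : G, ∃ c : K, ρ ⁅g, a⁆ = c • 1) (g : G) : ρ g * ρ a = ρ a * ρ g := by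
  have hc : ∀ i j, (fun g => ρ g i j) ∈ polyFun (fun (g : G) (p : C × C) => ρ g p.1 p.2) :=
    fun i j => coord_mem_polyFun (fun (g : G) (p : C × C) => ρ g p.1 p.2) (i, j)
  have hk : ∀ i j, (fun _ : G => ρ a i j) ∈ polyFun (fun (g : G) (p : C × C) => ρ g p.1 p.2) :=
    fun i j => const_mem_polyFun _ _
  have h1 := commutator_eq_of_scalar (x := id) (y := a) (P := fun g => ρ g * ρ a)
    (Q := fun g => ρ a * ρ g)
    (isClosed_eq_smul hcl (matrix_mul_mem_polyFun hc hk) (matrix_mul_mem_polyFun hk hc))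
    (fun g c => ?_) hsc g 1
  · have h2 : ρ ⁅g, a⁆ = 1 := by
      rw [show ρ ⁅g, a⁆ = _ from h1]
      simp
    have h3 : g * a = ⁅g, a⁆ * (a * g) := by
      rw [commutatorElement_def]
      group
    rw [← map_mul, h3, map_mul, h2, one_mul, map_mul]
  · have h3 : g * a = ⁅g, a⁆ * (a * g) := by
      rw [commutatorElement_def]
      group
    constructor
    · intro h
      show ρ g * ρ a = c • (ρ a * ρ g)
      rw [← map_mul, h3, map_mul, show ρ ⁅g, a⁆ = _ from h, Matrix.smul_mul, one_mul, map_mul]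
    · intro h
      have h4 : ρ ⁅g, a⁆ * ρ (a * g) = (c • 1) * ρ (a * g) := by
        rw [← map_mul, ← h3, map_mul, Matrix.smul_mul, one_mul, map_mul]
        exact h
      have h5 := congrArg (· * ρ (a * g)⁻¹) h4
      show ρ ⁅g, a⁆ = c • 1
      simpa only [mul_assoc, ← map_mul, mul_inv_cancel, map_one, mul_one] using h5

variable [CharZero K]

/-- The span is stable under conjugation by the torus, so it contains the weight components of its
elements; explicit combinations of few conjugates project to them in characteristic zero. -/
theorem single_mem_span {N : Subgroup G} [hN : N.Normal]
    (htorus : ∀ d : C → K, (∀ i, d i ≠ 0) → ∃ g, ρ g = Matrix.diagonal d) {i j : C} (hij : i ≠ j)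
    {X : Matrix C C K} (hX : X ∈ Submodule.span K (ρ '' N)) :
    X i j • Matrix.single i j 1 ∈ Submodule.span K (ρ '' N) := by
  have h2 : (2 : K) ≠ 0 := two_ne_zero
  have h3 : (3 : K) ≠ 0 := three_ne_zero
  have hm : (-1 : K) ≠ 0 := neg_ne_zero.2 one_ne_zero
  have e1 := exists_conj_mem_span htorus i hm hX
  have e2 := exists_conj_mem_span htorus i h2 hX
  let R : Matrix C C K := Matrix.of fun k l => if k = i ∧ l ≠ i then X k l else 0
  have hR : R ∈ Submodule.span K (ρ '' N) := by
    -- Conjugation scaling index `i` by `s` multiplies entries of row `i` by `s`, of column `i` by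
    -- `s⁻¹` and the rest by one. The weights `-1/2`, `-1/6`, `2/3` at `s = 1, -1, 2` give `1`, `0`,
    -- `0` on these three types.
    have : R = (-(1 / 2) : K) • X + (-(1 / 6) : K) • (Matrix.of fun k l =>
        (if k = i then -1 else 1) * X k l * (if l = i then (-1 : K)⁻¹ else 1)) +
        (2 / 3 : K) • (Matrix.of fun k l =>
          (if k = i then 2 else 1) * X k l * (if l = i then (2 : K)⁻¹ else 1)) := by
      ext k l
      simp only [R, Matrix.add_apply, Matrix.smul_apply, Matrix.of_apply, smul_eq_mul]
      by_cases hk : k = i <;> by_cases hl : l = i <;> simp only [hk, hl, if_true, if_false,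
        ne_eq, not_true, not_false_iff, and_true, and_false] <;> norm_num <;> ring
    rw [this]
    exact add_mem (add_mem (Submodule.smul_mem _ _ hX) (Submodule.smul_mem _ _ e1))
      (Submodule.smul_mem _ _ e2)
  -- Within the single row `R`, changing the sign of index `j` negates only the entry at `(i, j)`;
  -- half the difference isolates it.
  have : X i j • Matrix.single i j (1 : K) = (1 / 2 : K) • R + (-(1 / 2) : K) • (Matrix.of fun k l =>
        (if k = j then -1 else 1) * R k l * (if l = j then (-1 : K)⁻¹ else 1)) := by
    ext k l
    simp only [R, Matrix.add_apply, Matrix.smul_apply, Matrix.of_apply, smul_eq_mul,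
      Matrix.single_apply]
    by_cases hk : k = i <;> by_cases hl : l = j
    · subst hk hl
      simp [hij, hij.symm]
      ring
    · subst hk
      simp [hij, hl, Ne.symm hl]
      split_ifs <;> simp
    · simp [hk, Ne.symm hk]
    · simp [hk, Ne.symm hk]
  rw [this]
  exact add_mem (Submodule.smul_mem _ _ hR)
    (Submodule.smul_mem _ _ (exists_conj_mem_span htorus j hm hR))

variable [TopologicalSpace G] [PreconnectedSpace G]

/-- A nonzero off-diagonal entry would put an elementary matrix in the span, and this cannot commute
with all its conjugates when no entry of the group vanishes identically. So `N` acts diagonally.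
Conjugation then permutes eigenvalues, by connectedness it fixes them, and a nonzero entry at `(k,
i)` equates the `k`-th and `i`-th ones. -/
theorem actsByScalars_of_commute
    (hcl : ∀ f ∈ polyFun (fun (g : G) (p : C × C) => ρ g p.1 p.2), IsClosed {g | f g = 0})
    (htorus : ∀ d : C → K, (∀ i, d i ≠ 0) → ∃ g, ρ g = Matrix.diagonal d)
    (hirr : ∀ k l, ∃ g, ρ g k l ≠ 0) {N : Subgroup G} [hN : N.Normal]
    (hcomm : ∀ a ∈ N, ∀ b ∈ N, ρ a * ρ b = ρ b * ρ a) : ActsByScalars ρ N := by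
  rcases isEmpty_or_nonempty C with hC | hC
  · exact fun a _ => ⟨1, Subsingleton.elim _ _⟩
  have hdiag : ∀ a ∈ N, ∀ i j, i ≠ j → ρ a i j = 0 := by
    intro a ha i j hij
    by_contra hne
    have hE : Matrix.single i j (1 : K) ∈ Submodule.span K (ρ '' N) := by
      have h1 := single_mem_span htorus hij
        (Submodule.subset_span (R := K) (show ρ a ∈ ρ '' N from ⟨a, ha, rfl⟩))
      have h2 := Submodule.smul_mem _ (ρ a i j)⁻¹ h1
      rwa [smul_smul, inv_mul_cancel₀ hne, one_smul] at h2
    obtain ⟨g, hg⟩ := hirr j i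
    have hsp : ∀ (M : Matrix C C K), Matrix.single i j (1 : K) * M * Matrix.single i j (1 : K) =
        M j i • Matrix.single i j (1 : K) := by
      intro M
      rw [Matrix.single_mul_mul_single, one_mul, mul_one, Matrix.smul_single, smul_eq_mul, mul_one]
    have hinv : ρ g⁻¹ * ρ g = 1 := by rw [← map_mul, inv_mul_cancel, map_one]
    have hc : Matrix.single i j (1 : K) * (ρ g * Matrix.single i j (1 : K) * ρ g⁻¹) =
        (ρ g * Matrix.single i j (1 : K) * ρ g⁻¹) * Matrix.single i j (1 : K) := by
      refine commute_of_mem_span ?_ hE (conj_mem_span g hE)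
      rintro _ ⟨x, hx, rfl⟩ _ ⟨y, hy, rfl⟩
      exact hcomm x hx y hy
    -- Multiplying this relation by the elementary matrix, whose square is zero, forces the `(j, i)`
    -- entry of `g⁻¹` to vanish; the relation itself then contradicts `g j i ≠ 0`.
    have h1 : ρ g j i • Matrix.single i j (1 : K) =
        ρ g⁻¹ j i • (ρ g * Matrix.single i j (1 : K) * ρ g) := by
      calc ρ g j i • Matrix.single i j (1 : K)
          = (Matrix.single i j (1 : K) * ρ g * Matrix.single i j (1 : K)) * (ρ g⁻¹ * ρ g) := by
            rw [hinv, mul_one, hsp]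
        _ = (Matrix.single i j (1 : K) * (ρ g * Matrix.single i j (1 : K) * ρ g⁻¹)) * ρ g := by
            simp only [Matrix.mul_assoc]
        _ = ρ g * (Matrix.single i j (1 : K) * ρ g⁻¹ * Matrix.single i j (1 : K)) * ρ g := by
            rw [hc]
            simp only [Matrix.mul_assoc]
        _ = _ := by rw [hsp, Matrix.mul_smul, Matrix.smul_mul]
    have hEE : Matrix.single i j (1 : K) * Matrix.single i j (1 : K) = 0 :=
      Matrix.single_mul_single_of_ne _ _ _ _ hij.symm _
    have h2 := congrArg (Matrix.single i j (1 : K) * ·) h1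
    simp only [Matrix.mul_smul, hEE, smul_zero] at h2
    rw [← Matrix.mul_assoc, ← Matrix.mul_assoc, hsp, Matrix.smul_mul, smul_smul] at h2
    have h3 : ρ g⁻¹ j i = 0 := by
      by_contra hne'
      have h4 := (smul_eq_zero.1 h2.symm).resolve_left (mul_ne_zero hne' hg)
      obtain ⟨l, hl⟩ := exists_row_ne_zero (ρ := ρ) g j
      have h5 := congrFun (congrFun h4 i) l
      rw [Matrix.single_mul_apply_same, one_mul] at h5
      exact hl h5
    rw [h3, zero_smul] at h1
    have h6 := congrFun (congrFun h1 i) j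
    rw [Matrix.smul_apply, Matrix.single_apply_same, smul_eq_mul, mul_one] at h6
    exact hg h6
  intro a ha
  have hrel : ∀ g k l, ρ g k l * ρ a l l = ρ (g * a * g⁻¹) k k * ρ g k l := by
    intro g k l
    have h1 : ρ g * ρ a = ρ (g * a * g⁻¹) * ρ g := by
      rw [← map_mul, ← map_mul, inv_mul_cancel_right]
    have h2 := congrFun (congrFun h1 k) l
    rw [Matrix.mul_apply, Matrix.mul_apply, Finset.sum_eq_single l, Finset.sum_eq_single k] at h2
    · exact h2
    · intro m _ hm
      rw [hdiag _ (hN.conj_mem a ha g) k m hm.symm, zero_mul]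
    · simp
    · intro m _ hm
      rw [hdiag a ha m l hm, mul_zero]
    · simp
  have hconst : ∀ k g, ρ (g * a * g⁻¹) k k = ρ a k k := by
    intro k g
    have h1 : ρ a k k = ρ (1 * a * 1⁻¹) k k := by simp
    rw [h1]
    have hval : ∀ g, ∃ l, ρ g k l ≠ 0 ∧ ρ (g * a * g⁻¹) k k = ρ a l l := by
      intro g
      obtain ⟨l, hl⟩ := exists_row_ne_zero (ρ := ρ) g k
      refine ⟨l, hl, mul_right_cancel₀ hl ?_⟩
      rw [← hrel, mul_comm]
    refine eq_of_finite_range (F := fun g => ρ (g * a * g⁻¹) k k) ?_ ?_ g 1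
    · refine (Set.finite_range fun l => ρ a l l).subset ?_
      rintro _ ⟨g, rfl⟩
      obtain ⟨l, _, hl⟩ := hval g
      exact ⟨l, hl.symm⟩
    · intro c
      have : {g | ρ (g * a * g⁻¹) k k = c} = ⋂ l, {g | ρ g k l * (ρ a l l - c) = 0} := by
        ext g
        simp only [Set.mem_iInter, Set.mem_ofPred_eq]
        constructor
        · intro h l
          rw [mul_sub, hrel, h]
          ring
        · intro h
          obtain ⟨l, hl, hl'⟩ := hval g
          rw [hl', ← sub_eq_zero]
          exact (mul_eq_zero.1 (h l)).resolve_left hl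
      rw [this]
      exact isClosed_iInter fun l => hcl _ (mul_mem_polyFun
        (coord_mem_polyFun (fun (g : G) (p : C × C) => ρ g p.1 p.2) (k, l)) (const_mem_polyFun _ _))
  obtain ⟨k⟩ := hC
  refine ⟨ρ a k k, Matrix.ext fun i j => ?_⟩
  by_cases hij : i = j
  · subst hij
    obtain ⟨g, hg⟩ := hirr k i
    have := hrel g k i
    rw [hconst, mul_comm] at this
    rw [Matrix.smul_apply, Matrix.one_apply_eq, smul_eq_mul, mul_one]
    exact mul_right_cancel₀ hg this
  · rw [hdiag a ha i j hij, Matrix.smul_apply, Matrix.one_apply_ne hij, smul_zero]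

/-- Scalar commutators have finite order, so the commutator of `g a g⁻¹` with `y` is independent of
`g`. Hence `[G, N]` centralizes `N` under `ρ`. It is therefore commutative and acts by scalars, and
then `N` commutes with all of `G` and acts by scalars too. -/
theorem actsByScalars_of_commutator
    (hcl : ∀ f ∈ polyFun (fun (g : G) (p : C × C) => ρ g p.1 p.2), IsClosed {g | f g = 0})
    (htorus : ∀ d : C → K, (∀ i, d i ≠ 0) → ∃ g, ρ g = Matrix.diagonal d)
    (hirr : ∀ k l, ∃ g, ρ g k l ≠ 0) {N : Subgroup G} [hN : N.Normal]
    (hsc : ActsByScalars ρ ⁅N, N⁆) : ActsByScalars ρ N := by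
  have hdet : ∀ g, (ρ g).det ≠ 0 := fun g h0 => by
    have h1 : (ρ g).det * (ρ g⁻¹).det = 1 := by
      rw [← Matrix.det_mul, ← map_mul, mul_inv_cancel, map_one, Matrix.det_one]
    rw [h0, zero_mul] at h1
    exact zero_ne_one h1
  have hadj : ∀ g, ρ g⁻¹ = (ρ g).det⁻¹ • (ρ g).adjugate := fun g => by
    have h1 : ρ g⁻¹ * ρ g = 1 := by rw [← map_mul, inv_mul_cancel, map_one]
    refine left_inv_eq_right_inv h1 ?_
    rw [Matrix.mul_smul, Matrix.mul_adjugate, smul_smul, inv_mul_cancel₀ (hdet g), one_smul]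
  have hc : ∀ i j, (fun g => ρ g i j) ∈ polyFun (fun (g : G) (p : C × C) => ρ g p.1 p.2) :=
    fun i j => coord_mem_polyFun (fun (g : G) (p : C × C) => ρ g p.1 p.2) (i, j)
  have hk : ∀ a i j, (fun _ : G => ρ a i j) ∈ polyFun (fun (g : G) (p : C × C) => ρ g p.1 p.2) :=
    fun a i j => const_mem_polyFun _ _
  -- commutators of conjugates
  have hconj : ∀ a ∈ N, ∀ y ∈ N, ∀ g, ρ ⁅g * a * g⁻¹, y⁆ = ρ ⁅a, y⁆ := by
    intro a ha y hy g
    have hR : ∀ i j, (fun g => (ρ g * ρ a * (ρ g).adjugate) i j) ∈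
        polyFun (fun (g : G) (p : C × C) => ρ g p.1 p.2) :=
      matrix_mul_mem_polyFun (matrix_mul_mem_polyFun hc (hk a)) (adjugate_mem_polyFun hc)
    -- The inverse of `ρ g` is replaced by the adjugate so that the condition is polynomial in the
    -- entries; the determinant cancels from both sides.
    have h1 := commutator_eq_of_scalar (ρ := ρ) (x := fun g => g * a * g⁻¹) (y := y)
      (P := fun g => (ρ g * ρ a * (ρ g).adjugate) * ρ y)
      (Q := fun g => ρ y * (ρ g * ρ a * (ρ g).adjugate))
      (isClosed_eq_smul hcl (matrix_mul_mem_polyFun hR (hk y)) (matrix_mul_mem_polyFun (hk y) hR))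
      (fun g c => ?_)
      (fun g => hsc _ (Subgroup.commutator_mem_commutator (hN.conj_mem a ha g) hy)) g 1
    · simpa using h1
    · set z := g * a * g⁻¹ with hz
      have h2 : ρ g * ρ a * (ρ g).adjugate = (ρ g).det • ρ z := by
        rw [hz, map_mul, map_mul, hadj, Matrix.mul_smul, smul_smul, mul_inv_cancel₀ (hdet g), one_smul]
      have h3 : z * y = ⁅z, y⁆ * (y * z) := by
        rw [commutatorElement_def]
        group
      show _ ↔ ρ g * ρ a * (ρ g).adjugate * ρ y = c • (ρ y * (ρ g * ρ a * (ρ g).adjugate))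
      rw [h2, Matrix.smul_mul, Matrix.mul_smul, smul_comm c,
        (smul_right_injective _ (hdet g)).eq_iff, ← map_mul, h3, map_mul, ← map_mul ρ y z]
      constructor
      · intro h
        rw [h, Matrix.smul_mul, one_mul]
      · intro h
        have h5 := congrArg (· * ρ (y * z)⁻¹) h
        simpa only [Matrix.smul_mul, mul_assoc, ← map_mul, mul_inv_cancel, map_one, mul_one] using h5
  have hcent : ∀ x ∈ ⁅(⊤ : Subgroup G), N⁆, ∀ y ∈ N, ρ x * ρ y = ρ y * ρ x := by
    intro x hx y hy
    have hle : ⁅(⊤ : Subgroup G), N⁆ ≤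
        { carrier := {x | ρ x * ρ y = ρ y * ρ x}
          one_mem' := by simp
          mul_mem' := fun {p q} hp hq => by
            show ρ (p * q) * ρ y = ρ y * ρ (p * q)
            rw [map_mul, mul_assoc, show ρ q * ρ y = _ from hq, ← mul_assoc,
              show ρ p * ρ y = _ from hp, mul_assoc]
          inv_mem' := fun {p} hp => by
            have hp' : ρ p * ρ y = ρ y * ρ p := hp
            have h1 : ρ p⁻¹ * ρ p = 1 := by rw [← map_mul, inv_mul_cancel, map_one]
            have h2 : ρ p * ρ p⁻¹ = 1 := by rw [← map_mul, mul_inv_cancel, map_one]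
            show ρ p⁻¹ * ρ y = ρ y * ρ p⁻¹
            calc ρ p⁻¹ * ρ y = ρ p⁻¹ * (ρ y * ρ p) * ρ p⁻¹ := by
                  rw [mul_assoc, mul_assoc, h2, mul_one]
              _ = ρ p⁻¹ * ρ p * ρ y * ρ p⁻¹ := by rw [← hp', mul_assoc, mul_assoc, mul_assoc, mul_assoc]
              _ = _ := by rw [h1, one_mul] } := by
      rw [Subgroup.commutator_le]
      intro g _ a ha
      show ρ ⁅g, a⁆ * ρ y = ρ y * ρ ⁅g, a⁆
      have h1 := hconj a ha (a⁻¹ * y * a) (by simpa using hN.conj_mem y hy a⁻¹) g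
      have h2 : ⁅g, a⁆ * y = ⁅g * a * g⁻¹, a⁻¹ * y * a⁆ * (a⁻¹ * y * a * (g * a * g⁻¹) * a⁻¹) := by
        simp only [commutatorElement_def]
        group
      have h3 : y * ⁅g, a⁆ = ⁅a, a⁻¹ * y * a⁆ * (a⁻¹ * y * a * (g * a * g⁻¹) * a⁻¹) := by
        simp only [commutatorElement_def]
        group
      rw [← map_mul, ← map_mul, h2, h3, map_mul, h1, ← map_mul]
    exact hle hx
  have hN' : ⁅(⊤ : Subgroup G), N⁆ ≤ N := Subgroup.commutator_le_right _ _
  have hsc' : ActsByScalars ρ ⁅(⊤ : Subgroup G), N⁆ := actsByScalars_of_commute hcl htorus hirr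
    fun a ha b hb => hcent a ha b (hN' hb)
  exact actsByScalars_of_commute hcl htorus hirr fun a _ b hb =>
    commute_of_commutator_scalar hcl
      (fun g => hsc' _ (Subgroup.commutator_mem_commutator (Subgroup.mem_top g) hb)) a

/-- A connected solvable matrix group that contains the diagonal torus and has no identically
vanishing matrix entry has size at most one. -/
theorem subsingleton_of_isSolvable [hsol : Group.IsSolvable G]
    (hcl : ∀ f ∈ polyFun (fun (g : G) (p : C × C) => ρ g p.1 p.2), IsClosed {g | f g = 0})
    (htorus : ∀ d : C → K, (∀ i, d i ≠ 0) → ∃ g, ρ g = Matrix.diagonal d)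
    (hirr : ∀ k l, ∃ g, ρ g k l ≠ 0) : Subsingleton C := by
  obtain ⟨n, hn⟩ := hsol.solvable
  -- Scalar action climbs the derived series from its trivial last term up to the whole group, which
  -- contains a nonscalar torus element unless the size is at most one.
  have key : ∀ m ≤ n, ActsByScalars ρ (derivedSeries G (n - m)) := by
    intro m
    induction m with
    | zero =>
      intro _ a ha
      rw [Nat.sub_zero, hn, Subgroup.mem_bot] at ha
      exact ⟨1, by rw [ha, map_one, one_smul]⟩
    | succ m ih =>
      intro hm
      have h1 := ih (by omega)
      rw [show n - m = n - (m + 1) + 1 by omega, derivedSeries_succ] at h1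
      have := derivedSeries_normal G (n - (m + 1))
      exact actsByScalars_of_commutator hcl htorus hirr h1
  have h0 := key n le_rfl
  rw [Nat.sub_self, derivedSeries_zero] at h0
  refine ⟨fun i j => ?_⟩
  by_contra hij
  obtain ⟨g, hg⟩ := htorus (fun k => if k = i then 2 else 1) fun k => by
    split_ifs
    exacts [two_ne_zero, one_ne_zero]
  obtain ⟨c, hc⟩ := h0 g (Subgroup.mem_top g)
  rw [hg] at hc
  have h1 := congrFun (congrFun hc i) i
  have h2 := congrFun (congrFun hc j) j
  simp [Ne.symm hij] at h1 h2
  rw [← h2] at h1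
  norm_num at h1

end LieKolchin

/-! ## The triangular group -/

section Triangular

open scoped commutatorElement

variable {K : Type*} [Field K] {V : Type*} [AddCommGroup V] [Module K V] {ι : Type*}
  {b : Basis ι K V}

theorem apply_eq_of_fix {s : Set ι} {g : GLInf b} (hg : ∀ j ∈ s, g.1 (b j) = b j) {v : V}
    (hv : v ∈ coordSpan b s) : g.1 v = v := by
  induction hv using Submodule.span_induction with
  | zero => simp
  | mem _ h =>
    obtain ⟨i, hi, rfl⟩ := h
    exact hg i hi
  | add x y _ _ hx hy => rw [map_add, hx, hy]
  | smul c x _ hx => rw [map_smul, hx]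

/-- The elements that fix the vectors of `s`. -/
def fixSub (b : Basis ι K V) (s : Set ι) : Subgroup (GLInf b) where
  carrier := {g | ∀ j ∈ s, g.1 (b j) = b j}
  one_mem' := fun _ _ => rfl
  mul_mem' := by
    intro g h hg hh j hj
    show g.1 (h.1 (b j)) = b j
    rw [hh j hj, hg j hj]
  inv_mem' := by
    intro g hg j hj
    show g.1.symm (b j) = b j
    rw [LinearEquiv.symm_apply_eq, hg j hj]

/-- The elements that fix the vectors of `s` and fix `b a` modulo the span of `s`. -/
def fixModSub (b : Basis ι K V) (s : Set ι) (a : ι) : Subgroup (GLInf b) where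
  carrier := {g | g ∈ fixSub b s ∧ g.1 (b a) - b a ∈ coordSpan b s}
  one_mem' := ⟨one_mem _, by
    show b a - b a ∈ _
    rw [sub_self]
    exact zero_mem _⟩
  mul_mem' := by
    intro g h hg hh
    refine ⟨mul_mem hg.1 hh.1, ?_⟩
    have h1 := apply_eq_of_fix hg.1 hh.2
    have : (g * h).1 (b a) - b a = (h.1 (b a) - b a) + (g.1 (b a) - b a) := by
      rw [← h1, map_sub]
      show g.1 (h.1 (b a)) - b a = _
      abel
    rw [this]
    exact add_mem hh.2 hg.2
  inv_mem' := by
    intro g hg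
    refine ⟨inv_mem hg.1, ?_⟩
    have h1 := apply_eq_of_fix (inv_mem hg.1 : g⁻¹ ∈ fixSub b s) hg.2
    have h2 : (g⁻¹).1 (g.1 (b a)) = b a := g.1.symm_apply_apply (b a)
    rw [map_sub, h2] at h1
    rw [← neg_mem_iff, neg_sub, h1]
    exact hg.2

theorem commutator_apply (g h : GLInf b) (v : V) : (⁅g, h⁆).1 (h.1 (g.1 v)) = g.1 (h.1 v) := by
  have h1 : ⁅g, h⁆ * (h * g) = g * h := by
    rw [commutatorElement_def]
    group
  exact congrArg (fun x : GLInf b => x.1 v) h1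

/-- Modulo the span of `s` both elements act on `b a` by scalars, and scalars commute. The product
`c * d` is nonzero by injectivity, since `b a` is not in that span. -/
theorem commutator_mem_fixModSub {s : Set ι} {a : ι} (ha : a ∉ s) {g h : GLInf b}
    (hg : g ∈ fixSub b s) (hh : h ∈ fixSub b s) {c d : K} {v w : V} (hv : v ∈ coordSpan b s)
    (hw : w ∈ coordSpan b s) (hga : g.1 (b a) = c • b a + v) (hha : h.1 (b a) = d • b a + w) :
    ⁅g, h⁆ ∈ fixModSub b s a := by
  have hgh : ⁅g, h⁆ ∈ fixSub b s := by
    rw [commutatorElement_def]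
    exact mul_mem (mul_mem (mul_mem hg hh) (inv_mem hg)) (inv_mem hh)
  have e1 : g.1 (h.1 (b a)) = (c * d) • b a + (d • v + w) := by
    rw [hha, map_add, map_smul, hga, apply_eq_of_fix hg hw, smul_add, smul_smul, mul_comm d,
      add_assoc]
  have e2 : h.1 (g.1 (b a)) = (c * d) • b a + (c • w + v) := by
    rw [hga, map_add, map_smul, hha, apply_eq_of_fix hh hv, smul_add, smul_smul, add_assoc]
  have hx : d • v + w ∈ coordSpan b s := add_mem (Submodule.smul_mem _ _ hv) hw
  have hy : c • w + v ∈ coordSpan b s := add_mem (Submodule.smul_mem _ _ hw) hv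
  have hcd : c * d ≠ 0 := by
    intro h0
    rw [h0, zero_smul, zero_add] at e2
    have h1 : h.1 (g.1 (c • w + v)) = c • w + v := by
      rw [apply_eq_of_fix hg hy, apply_eq_of_fix hh hy]
    have h2 : b a = c • w + v := g.1.injective (h.1.injective (e2.trans h1.symm))
    rw [← h2] at hy
    exact ha (basis_mem_coordSpan.1 hy)
  refine ⟨hgh, ?_⟩
  have h3 := commutator_apply g h (b a)
  rw [e1, e2, map_add, map_smul, apply_eq_of_fix hgh hy] at h3
  have h4 : (c * d) • ((⁅g, h⁆).1 (b a) - b a) = (d • v + w) - (c • w + v) := by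
    rw [smul_sub, sub_eq_sub_iff_add_eq_add, h3]
    abel
  have h5 := Submodule.smul_mem _ (c * d)⁻¹ (sub_mem hx hy)
  rwa [← h4, smul_smul, inv_mul_cancel₀ hcd, one_smul] at h5

/-- Elements of this kind move `b a` by vectors they all fix; such translations commute. -/
theorem commutator_mem_fixSub_insert {s : Set ι} {a : ι} {g h : GLInf b}
    (hg : g ∈ fixModSub b s a) (hh : h ∈ fixModSub b s a) : ⁅g, h⁆ ∈ fixSub b (insert a s) := by
  have hgh : ⁅g, h⁆ ∈ fixSub b s := by
    rw [commutatorElement_def]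
    exact mul_mem (mul_mem (mul_mem hg.1 hh.1) (inv_mem hg.1)) (inv_mem hh.1)
  have key : ∀ {p q : GLInf b}, p ∈ fixModSub b s a → q ∈ fixModSub b s a →
      p.1 (q.1 (b a)) = b a + ((q.1 (b a) - b a) + (p.1 (b a) - b a)) := by
    intro p q hp hq
    have h1 := apply_eq_of_fix hp.1 hq.2
    rw [map_sub] at h1
    rw [← h1]
    abel
  have h3 := commutator_apply g h (b a)
  rw [key hg hh, key hh hg, map_add,
    apply_eq_of_fix hgh (add_mem hg.2 hh.2), add_comm (g.1 (b a) - b a),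
    add_right_cancel_iff] at h3
  rintro j (rfl | hj)
  · exact h3
  · exact hgh j hj

/-- A group of triangular matrices in finitely many variables is solvable. -/
theorem isSolvable_of_triangular [LinearOrder ι] {Q : Subgroup (GLInf b)} {I : Finset ι}
    (hQ : (Q : Set (GLInf b)) ⊆ glPiece b I) (htri : ∀ g ∈ Q, ∀ i j, ent g i j ≠ 0 → i ≤ j) :
    Group.IsSolvable Q := by
  -- Basis vectors are added in increasing order, and each costs two derived steps: one trivializes
  -- its diagonal entry, the next its column.
  have key : ∀ s : Finset ι, s ⊆ I → (∀ i ∈ I, ∀ j ∈ s, i < j → i ∈ s) →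
      ∃ k, ∀ g ∈ derivedSeries Q k, g.1 ∈ fixSub b (s : Set ι) := by
    intro s
    induction s using Finset.induction_on_max with
    | empty => exact fun _ _ => ⟨0, fun g _ j hj => absurd hj (Finset.notMem_empty j)⟩
    | insert a s has ih =>
      intro hsI hlow
      have hsa : a ∉ s := fun h => lt_irrefl a (has a h)
      obtain ⟨k, hk⟩ := ih ((Finset.subset_insert a s).trans hsI) fun i hi j hj hij =>
        (Finset.mem_insert.1 (hlow i hi j (Finset.mem_insert_of_mem hj) hij)).resolve_left
          (hij.trans (has j hj)).ne
      have hcol : ∀ g : Q, ∃ c : K, ∃ v ∈ coordSpan b (s : Set ι), g.1.1 (b a) = c • b a + v := by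
        intro g
        refine ⟨ent g.1 a a, g.1.1 (b a) - ent g.1 a a • b a, mem_coordSpan.2 fun i hi => ?_,
          by abel⟩
        by_cases hia : i = a
        · subst hia
          simp [ent] at hi
        · have hne : ent g.1 i a ≠ 0 := by
            simpa [ent, Finsupp.single_eq_of_ne hia] using hi
          have hiI : i ∈ I := by
            by_contra h
            exact hne (by rw [ent_of_notMem_left (hQ g.2) h, if_neg hia])
          exact (Finset.mem_insert.1 (hlow i hiI a (Finset.mem_insert_self a s)
            (lt_of_le_of_ne (htri g.1 g.2 i a hne) hia))).resolve_left hia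
      have h1 : ∀ g ∈ derivedSeries Q (k + 1), g.1 ∈ fixModSub b (s : Set ι) a := by
        have : derivedSeries Q (k + 1) ≤ (fixModSub b (s : Set ι) a).comap Q.subtype := by
          rw [derivedSeries_succ, Subgroup.commutator_le]
          intro g hg h hh
          obtain ⟨c, v, hv, hc⟩ := hcol g
          obtain ⟨d, w, hw, hd⟩ := hcol h
          exact commutator_mem_fixModSub (fun h => hsa h) (hk g hg) (hk h hh) hv hw hc hd
        exact this
      have h2 : derivedSeries Q (k + 2) ≤
          (fixSub b (insert a (s : Set ι))).comap Q.subtype := by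
        rw [derivedSeries_succ, Subgroup.commutator_le]
        intro g hg h hh
        exact commutator_mem_fixSub_insert (h1 g hg) (h1 h hh)
      refine ⟨k + 2, fun g hg => ?_⟩
      rw [Finset.coe_insert]
      exact h2 hg
  obtain ⟨k, hk⟩ := key I subset_rfl fun i hi _ _ _ => hi
  refine ⟨⟨k, (Subgroup.eq_bot_iff_forall _).2 fun g hg => Subtype.ext (GLInf_ext fun i => ?_)⟩⟩
  by_cases hi : i ∈ I
  · exact hk g hg i hi
  · exact (hQ g.2).1 i hi

/-- The line through `1` and a triangular matrix. -/
theorem exists_line [CharZero K] [LinearOrder ι] {I : Finset ι} {g : GLInf b}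
    (hg : g ∈ glPiece b I) (htri : ∀ i j, ent g i j ≠ 0 → i ≤ j) :
    ∃ D : Set K, D.Infinite ∧ ∃ γ : D → GLInf b, (∀ s, γ s ∈ glPiece b I) ∧
      (∀ s i j, ent (γ s) i j = (1 - s.1) * ent (1 : GLInf b) i j + s.1 * ent g i j) ∧
      (∃ s, γ s = 1) ∧ ∃ s, γ s = g := by
  have hdiag := diag_ne_zero_of_triangular htri
  -- Parameters at which no diagonal entry vanishes, so the matrix stays invertible. Each `i`
  -- excludes at most `s = (1 - g i i)⁻¹`.
  let D : Set K := {s | ∀ i ∈ I, (1 - s) + s * ent g i i ≠ 0}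
  have hD : D.Infinite := by
    have hfin : Dᶜ.Finite := by
      refine (I.finite_toSet.image fun i => (1 - ent g i i)⁻¹).subset fun s hs => ?_
      have hs' : ∃ i ∈ I, (1 - s) + s * ent g i i = 0 := by
        by_contra! h
        exact hs h
      obtain ⟨i, hi, h0⟩ := hs'
      have h1 : s * (1 - ent g i i) = 1 := by linear_combination -h0
      exact ⟨i, hi, (eq_inv_of_mul_eq_one_left h1).symm⟩
    intro hDf
    exact Set.infinite_univ (α := K) ((hDf.union hfin).subset fun s _ => em _)
  have hline : ∀ s : D, ∃ h : GLInf b, h ∈ glPiece b I ∧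
      ∀ i j, ent h i j = (1 - s.1) * ent (1 : GLInf b) i j + s.1 * ent g i j := by
    intro s
    let u : ι → V := fun j => (1 - s.1) • b j + s.1 • g.1 (b j)
    have hu : ∀ i j, b.repr (u j) i = (1 - s.1) * ent (1 : GLInf b) i j + s.1 * ent g i j := by
      intro i j
      rw [ent_one]
      simp [u, ent, Finsupp.single_apply, eq_comm]
      split_ifs <;> simp
    have hli := linearIndependent_of_triangular b (I := I) (u := u)
      (fun i hi => by
        rw [hu, ent_one, if_pos rfl, mul_one]
        exact s.2 i hi)
      (fun i _ k hk => by
        by_contra hlt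
        refine hk ?_
        have h1 : ent g k i = 0 := by
          by_contra hne
          exact hlt (htri k i hne)
        rw [hu, ent_one, h1, if_neg fun h => hlt h.le]
        simp)
    obtain ⟨h, hh, hhu⟩ := exists_glPiece_of_linearIndependent b I (u := u) (fun j hj =>
      add_mem (Submodule.smul_mem _ _ (basis_mem_coordSpan.2 hj))
        (Submodule.smul_mem _ _ (hg.2 j hj))) hli
    refine ⟨h, hh, fun i j => ?_⟩
    by_cases hj : j ∈ I
    · rw [ent, hhu j hj, hu]
    · rw [ent_of_notMem_right hh hj, ent_of_notMem_right hg hj, ent_one]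
      ring
  choose γ hγ hent using hline
  refine ⟨D, hD, γ, hγ, hent, ⟨⟨0, fun i _ => by simp⟩, ext_ent fun i j => ?_⟩,
    ⟨⟨1, fun i _ => by simpa using hdiag i⟩, ext_ent fun i j => ?_⟩⟩
  · rw [hent]; simp
  · rw [hent]; simp

theorem isClosed_glInd_iff {E : ℕ → Finset ι} {Z : Set (GLInf b)} : IsClosed[(glInd b E).top] Z ↔
    ∀ n, IsClosed[(zariski (entCoord b (E n))).top] {x : glPiece b (E n) | x.1 ∈ Z} :=
  isClosed_indSpace_iff

theorem isClosed_flagStabilizer_maxFlag [LinearOrder ι] (E : ℕ → Finset ι) :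
    IsClosed[(glInd b E).top] (flagStabilizer b (maxFlag b) : Set (GLInf b)) := by
  rw [isClosed_glInd_iff]
  intro n
  have : {x : glPiece b (E n) | x.1 ∈ (flagStabilizer b (maxFlag b) : Set (GLInf b))} =
      ⋂ i, ⋂ j, ⋂ _ : ¬ i ≤ j, {x : glPiece b (E n) | entCoord b (E n) x (i, j) = 0} := by
    ext x
    simp only [Set.mem_iInter]
    refine mem_flagStabilizer_maxFlag.trans (forall₂_congr fun i j => ?_)
    exact not_imp_comm
  rw [this]
  let _ := (zariski (entCoord b (E n))).top
  exact isClosed_iInter fun i => isClosed_iInter fun j => isClosed_iInter fun _ =>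
    isClosed_eq_zariski (coord_mem_polyFun _ _)

theorem line_mem_polyFun {D : Set K} {γ : D → GLInf b} {g : GLInf b}
    (hent : ∀ s i j, ent (γ s) i j = (1 - s.1) * ent (1 : GLInf b) i j + s.1 * ent g i j)
    (i j : ι) : (fun s => ent (γ s) i j) ∈ polyFun (lineCoord D) := by
  have hs : (fun s : D => s.1) ∈ polyFun (lineCoord D) := coord_mem_polyFun (lineCoord D) ()
  simp only [hent]
  exact add_mem_polyFun (mul_mem_polyFun (sub_mem_polyFun (const_mem_polyFun _ 1) hs)
    (const_mem_polyFun _ _)) (mul_mem_polyFun hs (const_mem_polyFun _ _))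

theorem isConnected_flagStabilizer_maxFlag [CharZero K] [LinearOrder ι] {E : ℕ → Finset ι}
    (hE : Monotone E) (hEι : ∀ i, ∃ n, i ∈ E n) :
    @IsConnected _ (glInd b E).top (flagStabilizer b (maxFlag b) : Set (GLInf b)) := by
  let _ := (glInd b E).top
  refine ⟨⟨1, one_mem _⟩, isPreconnected_of_forall 1 fun g hg => ?_⟩
  have htri := mem_flagStabilizer_maxFlag.1 hg
  obtain ⟨n, hn⟩ := exists_mem_glPiece hE hEι g
  obtain ⟨D, hD, γ, hγ, hent, ⟨s₀, h0⟩, s₁, h1⟩ := exists_line hn htri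
  -- The line from `1` to `g` stays triangular and is the continuous image of a connected subset of
  -- the affine line.
  refine ⟨Set.range γ, ?_, ⟨s₀, h0⟩, ⟨s₁, h1⟩, ?_⟩
  · rintro _ ⟨s, rfl⟩
    refine mem_flagStabilizer_maxFlag.2 fun i j hne => ?_
    by_contra hlt
    have h2 : ent g i j = 0 := by
      by_contra h
      exact hlt (htri i j h)
    rw [hent, h2, ent_one, if_neg fun h => hlt h.le] at hne
    simp at hne
  · let _ := (zariski (lineCoord D)).top
    have := preconnectedSpace_line hD
    refine isPreconnected_range ?_
    refine continuous_def.2 fun O hO => ?_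
    have h2 := isOpen_indSpace_iff.1 hO n
    have h3 : Continuous[(zariski (lineCoord D)).top, (zariski (entCoord b (E n))).top]
        fun s => (⟨γ s, hγ s⟩ : glPiece b (E n)) :=
      continuous_zariski fun p => line_mem_polyFun hent p.1 p.2
    exact continuous_def.1 h3 _ h2

theorem diag_mem_flagStabilizer_maxFlag [LinearOrder ι] {g : GLInf b} (hg : IsDiag b g) :
    g ∈ flagStabilizer b (maxFlag b) := by
  refine mem_flagStabilizer_maxFlag.2 fun i j hne => ?_
  obtain ⟨c, hc⟩ := hg j
  by_contra hlt
  refine hne ?_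
  rw [ent, hc, map_smul, Basis.repr_self, Finsupp.smul_apply,
    Finsupp.single_eq_of_ne fun h => hlt h.le, smul_zero]

theorem isLocallySolvable_flagStabilizer_maxFlag [LinearOrder ι] (E : ℕ → Finset ι) :
    IsLocallySolvable b E (flagStabilizer b (maxFlag b)) := by
  rintro Q hQ ⟨n, hn⟩ _
  exact isSolvable_of_triangular hn fun g hg => mem_flagStabilizer_maxFlag.1 (hQ hg)

/-- The transvection adding `b i` to `b j` is triangular precisely when `i` precedes `j`, so the
group remembers the order. -/
theorem le_of_flagStabilizer_eq {o₁ o₂ : LinearOrder ι}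
    (h : flagStabilizer b (@maxFlag _ _ _ _ _ _ o₁ b) = flagStabilizer b (@maxFlag _ _ _ _ _ _ o₂ b))
    {i j : ι} (hij : o₁.le i j) : o₂.le i j := by
  by_cases hne : i = j
  · rw [hne]
  have hlt : o₁.lt i j := @lt_of_le_of_ne _ o₁.toPartialOrder _ _ hij hne
  have h1 : transv b hne (1 : K) ∈ flagStabilizer b (@maxFlag _ _ _ _ _ _ o₁ b) :=
    (@mem_flagStabilizer_maxFlag _ _ _ _ _ _ o₁ _ _).2
      (@transv_triangular _ _ _ _ _ _ o₁ b _ _ hlt 1)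
  rw [h] at h1
  refine (@mem_flagStabilizer_maxFlag _ _ _ _ _ _ o₂ _ _).1 h1 i j ?_
  rw [ent, transv_apply_same]
  simp [Finsupp.single_eq_of_ne hne]

theorem linearOrder_eq_of_flagStabilizer_eq {o₁ o₂ : LinearOrder ι}
    (h : flagStabilizer b (@maxFlag _ _ _ _ _ _ o₁ b) =
      flagStabilizer b (@maxFlag _ _ _ _ _ _ o₂ b)) : o₁ = o₂ :=
  LinearOrder.ext fun _ _ => ⟨le_of_flagStabilizer_eq h, le_of_flagStabilizer_eq h.symm⟩

end Triangular

/-! ## Splitting Borel subgroups -/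

section Component

variable {K : Type*} [Field K] {V : Type*} [AddCommGroup V] [Module K V] {ι : Type*}
  {b : Basis ι K V}

/-- The matrix entries as coordinates on a subgroup. -/
noncomputable def subCoord (Q : Subgroup (GLInf b)) : Q → ι × ι → K := fun g p => ent g.1 p.1 p.2

theorem ent_mem_polyFun (Q : Subgroup (GLInf b)) (i j : ι) :
    (fun g : Q => ent g.1 i j) ∈ polyFun (subCoord Q) := coord_mem_polyFun (subCoord Q) (i, j)

variable {Q : Subgroup (GLInf b)} {I : Finset ι}

/-- Only the finitely many entries with both indices in `I` are nonconstant. -/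
theorem noetherianSpace_subgroup (hQ : (Q : Set (GLInf b)) ⊆ glPiece b I) :
    @TopologicalSpace.NoetherianSpace Q (zariski (subCoord Q)).top := by
  classical
  let c : Q → I × I → K := fun g p => ent g.1 p.1 p.2
  have h1 := noetherianSpace_zariski c
  refine @TopologicalSpace.noetherianSpace_of_surjective _ _ (zariski c).top (zariski (subCoord Q)).top
    h1 id (continuous_zariski fun p => ?_) Function.surjective_id
  by_cases hp1 : p.1 ∈ I
  · by_cases hp2 : p.2 ∈ I
    · exact coord_mem_polyFun c (⟨p.1, hp1⟩, ⟨p.2, hp2⟩)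
    · simp only [subCoord, id, fun g : Q => ent_of_notMem_right (hQ g.2) hp2 p.1]
      exact const_mem_polyFun _ _
  · simp only [subCoord, id, fun g : Q => ent_of_notMem_left (hQ g.2) hp1 p.2]
    exact const_mem_polyFun _ _

theorem continuous_mul_left_subgroup (hQ : (Q : Set (GLInf b)) ⊆ glPiece b I) (g : Q) :
    Continuous[(zariski (subCoord Q)).top, (zariski (subCoord Q)).top] fun h => g * h := by
  classical
  refine continuous_zariski fun p => ?_
  by_cases hp : p.2 ∈ I
  · have : (fun h : Q => subCoord Q (g * h) p) =
        fun h => ∑ k ∈ I, ent g.1 p.1 k * ent h.1 k p.2 :=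
      funext fun h => ent_mul g.1 (hQ h.2) p.1 hp
    rw [this]
    exact sum_mem_polyFun _ fun k _ => mul_mem_polyFun (const_mem_polyFun _ _) (ent_mem_polyFun Q _ _)
  · simp only [subCoord, fun h : Q => ent_of_notMem_right (hQ (g * h).2) hp p.1]
    exact const_mem_polyFun _ _

/-- The identity component of a subgroup of some `G(I)`. -/
noncomputable def identityComponent (hQ : (Q : Set (GLInf b)) ⊆ glPiece b I) : Subgroup (GLInf b) :=
  let _ := (zariski (subCoord Q)).top
  -- Only left translations need to be continuous: the translate by `g⁻¹` of the component is
  -- connected and contains `1`.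
  have key : ∀ g ∈ connectedComponent (1 : Q), ∀ h ∈ connectedComponent (1 : Q),
      g⁻¹ * h ∈ connectedComponent (1 : Q) := fun g hg h hh => by
    have h1 : IsPreconnected ((fun x => g⁻¹ * x) '' connectedComponent (1 : Q)) :=
      isPreconnected_connectedComponent.image _
        (continuous_mul_left_subgroup hQ g⁻¹).continuousOn
    exact h1.subset_connectedComponent ⟨g, hg, inv_mul_cancel g⟩ ⟨h, hh, rfl⟩
  have hinv : ∀ g ∈ connectedComponent (1 : Q), g⁻¹ ∈ connectedComponent (1 : Q) := fun g hg => by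
    simpa using key g hg 1 mem_connectedComponent
  Subgroup.map Q.subtype
    { carrier := connectedComponent (1 : Q)
      one_mem' := mem_connectedComponent
      mul_mem' := fun {g h} hg hh => by simpa using key g⁻¹ (hinv g hg) h hh
      inv_mem' := fun {g} hg => hinv g hg }

theorem mem_identityComponent (hQ : (Q : Set (GLInf b)) ⊆ glPiece b I) (g : Q) :
    g.1 ∈ identityComponent hQ ↔ g ∈ @connectedComponent _ (zariski (subCoord Q)).top 1 := by
  constructor
  · rintro ⟨h, hh, hg⟩
    rw [← Subtype.ext hg]
    exact hh
  · exact fun h => ⟨g, h, rfl⟩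

theorem identityComponent_le (hQ : (Q : Set (GLInf b)) ⊆ glPiece b I) : identityComponent hQ ≤ Q := by
  rintro _ ⟨h, _, rfl⟩
  exact h.2

theorem mem_identityComponent_of_continuous (hQ : (Q : Set (GLInf b)) ⊆ glPiece b I) {X : Type*}
    [TopologicalSpace X] {S : Set X} (hS : IsPreconnected S) {f : X → Q}
    (hf : Continuous[inferInstance, (zariski (subCoord Q)).top] f) {x₀ : X} (hx₀ : x₀ ∈ S)
    (h0 : f x₀ = 1) {x : X} (hx : x ∈ S) : (f x).1 ∈ identityComponent hQ := by
  let _ := (zariski (subCoord Q)).top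
  rw [mem_identityComponent]
  exact (hS.image f hf.continuousOn).subset_connectedComponent ⟨x₀, hx₀, h0⟩ ⟨x, hx, rfl⟩

theorem preconnectedSpace_identityComponent (hQ : (Q : Set (GLInf b)) ⊆ glPiece b I) :
    @PreconnectedSpace (identityComponent hQ)
      (zariski (subCoord (identityComponent hQ))).top := by
  let tQ := (zariski (subCoord Q)).top
  have h1 : IsPreconnected (connectedComponent (1 : Q)) := isPreconnected_connectedComponent
  have h2 : PreconnectedSpace (connectedComponent (1 : Q)) := Subtype.preconnectedSpace h1
  let f : connectedComponent (1 : Q) → identityComponent hQ := fun g =>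
    ⟨g.1.1, (mem_identityComponent hQ g.1).2 g.2⟩
  let tC := (zariski (subCoord (identityComponent hQ))).top
  have hf : Continuous f := by
    refine continuous_generateFrom_iff.2 ?_
    rintro _ ⟨p, rfl⟩
    exact (isOpen_ne_zariski (eval_mem_polyFun (subCoord Q) p)).preimage continuous_subtype_val
  have hsurj : Function.Surjective f := by
    rintro ⟨_, h, hh, rfl⟩
    exact ⟨⟨h, hh⟩, rfl⟩
  refine ⟨?_⟩
  rw [← hsurj.range_eq]
  exact isPreconnected_range hf

/-- The complement is the union of the irreducible components not contained in it, a finite union of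
closed sets. -/
theorem isOpen_connectedComponent_of_noetherianSpace {X : Type*} [TopologicalSpace X]
    [TopologicalSpace.NoetherianSpace X] (x : X) : IsOpen (connectedComponent x) := by
  have hfin := TopologicalSpace.NoetherianSpace.finite_irreducibleComponents (α := X)
  have h1 : (connectedComponent x)ᶜ =
      ⋃ Z ∈ {Z ∈ irreducibleComponents X | ¬ Z ⊆ connectedComponent x}, Z := by
    ext y
    simp only [Set.mem_iUnion, Set.mem_compl_iff]
    constructor
    · intro hy
      exact ⟨irreducibleComponent y, ⟨irreducibleComponent_mem_irreducibleComponents y,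
        fun h => hy (h mem_irreducibleComponent)⟩, mem_irreducibleComponent⟩
    · rintro ⟨Z, ⟨hZ, hZn⟩, hyZ⟩ hy
      refine hZn ?_
      rw [connectedComponent_eq hy]
      exact (hZ.1.isPreirreducible.isPreconnected).subset_connectedComponent hyZ
  rw [← isClosed_compl_iff, h1]
  exact (hfin.subset fun Z hZ => hZ.1).isClosed_biUnion fun Z hZ =>
    isClosed_of_mem_irreducibleComponents Z hZ.1

/-- The left cosets of the identity component are open, and the property is constant on them. -/
theorem isOpen_mem_iff_subgroup (hQ : (Q : Set (GLInf b)) ⊆ glPiece b I) {P : GLInf b → Prop}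
    (hP : ∀ g c, c ∈ identityComponent hQ → (P g ↔ P (g * c))) :
    IsOpen[(zariski (subCoord Q)).top] {g : Q | P g.1} := by
  let _ := (zariski (subCoord Q)).top
  have := noetherianSpace_subgroup hQ
  rw [isOpen_iff_forall_mem_open]
  intro g hg
  refine ⟨(fun h => g⁻¹ * h) ⁻¹' connectedComponent (1 : Q), fun h hh => ?_,
    (isOpen_connectedComponent_of_noetherianSpace _).preimage (continuous_mul_left_subgroup hQ g⁻¹),
    ?_⟩
  · have h1 := (hP g.1 _ ((mem_identityComponent hQ _).2 hh)).1 hg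
    have h2 : g.1 * (g⁻¹ * h).1 = h.1 := congrArg Subtype.val (mul_inv_cancel_left g h)
    rw [h2] at h1
    exact h1
  · show g⁻¹ * g ∈ connectedComponent (1 : Q)
    rw [inv_mul_cancel]
    exact mem_connectedComponent

/-- A relatively closed subset of a closed subgroup of `G(I)` is closed. -/
theorem isClosed_of_isClosed_subgroup
    (hQc : IsClosed[(zariski (entCoord b I)).top] {x : glPiece b I | x.1 ∈ Q})
    {Z : Set (GLInf b)} (hZQ : ∀ g ∈ Z, g ∈ Q)
    (hZ : IsClosed[(zariski (subCoord Q)).top] {g : Q | g.1 ∈ Z}) :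
    IsClosed[(zariski (entCoord b I)).top] {x : glPiece b I | x.1 ∈ Z} := by
  let _ := (zariski (entCoord b I)).top
  have hZo : IsOpen[(zariski (subCoord Q)).top] {g : Q | g.1 ∈ Z}ᶜ :=
    (@isOpen_compl_iff _ _ (zariski (subCoord Q)).top).2 hZ
  rw [← isOpen_compl_iff, isOpen_iff_forall_mem_open]
  intro x hx
  by_cases hxQ : x.1 ∈ Q
  · obtain ⟨f, hf, hfx, hfZ⟩ := exists_polyFun_of_isOpen hZo (x := ⟨x.1, hxQ⟩) hx
    obtain ⟨p, hp⟩ := mem_polyFun_iff.1 hf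
    refine ⟨{y | MvPolynomial.eval (entCoord b I y) p ≠ 0}, fun y hy hyZ => ?_,
      isOpen_ne_zariski (eval_mem_polyFun _ p), ?_⟩
    · refine hfZ ⟨y.1, hZQ _ hyZ⟩ ?_ hyZ
      rw [hp]
      exact hy
    · rw [hp] at hfx
      exact hfx
  · exact ⟨{x | x.1 ∈ Q}ᶜ, fun y hy hyZ => hy (hZQ _ hyZ), hQc.isOpen_compl, hxQ⟩

end Component

/-! ### The total order defined by a splitting Borel subgroup -/

section Borel

variable {K : Type*} [Field K] {V : Type*} [AddCommGroup V] [Module K V] {ι : Type*}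
  {b : Basis ι K V}

theorem exists_diag [DecidableEq ι] (b : Basis ι K V) {I : Finset ι} {d : ι → K}
    (hd : ∀ i, d i ≠ 0) (hI : ∀ i ∉ I, d i = 1) :
    ∃ t ∈ glPiece b I, IsDiag b t ∧ ∀ i, t.1 (b i) = d i • b i := by
  let e : V ≃ₗ[K] V := b.equiv (b.unitsSMul fun i => Units.mk0 (d i) (hd i)) (Equiv.refl ι)
  have he : ∀ i, e (b i) = d i • b i := fun i => by
    simp [e, Basis.equiv_apply, Basis.unitsSMul_apply, Units.smul_def]
  have h1 : ∀ i ∉ I, e (b i) = b i := fun i hi => by rw [he, hI i hi, one_smul]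
  refine ⟨⟨e, I.finite_toSet.subset fun i hi => ?_⟩, ⟨h1, fun i hi => ?_⟩, fun i => ⟨d i, he i⟩, he⟩
  · by_contra h
    exact hi (h1 i h)
  · show e (b i) ∈ coordSpan b (I : Set ι)
    rw [he]
    exact Submodule.smul_mem _ _ (basis_mem_coordSpan.2 hi)

theorem ent_diag_mul {t : GLInf b} {d : ι → K} (ht : ∀ i, t.1 (b i) = d i • b i) (h : GLInf b)
    (i j : ι) : ent (t * h) i j = d i * ent h i j := by
  classical
  obtain ⟨I, hI⟩ := exists_finset_mem_glPiece h
  have hI' := glPiece_mono (Finset.subset_insert i (insert j I))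
    (glPiece_mono (Finset.subset_insert j I) hI)
  rw [ent_mul t hI' i (by simp), Finset.sum_eq_single i]
  · rw [ent, ht]
    simp
  · intro k _ hk
    rw [ent, ht]
    simp [hk]
  · simp

/-- The torus trick: the relation of having a nonzero matrix entry is transitive. -/
theorem exists_ent_ne_zero_trans [CharZero K] {Γ : Subgroup (GLInf b)} {I : Finset ι}
    (hΓ : ∀ t ∈ glPiece b I, IsDiag b t → t ∈ Γ) {i j k : ι} (hj : j ∈ I)
    (hij : ∃ g ∈ Γ, ent g i j ≠ 0) (hjk : ∃ g ∈ Γ, ent g j k ≠ 0) :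
    ∃ g ∈ Γ, ent g i k ≠ 0 := by
  classical
  obtain ⟨g, hg, hgij⟩ := hij
  obtain ⟨h, hh, hhjk⟩ := hjk
  -- Doubling the coordinate `j` between `g` and `h` changes the `(i, k)` entry of the product by
  -- exactly `g i j * h j k`, so the entries of `g h` and `g t h` cannot both vanish.
  obtain ⟨t, htI, htd, ht⟩ := exists_diag b (I := I) (d := fun m => if m = j then 2 else 1)
    (fun m => by split_ifs; exacts [two_ne_zero, one_ne_zero])
    (fun m hm => if_neg fun h : m = j => hm (h ▸ hj))
  by_contra! hall
  have h1 := hall (g * h) (mul_mem hg hh)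
  have h2 := hall (g * (t * h)) (mul_mem hg (mul_mem (hΓ t htI htd) hh))
  obtain ⟨J, hJ⟩ := exists_finset_mem_glPiece h
  obtain ⟨J', hJ'⟩ := exists_finset_mem_glPiece t
  let M := insert j (insert k (J ∪ J'))
  have hM : h ∈ glPiece b M := glPiece_mono (fun x hx => by simp [M, hx]) hJ
  have hM' : t * h ∈ glPiece b M :=
    (glSub b M).mul_mem (glPiece_mono (fun x hx => by simp [M, hx]) hJ') hM
  have hk : k ∈ M := by simp [M]
  rw [ent_mul g hM i hk] at h1
  rw [ent_mul g hM' i hk] at h2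
  simp only [ent_diag_mul ht] at h2
  have h3 : ∑ x ∈ M, ent g i x * ((if x = j then 2 else 1) * ent h x k) -
      ∑ x ∈ M, ent g i x * ent h x k = ent g i j * ent h j k := by
    rw [← Finset.sum_sub_distrib, Finset.sum_eq_single j]
    · rw [if_pos rfl]
      ring
    · intro x _ hx
      rw [if_neg hx]
      ring
    · simp [M]
  rw [h1, h2, sub_zero] at h3
  exact mul_ne_zero hgij hhjk h3.symm

variable {E : ℕ → Finset ι} {B : Subgroup (GLInf b)}

theorem inf_glSub_subset (B : Subgroup (GLInf b)) (I : Finset ι) :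
    ((B ⊓ glSub b I : Subgroup (GLInf b)) : Set (GLInf b)) ⊆ glPiece b I := fun _ hg => hg.2

/-- The identity component of `B ∩ G(I)`. -/
noncomputable def compPiece (B : Subgroup (GLInf b)) (I : Finset ι) : Subgroup (GLInf b) :=
  identityComponent (inf_glSub_subset B I)

theorem compPiece_le (B : Subgroup (GLInf b)) (I : Finset ι) : compPiece B I ≤ B ⊓ glSub b I :=
  identityComponent_le _

theorem compPiece_mono (B : Subgroup (GLInf b)) {I J : Finset ι} (hIJ : I ⊆ J) :
    compPiece B I ≤ compPiece B J := by
  rintro _ ⟨g, hg, rfl⟩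
  let _ := (zariski (subCoord (B ⊓ glSub b I))).top
  let f : (B ⊓ glSub b I : Subgroup (GLInf b)) → (B ⊓ glSub b J : Subgroup (GLInf b)) :=
    fun g => ⟨g.1, g.2.1, glPiece_mono hIJ g.2.2⟩
  have hf : Continuous[(zariski (subCoord (B ⊓ glSub b I))).top,
      (zariski (subCoord (B ⊓ glSub b J))).top] f :=
    continuous_zariski fun p => ent_mem_polyFun _ p.1 p.2
  exact mem_identityComponent_of_continuous (inf_glSub_subset B J)
    (isPreconnected_connectedComponent (x := (1 : (B ⊓ glSub b I : Subgroup (GLInf b))))) hf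
    mem_connectedComponent rfl hg

theorem isClosed_glPiece_subset (E : ℕ → Finset ι) (n : ℕ) :
    IsClosed[(glInd b E).top] (glPiece b (E n)) := by
  classical
  rw [isClosed_glInd_iff]
  intro m
  let _ := (zariski (entCoord b (E m))).top
  have : {x : glPiece b (E m) | x.1 ∈ glPiece b (E n)} = ⋂ p : ι × ι,
      ⋂ _ : ¬ (p.1 ∈ E n ∧ p.2 ∈ E n), {x | entCoord b (E m) x p - (if p.1 = p.2 then 1 else 0) = 0} := by
    ext x
    simp only [Set.mem_iInter]
    constructor
    · rintro hx p hp
      refine sub_eq_zero.2 ?_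
      by_cases h : p.1 ∈ E n
      · exact ent_of_notMem_right hx (fun h' => hp ⟨h, h'⟩) p.1
      · exact ent_of_notMem_left hx h p.2
    · intro h
      refine mem_glPiece_of_ent (fun i j hne hij => ?_) fun i hi => ?_
      · by_contra hn
        have h1 := sub_eq_zero.1 (h (i, j) hn)
        rw [if_neg hij] at h1
        exact hne h1
      · have h1 := sub_eq_zero.1 (h (i, i) fun h' => hi h'.1)
        rwa [if_pos rfl] at h1
  rw [this]
  exact isClosed_iInter fun p => isClosed_iInter fun _ => isClosed_eq_zariski
    (sub_mem_polyFun (coord_mem_polyFun _ p) (const_mem_polyFun _ _))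

/-- Transfers connectedness from `B` to the finite pieces. The union `L` of the identity components
is a subgroup; on each piece, membership in `L` is constant on cosets of the identity component, so
both `L` and its complement in `B` are closed. -/
theorem exists_mem_compPiece (hE : Monotone E)
    (hcl : IsClosed[(glInd b E).top] (B : Set (GLInf b)))
    (hconn : @IsConnected _ (glInd b E).top (B : Set (GLInf b))) {g : GLInf b} (hg : g ∈ B) :
    ∃ n, g ∈ compPiece B (E n) := by
  let L : Subgroup (GLInf b) := ⨆ n, compPiece B (E n)
  have hdir : Directed (· ≤ ·) fun n => compPiece B (E n) :=
    Monotone.directed_le fun _ _ h => compPiece_mono B (hE h)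
  have hLB : L ≤ B := iSup_le fun n => (compPiece_le B (E n)).trans inf_le_left
  have hP : ∀ n (g c : GLInf b), c ∈ compPiece B (E n) → (g ∈ L ↔ g * c ∈ L) := fun n g c hc =>
    (Subgroup.mul_mem_cancel_right L (le_iSup (fun n => compPiece B (E n)) n hc)).symm
  have hclosed : ∀ P : GLInf b → Prop, (∀ n (g c : GLInf b), c ∈ compPiece B (E n) →
      (P g ↔ P (g * c))) → IsClosed[(glInd b E).top] {g | g ∈ B ∧ P g} := by
    intro P hP
    rw [isClosed_glInd_iff]
    intro n
    have h1 : {x : glPiece b (E n) | x.1 ∈ {g | g ∈ B ∧ P g}} =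
        {x : glPiece b (E n) | x.1 ∈ {g | g ∈ B ⊓ glSub b (E n) ∧ P g}} := by
      ext x
      exact ⟨fun h => ⟨⟨h.1, x.2⟩, h.2⟩, fun h => ⟨h.1.1, h.2⟩⟩
    rw [h1]
    refine isClosed_of_isClosed_subgroup (Q := B ⊓ glSub b (E n)) ?_ (fun _ h => h.1) ?_
    · convert isClosed_glInd_iff.1 hcl n using 1
      ext x
      exact ⟨fun h => h.1, fun h => ⟨h, x.2⟩⟩
    · have h2 := isOpen_mem_iff_subgroup (inf_glSub_subset B (E n)) (P := fun g => ¬ P g)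
        fun g c hc => not_congr (hP n g c hc)
      let _ := (zariski (subCoord (B ⊓ glSub b (E n)))).top
      rw [← isOpen_compl_iff]
      convert h2 using 1
      ext x
      exact ⟨fun h h' => h ⟨x.2, h'⟩, fun h h' => h h'.2⟩
  by_contra hno
  have hgL : g ∉ L := fun h => hno ((Subgroup.mem_iSup_of_directed hdir).1 h)
  let _ := (glInd b E).top
  obtain ⟨x, _, hx1, hx2⟩ := isPreconnected_closed_iff.1 hconn.isPreconnected _ _
    (hclosed (· ∈ L) hP) (hclosed (· ∉ L) fun n g c hc => not_congr (hP n g c hc))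
    (fun x hx => (em (x ∈ L)).imp (fun h => ⟨hx, h⟩) fun h => ⟨hx, h⟩)
    ⟨1, one_mem B, one_mem B, one_mem L⟩ ⟨g, hg, hg, hgL⟩
  exact hx2.2 hx1.2

theorem diag_mem_compPiece [CharZero K] (hdiag : ∀ g, IsDiag b g → g ∈ B) {I : Finset ι} {t : GLInf b}
    (ht : t ∈ glPiece b I) (htd : IsDiag b t) : t ∈ compPiece B I := by
  classical
  have hoff : ∀ i j, i ≠ j → ent t i j = 0 := by
    intro i j hij
    obtain ⟨c, hc⟩ := htd j
    rw [ent, hc]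
    simp [Finsupp.single_eq_of_ne hij]
  -- A diagonal matrix is triangular for every order; an arbitrary one is chosen so that
  -- `exists_line` joins it to `1` inside the torus.
  let _ : LinearOrder ι := IsWellOrder.linearOrder WellOrderingRel
  have htri : ∀ i j, ent t i j ≠ 0 → i ≤ j := fun i j hne => by
    by_contra hlt
    exact hne (hoff i j fun h => hlt h.le)
  obtain ⟨D, hD, γ, hγ, hent, ⟨s₀, h0⟩, s₁, h1⟩ := exists_line ht htri
  have hγd : ∀ s, IsDiag b (γ s) := fun s j => by
    refine ⟨ent (γ s) j j, b.repr.injective (Finsupp.ext fun i => ?_)⟩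
    show ent (γ s) i j = _
    by_cases hij : i = j
    · subst hij
      simp
    · rw [hent, hoff i j hij, ent_one, if_neg hij]
      simp [Finsupp.single_eq_of_ne hij]
  let _ := (zariski (lineCoord D)).top
  have := preconnectedSpace_line hD
  let f : D → (B ⊓ glSub b I : Subgroup (GLInf b)) := fun s => ⟨γ s, hdiag _ (hγd s), hγ s⟩
  have hf : Continuous[(zariski (lineCoord D)).top, (zariski (subCoord (B ⊓ glSub b I))).top] f :=
    continuous_zariski fun p => line_mem_polyFun hent p.1 p.2
  rw [← h1]
  exact mem_identityComponent_of_continuous (inf_glSub_subset B I) (f := f) isPreconnected_univ hf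
    (x₀ := s₀) trivial (Subtype.ext h0) (x := s₁) trivial

theorem isSolvable_compPiece (hcl : IsClosed[(glInd b E).top] (B : Set (GLInf b)))
    (hsol : IsLocallySolvable b E B) (n : ℕ) : Group.IsSolvable (compPiece B (E n)) := by
  have h1 : Group.IsSolvable (B ⊓ glSub b (E n) : Subgroup (GLInf b)) := by
    refine hsol _ inf_le_left ⟨n, inf_glSub_subset B (E n)⟩ ?_
    let _ := (glInd b E).top
    exact hcl.inter (isClosed_glPiece_subset E n)
  exact Group.isSolvable_of_isSolvable_injective (Subgroup.inclusion_injective (compPiece_le B (E n)))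

/-- Let `S` be the indices linked to `i` in both directions. The `S`-block is a representation of
the connected solvable group, contains the full torus and has no identically vanishing entry; hence
`S` has at most one element. -/
theorem eq_of_ent_ne_zero [CharZero K] (hdiag : ∀ g, IsDiag b g → g ∈ B)
    (hcl : IsClosed[(glInd b E).top] (B : Set (GLInf b)))
    (hsol : IsLocallySolvable b E B) {n : ℕ} {i j : ι} (hi : i ∈ E n) (hj : j ∈ E n)
    (hij : ∃ g ∈ compPiece B (E n), ent g i j ≠ 0) (hji : ∃ g ∈ compPiece B (E n), ent g j i ≠ 0) :
    i = j := by
  classical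
  let Γ := compPiece B (E n)
  have hΓpiece : ∀ g : Γ, g.1 ∈ glPiece b (E n) := fun g => (compPiece_le B (E n) g.2).2
  have htorus : ∀ t ∈ glPiece b (E n), IsDiag b t → t ∈ Γ := fun t ht htd =>
    diag_mem_compPiece hdiag ht htd
  have htrans : ∀ {k l m : ι}, l ∈ E n → (∃ g ∈ Γ, ent g k l ≠ 0) → (∃ g ∈ Γ, ent g l m ≠ 0) →
      ∃ g ∈ Γ, ent g k m ≠ 0 := fun hl h1 h2 => exists_ent_ne_zero_trans htorus hl h1 h2
  have hrefl : ∀ k, ∃ g ∈ Γ, ent g k k ≠ 0 := fun k => ⟨1, one_mem _, by simp [ent_one]⟩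
  let S : Finset ι := (E n).filter fun k => (∃ g ∈ Γ, ent g i k ≠ 0) ∧ ∃ g ∈ Γ, ent g k i ≠ 0
  have hS : ∀ {k}, k ∈ S ↔ k ∈ E n ∧ (∃ g ∈ Γ, ent g i k ≠ 0) ∧ ∃ g ∈ Γ, ent g k i ≠ 0 :=
    Finset.mem_filter
  let ρ : Γ →* Matrix S S K :=
    { toFun := fun g => Matrix.of fun k l => ent g.1 k l
      map_one' := by
        ext k l
        simp only [Matrix.of_apply, Subgroup.coe_one, ent_one, Matrix.one_apply, Subtype.ext_iff]
      map_mul' := by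
        intro g h
        ext k l
        rw [Matrix.mul_apply]
        show ent (g.1 * h.1) k l = ∑ m : S, ent g.1 k m * ent h.1 m l
        rw [ent_mul g.1 (hΓpiece h) k (hS.1 l.2).1, Finset.sum_coe_sort S fun m =>
          ent g.1 k m * ent h.1 m l]
        symm
        -- Multiplicativity of the block: an intermediate index that contributes is linked to `i`
        -- both ways by transitivity, so it already lies in `S`.
        refine Finset.sum_subset (Finset.filter_subset _ _) fun m hm hmS => ?_
        by_contra hne
        refine hmS (hS.2 ⟨hm, ?_, ?_⟩)
        · exact htrans (hS.1 k.2).1 (hS.1 k.2).2.1 ⟨g.1, g.2, left_ne_zero_of_mul hne⟩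
        · exact htrans (hS.1 l.2).1 ⟨h.1, h.2, right_ne_zero_of_mul hne⟩ (hS.1 l.2).2.2 }
  let _ := (zariski (subCoord Γ)).top
  have : PreconnectedSpace Γ := preconnectedSpace_identityComponent (inf_glSub_subset B (E n))
  have hsolv : Group.IsSolvable Γ := isSolvable_compPiece hcl hsol n
  have hsub : Subsingleton S := by
    refine subsingleton_of_isSolvable (ρ := ρ) ?_ ?_ ?_
    · intro f hf
      have h1 : f ∈ polyFun (subCoord Γ) :=
        comp_mem_polyFun (f := id) (d := fun (g : Γ) (p : S × S) => ρ g p.1 p.2)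
          (fun p => ent_mem_polyFun Γ p.1 p.2) hf
      exact isClosed_eq_zariski h1
    · intro d hd
      obtain ⟨t, ht, htd, hte⟩ := exists_diag b (I := E n)
        (d := fun k => if h : k ∈ S then d ⟨k, h⟩ else 1)
        (fun k => by split_ifs; exacts [hd _, one_ne_zero])
        (fun k hk => dif_neg fun h => hk (hS.1 h).1)
      refine ⟨⟨t, htorus t ht htd⟩, ?_⟩
      ext k l
      show ent t k l = _
      rw [ent, hte, dif_pos l.2]
      by_cases hkl : k = l
      · subst hkl
        simp
      · rw [Matrix.diagonal_apply_ne _ hkl]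
        simp [Finsupp.single_eq_of_ne fun h : (k : ι) = l => hkl (Subtype.ext h)]
    · intro k l
      obtain ⟨g, hg, hne⟩ := htrans hi (hS.1 k.2).2.2 (hS.1 l.2).2.1
      exact ⟨⟨g, hg⟩, hne⟩
  exact congrArg Subtype.val (hsub.elim ⟨i, hS.2 ⟨hi, hrefl i, hrefl i⟩⟩ ⟨j, hS.2 ⟨hj, hij, hji⟩⟩)

/-- A splitting Borel subgroup is the stabilizer of the maximal flag of a total order. -/
theorem exists_linearOrder_of_isSplittingBorel [CharZero K] (hE : Monotone E)
    (hEι : ∀ i, ∃ n, i ∈ E n) (hB : IsSplittingBorel b E B) :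
    ∃ o : LinearOrder ι, B = flagStabilizer b (@maxFlag _ _ _ _ _ _ o b) := by
  classical
  obtain ⟨⟨hdiag, hcl, hconn, hsol⟩, hmax⟩ := hB
  let r : ι → ι → Prop := fun i j => ∃ g ∈ B, ent g i j ≠ 0
  have hr : IsPartialOrder ι r :=
    { refl := fun i => ⟨1, one_mem B, by simp [ent_one]⟩
      trans := fun i j k h1 h2 => exists_ent_ne_zero_trans (I := {j}) (fun t _ htd => hdiag t htd)
        (Finset.mem_singleton_self j) h1 h2
      antisymm := by
        rintro i j ⟨g, hg, hgij⟩ ⟨h, hh, hhji⟩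
        obtain ⟨n₁, h₁⟩ := exists_mem_compPiece hE hcl hconn hg
        obtain ⟨n₂, h₂⟩ := exists_mem_compPiece hE hcl hconn hh
        obtain ⟨n₃, h₃⟩ := hEι i
        obtain ⟨n₄, h₄⟩ := hEι j
        let m := max (max n₁ n₂) (max n₃ n₄)
        have e₁ : n₁ ≤ m := (le_max_left _ _).trans (le_max_left _ _)
        have e₂ : n₂ ≤ m := (le_max_right _ _).trans (le_max_left _ _)
        have e₃ : n₃ ≤ m := (le_max_left _ _).trans (le_max_right _ _)
        have e₄ : n₄ ≤ m := (le_max_right _ _).trans (le_max_right _ _)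
        exact eq_of_ent_ne_zero hdiag hcl hsol (hE e₃ h₃) (hE e₄ h₄)
          ⟨g, compPiece_mono B (hE e₁) h₁, hgij⟩ ⟨h, compPiece_mono B (hE e₂) h₂, hhji⟩ }
  -- Any linear extension will do: its triangular group contains `B` and satisfies all the
  -- conditions for which `B` is maximal.
  obtain ⟨s, hs, hrs⟩ := extend_partialOrder r
  let o : LinearOrder ι :=
    { le := s
      le_refl := hs.refl
      le_trans := hs.trans
      le_antisymm := hs.antisymm
      le_total := hs.total
      toDecidableLE := Classical.decRel _ }
  refine ⟨o, ?_⟩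
  have hle : B ≤ flagStabilizer b (maxFlag b) := fun g hg =>
    mem_flagStabilizer_maxFlag.2 fun i j hne => hrs i j ⟨g, hg, hne⟩
  exact le_antisymm hle (hmax ⟨fun g hg => diag_mem_flagStabilizer_maxFlag hg,
    isClosed_flagStabilizer_maxFlag E, isConnected_flagStabilizer_maxFlag hE hEι,
    isLocallySolvable_flagStabilizer_maxFlag E⟩ hle)

end Borel

end GenFlag

open GenFlag in
theorem theorem1 {K : Type*} [Field K] [IsAlgClosed K] [CharZero K]
    {V : Type*} [AddCommGroup V] [Module K V]
    {ι : Type*} [Infinite ι] (b : Module.Basis ι K V)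
    (E : ℕ → Finset ι) (hE : Monotone E) (hEι : ∀ i, ∃ n, i ∈ E n)
    {A : Type*} [LinearOrder A] (σ₀ : ι → A) (hσ₀ : Function.Surjective σ₀)
    (B : Subgroup (GLInf b)) (hB : IsSplittingBorel b E B) :
    -- `B` is the stabilizer of the maximal flag of a unique total order on the basis
    (∃! o : LinearOrder ι, B = flagStabilizer b (@maxFlag _ _ _ _ _ _ o b)) ∧
    -- (a) `G(E)/P_F = Fl(F, E)`
    (∃ Φ : (GLInf b ⧸ flagStabilizer b (flagOf b σ₀)) ≃ Fl b (flagOf b σ₀),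
      (∀ g : GLInf b, (Φ g : Set (Submodule K V)) = act g.1 (flagOf b σ₀)) ∧
      (quotInd b E (flagStabilizer b (flagOf b σ₀))).IsIso (flInd b E σ₀) Φ) ∧
    -- the decomposition indexed by `W(E) · σ₀`
    (Fl b (flagOf b σ₀) = ⋃ σ ∈ WOrbit σ₀, cell b B σ) ∧
    (WOrbit σ₀).PairwiseDisjoint (fun σ => cell b B σ) ∧
    -- the decomposition indexed by `W(E) / W_P(E)`
    (∃ Ψ : (WInf ι ⧸ WPar σ₀) ≃ WOrbit σ₀,
      (∀ w : WInf ι, (Ψ w : ι → A) = wact w σ₀) ∧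
      (Fl b (flagOf b σ₀) = ⋃ q : WInf ι ⧸ WPar σ₀, cell b B (Ψ q : ι → A)) ∧
      Pairwise fun q q' : WInf ι ⧸ WPar σ₀ =>
        Disjoint (cell b B (Ψ q : ι → A)) (cell b B (Ψ q' : ι → A))) ∧
    -- in (b), (c), (d) the basis carries the total order that corresponds to `B`
    ∀ [LinearOrder ι], B = flagStabilizer b (maxFlag b) →
      -- (b)
      (∀ G ∈ Fl b (flagOf b σ₀), ∀ φ : flagOf b σ₀ ≃o G, IsCommensuration φ →
        ∀ σ ∈ WOrbit σ₀, (G ∈ cell b B σ ↔ IsRelPosition b σ₀ φ σ)) ∧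
      -- (c)
      (∀ σ ∈ WOrbit σ₀,
        @IsLocallyClosed _ (flInd b E σ₀).top (cellIn b σ₀ B σ) ∧
        ∃ f : cellIn b σ₀ B σ ≃ AffineSpc K (nInv σ),
          ((flInd b E σ₀).sub (cellIn b σ₀ B σ)).IsIso (affineInd K (nInv σ)) f) ∧
      -- (d)
      (∀ σ ∈ WOrbit σ₀, ∀ τ ∈ WOrbit σ₀,
        (cellIn b σ₀ B σ ⊆ @closure _ (flInd b E σ₀).top (cellIn b σ₀ B τ) ↔ BruhatLE σ τ)) := by
  -- The decomposition does not mention the order, but its proof needs one; it is shown for an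
  -- arbitrary order with stabilizer `B` and then applied to the one produced from `B`.
  have hab : ∀ o : LinearOrder ι, B = flagStabilizer b (@maxFlag _ _ _ _ _ _ o b) →
      (Fl b (flagOf b σ₀) = ⋃ σ ∈ WOrbit σ₀, cell b B σ) ∧
      ∀ σ ∈ WOrbit σ₀, ∀ τ ∈ WOrbit σ₀, σ ≠ τ → Disjoint (cell b B σ) (cell b B τ) := by
    rintro o rfl
    refine ⟨Set.Subset.antisymm (fun G hG => ?_) ?_, fun σ hσ τ hτ hne => ?_⟩
    · obtain ⟨w, hw⟩ := exists_cell_of_mem_Fl hE hEι hG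
      exact Set.mem_iUnion₂.2 ⟨wact w σ₀, ⟨w, rfl⟩, hw⟩
    · exact Set.iUnion₂_subset fun σ hσ => cell_subset_Fl hσ₀ _ hσ
    · exact Set.disjoint_left.2 fun G h1 h2 => hne (eq_of_mem_cell hσ₀ hσ hτ h1 h2)
  obtain ⟨o, ho⟩ := exists_linearOrder_of_isSplittingBorel hE hEι hB
  obtain ⟨hunion, hdisj⟩ := hab o ho
  obtain ⟨Ψ, hΨ⟩ := exists_quot_equiv_WOrbit σ₀
  refine ⟨⟨o, ho, fun o' ho' => linearOrder_eq_of_flagStabilizer_eq (ho'.symm.trans ho)⟩,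
    exists_quot_equiv_Fl hσ₀ hE hEι, hunion, hdisj, ⟨Ψ, hΨ, ?_, fun q q' hq => ?_⟩, ?_⟩
  · rw [hunion, Set.biUnion_eq_iUnion]
    exact (Ψ.surjective.iUnion_comp fun σ => cell b B (σ : ι → A)).symm
  · exact hdisj _ (Ψ q).2 _ (Ψ q').2 fun h => hq (Ψ.injective (Subtype.ext h))
  · rintro _ rfl
    exact ⟨fun G hG φ hφ σ hσ => mem_cell_iff_isRelPosition hE hEι hG hφ hσ,
      fun σ hσ => ⟨isLocallyClosed_cellIn hE hEι hσ₀ hσ, exists_cellIn_equiv_affineSpc hE hEι hσ₀ hσ⟩,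
      fun σ hσ τ hτ => cellIn_subset_closure_iff hE hEι hσ₀ hσ hτ⟩
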